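/- Let $N\ge 2$. Consider functions of $r$: a mass function $m$, a metric function $S$, magnetic gauge functions $\omega_1,\dots,\omega_{N-1}$ and electric gauge functions $\alpha_1,\dots,\alpha_N$ with $\sum_{j=1}^N\alpha_j=0$ (and $\omega_0=\omega_N=\alpha_0=\alpha_{N+1}=0$). Put $\mathcal E_j=\alpha_j-\alpha_{j+1}$, and for $k\in\{-1,0,1\}$ and $\ell>0$ (so that $\Lambda=-3/\ell^2$) put $\mu=k-\frac{2m}{r}+\frac{r^2}{\ell^2}$. The $\mathfrak{su}(N)$ Einstein–Yang–Mills field equations are $$m'=\frac{r^2\eta}{4S^2}+\frac{\zeta}{4\mu S^2}+\mu G+P,\qquad \frac{S'}{S}=\frac{\zeta}{2\mu^2S^2r}+\frac{2G}{r},$$ $$\mathcal E_j''=\Big(\frac{S'}{S}-\frac2r\Big)\mathcal E_j'+\frac{1}{\mu r^2}\big(2\omega_j^2\mathcal E_j-\omega_{j-1}^2\mathcal E_{j-1}-\omega_{j+1}^2\mathcal E_{j+1}\big),$$ $$\omega_j''=-\Big(\frac{S'}{S}+\frac{\mu'}{\mu}\Big)\omega_j'-\frac{\omega_j\mathcal E_j^2}{4\mu^2S^2}-\frac{W_j\omega_j}{\mu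 r^2},\qquad W_j=k-\omega_j^2+\tfrac12(\omega_{j+1}^2+\omega_{j-1}^2)$$ for $1\le j\le N-1$, where $\eta=\sum_{j=1}^N\alpha_j'^2$, $\zeta=\sum_{j=1}^{N-1}\omega_j^2\mathcal E_j^2$, $G=\sum_{j=1}^{N-1}\omega_j'^2$ and $P=\frac1{4r^2}\sum_{j=1}^N\big(\omega_j^2-\omega_{j-1}^2-k(N+1-2j)\big)^2$. A global solution on $[r_0,\infty)$ is one whose fields are real analytic on $[r_0,\infty)$, with $S>0$ there, with $\mu>0$ and the field equations valid for $r>r_0$, and whose fields are, for large $r$, convergent power series in $1/r$ with $S=1+O(r^{-4})$. A black hole with horizon $r_h>0$ and initial data $(\omega_{jh},\mathcal E'_{jh})$ is a global solution on $[r_h,\infty)$ with $\mu(r_h)=0<\mu'(r_h)$, $\alpha_j(r_h)=0$, $\omega_j(r_h)=\omega_{jh}$ and $\mathcal E_j'(r_h)=\mathcal E'_{jh}$. Put $\gamma_j=j(N-j)$ and $v_k^j=\frac{N-1}{N-j}\,{}_3F_2(-k,k+1,1-j;2,1-N;1)$ for $1\le j,k\le N-1$ (these are the eigenvectors, with eigenvalues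 $k(k+1)$, of the matrix $(2\delta_{ij}-\delta_{i-1,j}-\delta_{i+1,j})\gamma_j$). A soliton with initial data $(\breve\beta_k,\breve\theta_k)$ is a global solution on $[0,\infty)$ with curvature parameter $k=1$, such that $m=O(r^3)$ and $S=S(0)+O(r^2)$ at $0$, and $$\omega_j(r)=\sqrt{\gamma_j}\Big(1+\sum_{k=1}^{N-1}\bar\beta_k(r)v_k^jr^{k+1}\Big),\qquad \mathcal E_j(r)=\sum_{k=1}^{N-1}\bar\theta_k(r)v_k^jr^k$$ near $0$, with $\bar\beta_k,\bar\theta_k$ analytic at $0$, $\bar\beta_k(0)=\breve\beta_k$, $\bar\theta_k(0)=\breve\theta_k$. **Black holes.** Let $k\in\{-1,0,1\}$, $r_h>0$ and let $(\omega_{jh})\in\mathbb R^{N-1}$ be arbitrary. There are $\varepsilon,\ell_0>0$ such that for all $(\mathcal E'_{jh})$ with $|\mathcal E'_{jh}|<\varepsilon$ for every $j$ there is a family of functions $\breve m,S,\omega_j,\alpha_j$ of $(\ell,r)$, jointly real analytic at every point of $(-\ell_0,\ell_0)\times[r_h,\infty)$, such that for each $0<\ell<\ell_0$ the fields $m=\breve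 m(\ell,\cdot)/\ell^2$, $S(\ell,\cdot)$, $\omega_j(\ell,\cdot)$, $\alpha_j(\ell,\cdot)$ form a black hole with data $(\omega_{jh},\mathcal E'_{jh})$, for which $\omega_j$ has no zero on $[r_h,\infty)$ for each $j$ with $\omega_{jh}\ne0$. It is non-trivial: the $\alpha_j$ do not all vanish identically if some $\mathcal E'_{jh}\ne0$; the $\omega_j$ do not all vanish identically if some $\omega_{jh}\neq0$; and it is not an embedded $\mathfrak{su}(2)$ solution (that is, not of the form $\omega_j=\sqrt{\gamma_j}\,\omega$, $\alpha_j=(N+1-2j)\alpha$ for functions $\omega,\alpha$ of $r$) unless $\omega_{jh}=c\sqrt{\gamma_j}$ and $\mathcal E'_{jh}=d$ for some constants $c,d$ and all $j$. **Solitons.** Let $(\breve\beta_k)\in\mathbb R^{N-1}$ be arbitrary. There are $\varepsilon,\ell_0>0$ such that for all $(\breve\theta_k)$ with $|\breve\theta_k|<\varepsilon$ for every $k$ there is a family of functions $\breve m,S,\omega_j,\alpha_j$ and amplitudes $\bar\beta_k,\bar\theta_k$ of $(\ell,x)$, jointly real analytic at every point of $(-\ell_0,\ell_0)\times[0,\infty)$,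 such that for each $0<\ell<\ell_0$ the fields $m(r)=\ell\,\breve m(\ell,r/\ell)$, $S(\ell,r/\ell)$, $\omega_j(\ell,r/\ell)$, $\alpha_j(\ell,r/\ell)$ form a soliton with data $(\breve\beta_k,\breve\theta_k)$, the two displayed mode expansions hold for all $r\ge0$ with amplitudes $\bar\beta_k(\ell,r/\ell)$, $\bar\theta_k(\ell,r/\ell)$, and no $\omega_j$ has a zero on $[0,\infty)$. It is non-trivial: the $\omega_j$ do not all vanish identically; the $\alpha_j$ do not all vanish identically if some $\breve\theta_k\ne0$; and it is not an embedded $\mathfrak{su}(2)$ solution if $\breve\beta_k\neq0$ or $\breve\theta_k\ne0$ for some $k\ge2$. -/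

import Mathlib

open Filter Topology Set

/-- The field variables: mass function `m`, metric function `S`, magnetic gauge functions `ω j`
(`1 ≤ j ≤ N - 1`) and electric gauge functions `α j` (`1 ≤ j ≤ N`), all functions of the radius. -/
structure EYMFields where
  m : ℝ → ℝ
  S : ℝ → ℝ
  ω : ℕ → ℝ → ℝ
  α : ℕ → ℝ → ℝ

namespace EYMFields

/-- `𝓔_j = α_j - α_{j+1}`. -/
def elec (F : EYMFields) (j : ℕ) (r : ℝ) : ℝ := F.α j r - F.α (j + 1) r

/-- `μ(r) = k - 2 m(r) / r + r² / ℓ²`. -/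
noncomputable def mu (F : EYMFields) (k : ℤ) (ℓ r : ℝ) : ℝ :=
  (k : ℝ) - 2 * F.m r / r + r ^ 2 / ℓ ^ 2

/-- `η = ∑_{j=1}^N (α_j')²`. -/
noncomputable def eta (F : EYMFields) (N : ℕ) (r : ℝ) : ℝ :=
  ∑ j ∈ Finset.Icc 1 N, (deriv (F.α j) r) ^ 2

/-- `ζ = ∑_{j=1}^{N-1} ω_j² (α_j - α_{j+1})²`. -/
def zeta (F : EYMFields) (N : ℕ) (r : ℝ) : ℝ :=
  ∑ j ∈ Finset.Icc 1 (N - 1), (F.ω j r) ^ 2 * (F.elec j r) ^ 2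

/-- `G = ∑_{j=1}^{N-1} (ω_j')²`. -/
noncomputable def gradG (F : EYMFields) (N : ℕ) (r : ℝ) : ℝ :=
  ∑ j ∈ Finset.Icc 1 (N - 1), (deriv (F.ω j) r) ^ 2

/-- `P = (1 / 4r²) ∑_{j=1}^N (ω_j² - ω_{j-1}² - k (N + 1 - 2j))²`. -/
noncomputable def potP (F : EYMFields) (N : ℕ) (k : ℤ) (r : ℝ) : ℝ :=
  1 / (4 * r ^ 2) * ∑ j ∈ Finset.Icc 1 N,
    ((F.ω j r) ^ 2 - (F.ω (j - 1) r) ^ 2 - (k : ℝ) * ((N : ℝ) + 1 - 2 * (j : ℝ))) ^ 2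

/-- `W_j = k - ω_j² + (ω_{j+1}² + ω_{j-1}²) / 2`. -/
noncomputable def potW (F : EYMFields) (k : ℤ) (j : ℕ) (r : ℝ) : ℝ :=
  (k : ℝ) - (F.ω j r) ^ 2 + 1 / 2 * ((F.ω (j + 1) r) ^ 2 + (F.ω (j - 1) r) ^ 2)

/-- `𝓩_j = 2 ω_j² 𝓔_j - ω_{j-1}² 𝓔_{j-1} - ω_{j+1}² 𝓔_{j+1}`. -/
def potZ (F : EYMFields) (j : ℕ) (r : ℝ) : ℝ :=
  2 * (F.ω j r) ^ 2 * F.elec j r - (F.ω (j - 1) r) ^ 2 * F.elec (j - 1) r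
    - (F.ω (j + 1) r) ^ 2 * F.elec (j + 1) r

/-- The two Einstein equations and the `2N - 2` Yang–Mills equations at the radius `r`. -/
def FieldEquations (F : EYMFields) (N : ℕ) (k : ℤ) (ℓ r : ℝ) : Prop :=
  deriv F.m r = r ^ 2 * F.eta N r / (4 * F.S r ^ 2) + F.zeta N r / (4 * F.mu k ℓ r * F.S r ^ 2)
      + F.mu k ℓ r * F.gradG N r + F.potP N k r ∧
  deriv F.S r / F.S r = F.zeta N r / (2 * F.mu k ℓ r ^ 2 * F.S r ^ 2 * r)
      + 2 * F.gradG N r / r ∧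
  (∀ j ∈ Finset.Icc 1 (N - 1),
    deriv (deriv (F.elec j)) r = (deriv F.S r / F.S r - 2 / r) * deriv (F.elec j) r
      + 1 / (F.mu k ℓ r * r ^ 2) * F.potZ j r) ∧
  (∀ j ∈ Finset.Icc 1 (N - 1),
    deriv (deriv (F.ω j)) r
      = -(deriv F.S r / F.S r + deriv (F.mu k ℓ) r / F.mu k ℓ r) * deriv (F.ω j) r
        - 1 / (4 * F.mu k ℓ r ^ 2 * F.S r ^ 2) * F.ω j r * (F.elec j r) ^ 2
        - F.potW k j r * F.ω j r / (F.mu k ℓ r * r ^ 2))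

/-- The conventions `ω_0 = ω_N = α_0 = α_{N+1} = 0` and the tracelessness `∑_{j=1}^N α_j = 0`. -/
def IsSuN (F : EYMFields) (N : ℕ) : Prop :=
  ∀ r, F.ω 0 r = 0 ∧ F.ω N r = 0 ∧ F.α 0 r = 0 ∧ F.α (N + 1) r = 0 ∧
    ∑ j ∈ Finset.Icc 1 N, F.α j r = 0

/-- All field variables are regular (real analytic) on `[r₀, ∞)`, the end point included. -/
def IsRegular (F : EYMFields) (N : ℕ) (r₀ : ℝ) : Prop :=
  AnalyticOnNhd ℝ F.m (Ici r₀) ∧ AnalyticOnNhd ℝ F.S (Ici r₀) ∧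
  (∀ j ∈ Finset.Icc 1 (N - 1), AnalyticOnNhd ℝ (F.ω j) (Ici r₀)) ∧
  (∀ j ∈ Finset.Icc 1 N, AnalyticOnNhd ℝ (F.α j) (Ici r₀))

/-- Boundary conditions at infinity: the fields are given by convergent power series in `1 / r`,
with `S = 1 + O(r⁻⁴)`. -/
def IsAsymptoticallyAdS (F : EYMFields) (N : ℕ) : Prop :=
  ∃ (m' S' : ℝ → ℝ) (ω' α' : ℕ → ℝ → ℝ),
    AnalyticAt ℝ m' 0 ∧ AnalyticAt ℝ S' 0 ∧
    (∀ j ∈ Finset.Icc 1 (N - 1), AnalyticAt ℝ (ω' j) 0) ∧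
    (∀ j ∈ Finset.Icc 1 N, AnalyticAt ℝ (α' j) 0) ∧
    (fun x => S' x - 1) =O[𝓝 0] (fun x : ℝ => x ^ 4) ∧
    ∀ᶠ r in atTop, F.m r = m' r⁻¹ ∧ F.S r = S' r⁻¹ ∧
      (∀ j ∈ Finset.Icc 1 (N - 1), F.ω j r = ω' j r⁻¹) ∧
      (∀ j ∈ Finset.Icc 1 N, F.α j r = α' j r⁻¹)

/-- A global solution on `r > r₀` of the field equations, regular on `[r₀, ∞)`, with `μ > 0` for
`r > r₀`, that satisfies the boundary conditions at infinity. -/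
def IsGlobalSolution (F : EYMFields) (N : ℕ) (k : ℤ) (ℓ r₀ : ℝ) : Prop :=
  F.IsSuN N ∧ F.IsRegular N r₀ ∧ (∀ r, r₀ ≤ r → 0 < F.S r) ∧ (∀ r, r₀ < r → 0 < F.mu k ℓ r) ∧
    (∀ r, r₀ < r → F.FieldEquations N k ℓ r) ∧ F.IsAsymptoticallyAdS N

/-- A black hole with a regular non-extremal event horizon at `rh`, with the initial values
`ω_j(rh) = w_j` and `𝓔_j'(rh) = e_j`. -/
def IsBlackHole (F : EYMFields) (N : ℕ) (k : ℤ) (ℓ rh : ℝ) (w e : ℕ → ℝ) : Prop :=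
  F.IsGlobalSolution N k ℓ rh ∧ F.mu k ℓ rh = 0 ∧ 0 < deriv (F.mu k ℓ) rh ∧
    (∀ j ∈ Finset.Icc 1 N, F.α j rh = 0) ∧
    (∀ j ∈ Finset.Icc 1 (N - 1), F.ω j rh = w j ∧ deriv (F.elec j) rh = e j)

end EYMFields

/-- The Hahn polynomial `Q_k(x) = ₃F₂(-k, k+1, -x; 2, 1-N; 1)` (for `k ≤ N - 1`). -/
noncomputable def hahnQ (N k : ℕ) (x : ℝ) : ℝ :=
  ∑ i ∈ Finset.range (k + 1),
    (ascPochhammer ℝ i).eval (-(k : ℝ)) * (ascPochhammer ℝ i).eval ((k : ℝ) + 1)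
        * (ascPochhammer ℝ i).eval (-x)
      / ((ascPochhammer ℝ i).eval 2 * (ascPochhammer ℝ i).eval (1 - (N : ℝ)) * (i.factorial : ℝ))

/-- The component `v_k^j = (N - 1) / (N - j) Q_k(j - 1)` (`1 ≤ j, k ≤ N - 1`) of the right
eigenvector, of eigenvalue `k (k + 1)`, of the matrix `A^i_j = (2δ^i_j - δ^{i-1}_j - δ^{i+1}_j) γ_j`,
where `γ_j = j (N - j)`. -/
noncomputable def modeVec (N k j : ℕ) : ℝ :=
  ((N : ℝ) - 1) / ((N : ℝ) - (j : ℝ)) * hahnQ N k ((j : ℝ) - 1)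

/-- `√γ_j = √(j (N - j))`. -/
noncomputable def sqrtGamma (N j : ℕ) : ℝ := Real.sqrt ((j : ℝ) * ((N : ℝ) - (j : ℝ)))

namespace EYMFields

/-- At the radius `r` the magnetic and electric gauge functions have the eigenmode amplitudes
`b k` and `t k`: `ω_j = √γ_j (1 + ∑_k b_k v_k^j r^{k+1})` and `𝓔_j = ∑_k t_k v_k^j r^k`. -/
def HasModes (F : EYMFields) (N : ℕ) (r : ℝ) (b t : ℕ → ℝ) : Prop :=
  ∀ j ∈ Finset.Icc 1 (N - 1),
    F.ω j r = sqrtGamma N j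
      * (1 + ∑ i ∈ Finset.Icc 1 (N - 1), b i * modeVec N i j * r ^ (i + 1)) ∧
    F.elec j r = ∑ i ∈ Finset.Icc 1 (N - 1), t i * modeVec N i j * r ^ i

/-- A soliton (`k = 1`), regular at the origin, whose mode amplitudes, analytic at the origin,
take the initial values `β_k` and `θ_k` there. -/
def IsSoliton (F : EYMFields) (N : ℕ) (ℓ : ℝ) (β θ : ℕ → ℝ) : Prop :=
  F.IsGlobalSolution N 1 ℓ 0 ∧
    F.m =O[𝓝 0] (fun r : ℝ => r ^ 3) ∧ (fun r => F.S r - F.S 0) =O[𝓝 0] (fun r : ℝ => r ^ 2) ∧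
    ∃ b t : ℕ → ℝ → ℝ,
      (∀ i ∈ Finset.Icc 1 (N - 1), AnalyticAt ℝ (b i) 0 ∧ AnalyticAt ℝ (t i) 0 ∧
        b i 0 = β i ∧ t i 0 = θ i) ∧
      ∀ᶠ r in 𝓝 0, F.HasModes N r (fun i => b i r) (fun i => t i r)

/-- The electric gauge functions vanish identically. -/
def IsPurelyMagnetic (F : EYMFields) (N : ℕ) (r₀ : ℝ) : Prop :=
  ∀ j ∈ Finset.Icc 1 N, ∀ r, r₀ < r → F.α j r = 0

/-- The magnetic gauge functions vanish identically (the Abelian, Reissner–Nordström type case). -/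
def IsAbelian (F : EYMFields) (N : ℕ) (r₀ : ℝ) : Prop :=
  ∀ j ∈ Finset.Icc 1 (N - 1), ∀ r, r₀ < r → F.ω j r = 0

/-- The gauge functions are those of an embedded `su(2)` field. -/
def IsEmbeddedSU2 (F : EYMFields) (N : ℕ) (r₀ : ℝ) : Prop :=
  ∃ w a : ℝ → ℝ, ∀ r, r₀ < r →
    (∀ j ∈ Finset.Icc 1 (N - 1), F.ω j r = sqrtGamma N j * w r) ∧
    (∀ j ∈ Finset.Icc 1 N, F.α j r = ((N : ℝ) + 1 - 2 * (j : ℝ)) * a r)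

/-- No magnetic gauge function `ω_j` with `j ∈ J` has a zero on `[r₀, ∞)`. -/
def IsNodeless (F : EYMFields) (J : Set ℕ) (r₀ : ℝ) : Prop :=
  ∀ j ∈ J, ∀ r, r₀ ≤ r → F.ω j r ≠ 0

/-- The family `G` of rescaled fields, indexed by `ℓ`, is jointly real analytic in `(ℓ, x)` for
`|ℓ| < ℓ₀` and `x ≥ x₀`. -/
def IsAnalyticFamily (G : ℝ → EYMFields) (N : ℕ) (ℓ₀ x₀ : ℝ) : Prop :=
  AnalyticOnNhd ℝ (fun p : ℝ × ℝ => (G p.1).m p.2) (Ioo (-ℓ₀) ℓ₀ ×ˢ Ici x₀) ∧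
  AnalyticOnNhd ℝ (fun p : ℝ × ℝ => (G p.1).S p.2) (Ioo (-ℓ₀) ℓ₀ ×ˢ Ici x₀) ∧
  (∀ j ∈ Finset.Icc 1 (N - 1),
    AnalyticOnNhd ℝ (fun p : ℝ × ℝ => (G p.1).ω j p.2) (Ioo (-ℓ₀) ℓ₀ ×ˢ Ici x₀)) ∧
  (∀ j ∈ Finset.Icc 1 N,
    AnalyticOnNhd ℝ (fun p : ℝ × ℝ => (G p.1).α j p.2) (Ioo (-ℓ₀) ℓ₀ ×ˢ Ici x₀))

/-- The fields whose rescaled mass function is `ℓ² m(r)` (black holes). -/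
noncomputable def ofBlackHoleScaling (ℓ : ℝ) (G : EYMFields) : EYMFields where
  m := fun r => G.m r / ℓ ^ 2
  S := G.S
  ω := G.ω
  α := G.α

/-- The fields written in the variable `x = r / ℓ`, with rescaled mass function `m(ℓ x) / ℓ`
(solitons). -/
noncomputable def ofSolitonScaling (ℓ : ℝ) (G : EYMFields) : EYMFields where
  m := fun r => ℓ * G.m (r / ℓ)
  S := fun r => G.S (r / ℓ)
  ω := fun j r => G.ω j (r / ℓ)
  α := fun j r => G.α j (r / ℓ)

end EYMFields

/-! Both families are perturbations of `ℓ = 0`, carried out in a Banach algebra of power series in a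
compactified radius whose disc of convergence contains the whole radial range, infinity included. A
solution found there is automatically global, regular at the inner end point and analytic at
infinity, so no local solution has to be continued. For black holes the variable is `x = 1 - r_h / r
∈ [0, 1]`; for solitons it is `x = arctan (r / ℓ) ∈ [0, π / 2]`. The radius `8 / 5` exceeds `1` and
`π / 2`, yet is small enough for `x / sin x` (first pole at `π`) and `1 / (3 - 3 x + x²)` (poles of
modulus `√3`) to belong to the algebra `Wiener`.

The equations are integrated with the operators `avg`, which are bounded and select the solution
regular at the singular end point. The inverses of `S` and of the normalised `μ` are kept as
separate unknowns, so that everything is polynomial, and the system takes the form `L u = u₀(p) + ℓ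
T(ℓ, p, u)` with `L` invertible and `p` the electric data. The analytic inverse function theorem
(`exists_analytic_solution`) solves it for small `ℓ` and `p`; `analyticAt_ev` turns analytic
dependence on `ℓ` into joint analyticity.

Black holes: with the mass scaled by `ℓ²`, the limit `ℓ = 0` is explicit. There `ℓ² μ / r² = 1 -
(r_h / r)³ = x (3 - 3 x + x²)`, `S = 1`, the `ω_j` are constant and the `𝓔_j` are affine in `x`; the
Yang-Mills sources carry `1 / μ = O(ℓ²)`. Here `L` is the identity.

Solitons: the limit is anti-de Sitter space with `ω_j = √γ_j`, and the perturbations decouple into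
modes along the eigenvectors `v_k`. Each mode satisfies a linear Volterra equation. Powers of its
operator decay factorially, so it is solvable for all data without smallness
(`isUnit_one_sub_modeOp`). The nonlinear terms must respect the required vanishing of mode `k` at
the origin. They do because `v_k^j` is a polynomial in `j` of degree `k - 1`: the Hahn polynomial
vanishes at `N - 1`, which cancels the denominator `N - j`. Hence `v_k v_l` involves only `v_i` with
`i ≤ k + l - 1` (`exists_modeVec_mul`), exactly what grading by powers of `ℓ sin x = r cos x`
requires (`modeSum_modeMul`).

Positivity of `μ` and `S` and absence of zeros of `ω_j` are open conditions, valid at the limit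
point. Non-triviality follows by passing to the inner end point, where the data are recovered from
the fields; for solitons this uses the independence of the `v_k` and `v_1 = 1`. -/

/-! ### The Banach algebra of convergent power series. -/

/-- The common radius of convergence of the power series used below. -/
noncomputable def convRadius : ℝ := 8 / 5

theorem convRadius_pos : 0 < convRadius := by norm_num [convRadius]

/-- The real power series that converge absolutely on the closed disc of radius `convRadius`. -/
noncomputable def wienerSubalgebra : Subalgebra ℝ (PowerSeries ℝ) where
  carrier := {f | Summable fun n => ‖PowerSeries.coeff n f * convRadius ^ n‖}
  mul_mem' := by
    intro f g hf hg
    have h := summable_norm_sum_mul_antidiagonal_of_summable_norm hf hg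
    refine h.congr fun n => ?_
    rw [PowerSeries.coeff_mul, Finset.sum_mul]
    congr 1
    refine Finset.sum_congr rfl fun p hp => ?_
    rw [← Finset.HasAntidiagonal.mem_antidiagonal.1 hp, pow_add]
    ring
  add_mem' := by
    intro f g hf hg
    refine Summable.of_nonneg_of_le (fun _ => norm_nonneg _) (fun n => ?_) (hf.add hg)
    rw [map_add, add_mul]
    exact norm_add_le _ _
  algebraMap_mem' := by
    intro r
    refine summable_of_ne_finset_zero (s := {0}) fun n hn => ?_
    have : n ≠ 0 := by simpa using hn
    simp [PowerSeries.coeff_C, this]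

/-- The Banach algebra of real power series that converge absolutely on the closed disc of radius
`convRadius`. -/
def Wiener : Type := wienerSubalgebra

namespace Wiener

noncomputable instance : CommRing Wiener := inferInstanceAs (CommRing wienerSubalgebra)
noncomputable instance : Algebra ℝ Wiener := inferInstanceAs (Algebra ℝ wienerSubalgebra)

/-- The coefficients of a power series. -/
noncomputable def coeff (n : ℕ) : Wiener →ₗ[ℝ] ℝ :=
  (PowerSeries.coeff n).comp wienerSubalgebra.val.toLinearMap

theorem summable_coeff (f : Wiener) : Summable fun n => ‖coeff n f * convRadius ^ n‖ := f.2

@[ext] theorem ext {f g : Wiener} (h : ∀ n, coeff n f = coeff n g) : f = g :=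
  Subtype.ext (PowerSeries.ext h)

/-- The power series with given coefficients. -/
noncomputable def mk (a : ℕ → ℝ) (ha : Summable fun n => ‖a n * convRadius ^ n‖) : Wiener :=
  ⟨PowerSeries.mk a, by
    show Summable fun n => ‖PowerSeries.coeff n (PowerSeries.mk a) * convRadius ^ n‖
    simpa only [PowerSeries.coeff_mk] using ha⟩

@[simp] theorem coeff_mk (a : ℕ → ℝ) (ha) (n : ℕ) : coeff n (mk a ha) = a n :=
  PowerSeries.coeff_mk n a

theorem coeff_mul (f g : Wiener) (n : ℕ) :
    coeff n (f * g) = ∑ p ∈ Finset.HasAntidiagonal.antidiagonal n, coeff p.1 f * coeff p.2 g :=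
  PowerSeries.coeff_mul n f.1 g.1

theorem coeff_one (n : ℕ) : coeff n (1 : Wiener) = if n = 0 then 1 else 0 :=
  PowerSeries.coeff_one n

theorem coeff_algebraMap (r : ℝ) (n : ℕ) :
    coeff n (algebraMap ℝ Wiener r) = if n = 0 then r else 0 :=
  PowerSeries.coeff_C n r

theorem tsum_norm_mul_le (f g : Wiener) :
    ∑' n, ‖coeff n (f * g) * convRadius ^ n‖ ≤
      (∑' n, ‖coeff n f * convRadius ^ n‖) * ∑' n, ‖coeff n g * convRadius ^ n‖ := by
  have hf : Summable fun n => ‖‖coeff n f * convRadius ^ n‖‖ := by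
    simpa only [norm_norm] using summable_coeff f
  have hg : Summable fun n => ‖‖coeff n g * convRadius ^ n‖‖ := by
    simpa only [norm_norm] using summable_coeff g
  rw [tsum_mul_tsum_eq_tsum_sum_antidiagonal_of_summable_norm hf hg]
  refine (summable_coeff (f * g)).tsum_le_tsum (fun n => ?_)
    (summable_norm_sum_mul_antidiagonal_of_summable_norm hf hg).of_norm
  rw [coeff_mul, Finset.sum_mul]
  refine (norm_sum_le _ _).trans (Finset.sum_le_sum fun p hp => le_of_eq ?_)
  rw [← norm_mul, ← Finset.HasAntidiagonal.mem_antidiagonal.1 hp, pow_add]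
  congr 1
  ring

/-- The weighted `ℓ¹` norm. -/
noncomputable def ringNorm : RingNorm Wiener where
  toFun f := ∑' n, ‖coeff n f * convRadius ^ n‖
  map_zero' := by simp
  neg' f := by simp
  add_le' f g := by
    rw [← (summable_coeff f).tsum_add (summable_coeff g)]
    refine (summable_coeff (f + g)).tsum_le_tsum (fun n => ?_)
      ((summable_coeff f).add (summable_coeff g))
    rw [map_add, add_mul]
    exact norm_add_le _ _
  mul_le' f g := tsum_norm_mul_le f g
  eq_zero_of_map_eq_zero' f hf := by
    ext n
    have h := (hasSum_zero_iff_of_nonneg (fun n => norm_nonneg _)).1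
      (show HasSum (fun n => ‖coeff n f * convRadius ^ n‖) 0 from
        hf ▸ (summable_coeff f).hasSum)
    have := congrFun h n
    simpa [convRadius_pos.ne'] using this

noncomputable instance : NormedCommRing Wiener :=
  { ringNorm.toNormedRing, (inferInstance : CommRing Wiener) with }

theorem norm_def (f : Wiener) : ‖f‖ = ∑' n, ‖coeff n f * convRadius ^ n‖ := rfl

noncomputable instance : NormedAlgebra ℝ Wiener :=
  { (inferInstance : Algebra ℝ Wiener) with
    norm_smul_le := fun r f => by
      simp only [norm_def, map_smul, smul_eq_mul, mul_assoc]
      simp only [norm_mul r, tsum_mul_left]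
      exact le_rfl }

theorem hasSum_norm (f : Wiener) : HasSum (fun n => ‖coeff n f * convRadius ^ n‖) ‖f‖ :=
  (summable_coeff f).hasSum

theorem norm_coeff_le (n : ℕ) (f : Wiener) : ‖coeff n f‖ * convRadius ^ n ≤ ‖f‖ := by
  have := le_hasSum (hasSum_norm f) n fun _ _ => norm_nonneg _
  rwa [norm_mul, norm_pow, Real.norm_of_nonneg convRadius_pos.le] at this

theorem norm_le_of_coeff_le {f : Wiener} {a : ℕ → ℝ} {A : ℝ} (ha : HasSum a A)
    (h : ∀ n, ‖coeff n f * convRadius ^ n‖ ≤ a n) : ‖f‖ ≤ A :=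
  hasSum_le h (hasSum_norm f) ha

/-- The isometry with the unweighted sequence space. -/
noncomputable def isometryLp : Wiener ≃ᵢ lp (fun _ : ℕ => ℝ) 1 where
  toFun f := ⟨fun n => coeff n f * convRadius ^ n, by
    have := summable_coeff f
    exact memℓp_gen (by simpa using this)⟩
  invFun a := mk (fun n => a n / convRadius ^ n) (by
    have h := (memℓp_gen_iff (p := 1) (by simp)).1 a.2
    refine h.congr fun n => ?_
    simp only [ENNReal.toReal_one, Real.rpow_one]
    rw [div_mul_cancel₀ _ (pow_ne_zero _ convRadius_pos.ne')])
  left_inv f := by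
    ext n
    simp [convRadius_pos.ne']
  right_inv a := by
    ext n
    simp [convRadius_pos.ne']
  isometry_toFun := by
    refine Isometry.of_dist_eq fun f g => ?_
    rw [dist_eq_norm, dist_eq_norm, lp.norm_eq_tsum_rpow (by simp), norm_def]
    simp only [ENNReal.toReal_one, Real.rpow_one, one_div, inv_one, map_sub, sub_mul]
    exact tsum_congr fun n => rfl

/-- Completeness is inherited from `ℓ¹`; the Neumann series and the inverse function theorem rest on
it. -/
instance : CompleteSpace Wiener := isometryLp.completeSpace_iff.2 inferInstance

instance : NormOneClass Wiener where
  norm_one := by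
    rw [norm_def, tsum_eq_single 0 (fun n hn => by simp [coeff_one, hn])]
    simp [coeff_one]

/-- The coefficients as continuous functionals. -/
noncomputable def coeffL (n : ℕ) : Wiener →L[ℝ] ℝ :=
  (coeff n).mkContinuous (convRadius ^ n)⁻¹ fun f => by
    have h := norm_coeff_le n f
    have hp := pow_pos convRadius_pos n
    rw [inv_mul_eq_div, le_div_iff₀ hp]
    exact h

theorem norm_coeffL_le (n : ℕ) : ‖coeffL n‖ ≤ (convRadius ^ n)⁻¹ :=
  LinearMap.mkContinuous_norm_le _ (by have := convRadius_pos; positivity) _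

/-- The value at `x` of a power series. -/
noncomputable def ev (f : Wiener) (x : ℝ) : ℝ := ∑' n, coeff n f * x ^ n

theorem norm_term_le (f : Wiener) {x : ℝ} (hx : |x| ≤ convRadius) (n : ℕ) :
    ‖coeff n f * x ^ n‖ ≤ ‖coeff n f * convRadius ^ n‖ := by
  rw [norm_mul, norm_mul, norm_pow, norm_pow, Real.norm_of_nonneg convRadius_pos.le]
  gcongr
  exact hx

theorem summable_norm_ev (f : Wiener) {x : ℝ} (hx : |x| ≤ convRadius) :
    Summable fun n => ‖coeff n f * x ^ n‖ :=
  (summable_coeff f).of_nonneg_of_le (fun _ => norm_nonneg _) (norm_term_le f hx)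

theorem hasSum_ev (f : Wiener) {x : ℝ} (hx : |x| ≤ convRadius) :
    HasSum (fun n => coeff n f * x ^ n) (ev f x) :=
  (summable_norm_ev f hx).of_norm.hasSum

theorem abs_ev_le (f : Wiener) {x : ℝ} (hx : |x| ≤ convRadius) : |ev f x| ≤ ‖f‖ :=
  (norm_tsum_le_tsum_norm (summable_norm_ev f hx)).trans
    ((summable_norm_ev f hx).tsum_le_tsum (norm_term_le f hx) (summable_coeff f))

/-- Evaluation at a point of the disc of convergence, as a homomorphism. -/
noncomputable def evHom (x : ℝ) (hx : |x| ≤ convRadius) : Wiener →ₐ[ℝ] ℝ where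
  toFun f := ev f x
  map_one' := by
    rw [ev, tsum_eq_single 0 (fun n hn => by simp [coeff_one, hn])]
    simp [coeff_one]
  map_zero' := by simp [ev]
  map_add' f g := by
    refine ((hasSum_ev (f + g) hx).unique ?_)
    simpa [add_mul] using (hasSum_ev f hx).add (hasSum_ev g hx)
  map_mul' f g := by
    show ev (f * g) x = ev f x * ev g x
    have h := tsum_mul_tsum_eq_tsum_sum_antidiagonal_of_summable_norm
      (summable_norm_ev f hx) (summable_norm_ev g hx)
    rw [ev, ev, ev, h]
    refine tsum_congr fun n => ?_
    rw [coeff_mul, Finset.sum_mul]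
    refine Finset.sum_congr rfl fun p hp => ?_
    rw [← Finset.HasAntidiagonal.mem_antidiagonal.1 hp, pow_add]
    ring
  commutes' r := by
    show ev (algebraMap ℝ Wiener r) x = r
    rw [ev, tsum_eq_single 0 (fun n hn => by simp [coeff_algebraMap, hn])]
    simp [coeff_algebraMap]

theorem evHom_apply (x : ℝ) (hx : |x| ≤ convRadius) (f : Wiener) : evHom x hx f = ev f x := rfl

/-- The coordinate function. -/
noncomputable def X : Wiener := mk (fun n => if n = 1 then 1 else 0)
  (summable_of_ne_finset_zero (s := {1}) fun n hn => by
    have : n ≠ 1 := by simpa using hn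
    simp [this])

theorem ev_X (x : ℝ) : ev X x = x := by
  rw [ev, tsum_eq_single 1 (fun n hn => by simp [X, hn])]
  simp [X]

theorem norm_X : ‖X‖ = convRadius := by
  rw [norm_def, tsum_eq_single 1 (fun n hn => by simp [X, hn])]
  simp [X, abs_of_pos convRadius_pos]

theorem coeff_X_mul_zero (f : Wiener) : coeff 0 (X * f) = 0 := by
  simp [coeff_mul, X]

theorem coeff_X_mul_succ (f : Wiener) (n : ℕ) : coeff (n + 1) (X * f) = coeff n f := by
  rw [coeff_mul, Finset.sum_eq_single (1, n)]
  · simp [X]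
  · rintro ⟨i, j⟩ hij hne
    have : i ≠ 1 := by
      rintro rfl
      refine hne ?_
      have := Finset.HasAntidiagonal.mem_antidiagonal.1 hij
      simp only [Prod.mk.injEq, true_and]
      simp only at this
      omega
    simp [X, this]
  · intro h
    exact absurd (Finset.HasAntidiagonal.mem_antidiagonal.2 (by simp [add_comm])) h

/-! ### Averaging operators. -/

/-- The averaging operator `f ↦ x⁻ᵖ ∫₀ˣ tᵖ⁻¹ f(t) dt`. -/
noncomputable def avg (p : ℕ) : Wiener →L[ℝ] Wiener :=
  LinearMap.mkContinuous
    { toFun := fun f => mk (fun n => coeff n f / ((n : ℝ) + p)) (by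
        -- For `p = 0` the constant coefficient is divided by `0` and so becomes `0`; the other
        -- coefficients do not grow, which leaves the bound `1`.
        by_cases hp : p = 0
        · refine (summable_coeff f).of_nonneg_of_le (fun _ => norm_nonneg _) fun n => ?_
          subst hp
          rw [norm_mul, norm_mul, norm_div]
          refine mul_le_mul_of_nonneg_right ?_ (norm_nonneg _)
          rcases Nat.eq_zero_or_pos n with rfl | hn
          · simp
          · refine div_le_self (norm_nonneg _) ?_
            have : (1 : ℝ) ≤ n := by exact_mod_cast hn
            simp only [CharP.cast_eq_zero, add_zero, RCLike.norm_natCast, this]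
        · refine (summable_coeff f).of_nonneg_of_le (fun _ => norm_nonneg _) fun n => ?_
          rw [norm_mul, norm_mul, norm_div]
          refine mul_le_mul_of_nonneg_right ?_ (norm_nonneg _)
          refine div_le_self (norm_nonneg _) ?_
          have : (1 : ℝ) ≤ p := by exact_mod_cast Nat.pos_of_ne_zero hp
          have hn : (0 : ℝ) ≤ n := n.cast_nonneg
          rw [Real.norm_of_nonneg (by positivity)]
          linarith)
      map_add' := fun f g => by
        ext n
        simp [add_div]
      map_smul' := fun r f => by
        ext n
        simp [mul_div_assoc] } (if p = 0 then 1 else (p : ℝ)⁻¹) fun f => by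
    have hs := (hasSum_norm f).mul_left (if p = 0 then 1 else (p : ℝ)⁻¹)
    refine norm_le_of_coeff_le hs fun n => ?_
    simp only [LinearMap.coe_mk, AddHom.coe_mk, coeff_mk]
    rw [norm_mul, norm_mul, norm_div, ← mul_assoc]
    refine mul_le_mul_of_nonneg_right ?_ (norm_nonneg _)
    by_cases hp : p = 0
    · subst hp
      rcases Nat.eq_zero_or_pos n with rfl | hn
      · simp
      · simp only [if_true, one_mul]
        refine div_le_self (norm_nonneg _) ?_
        have : (1 : ℝ) ≤ n := by exact_mod_cast hn
        simp only [CharP.cast_eq_zero, add_zero, RCLike.norm_natCast, this]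
    · rw [if_neg hp, inv_mul_eq_div]
      have hp' : (0 : ℝ) < p := by exact_mod_cast Nat.pos_of_ne_zero hp
      have hn : (0 : ℝ) ≤ n := n.cast_nonneg
      rw [Real.norm_of_nonneg (by positivity : (0 : ℝ) ≤ n + p)]
      exact div_le_div_of_nonneg_left (norm_nonneg _) hp' (by linarith)

@[simp] theorem coeff_avg (p : ℕ) (f : Wiener) (n : ℕ) :
    coeff n (avg p f) = coeff n f / ((n : ℝ) + p) := by
  simp [avg]

theorem norm_avg_le {p : ℕ} (hp : p ≠ 0) (f : Wiener) : ‖avg p f‖ ≤ (p : ℝ)⁻¹ * ‖f‖ := by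
  have h : ‖avg p‖ ≤ (if p = 0 then 1 else (p : ℝ)⁻¹) :=
    LinearMap.mkContinuous_norm_le _ (by split_ifs <;> positivity) _
  rw [if_neg hp] at h
  exact (avg p).le_of_opNorm_le h f

/-- In integral form, `x⁻ᵖ ∫ tᵖ⁻¹ (t f) = x · x⁻⁽ᵖ⁺¹⁾ ∫ tᵖ f`. Pulling out powers of `x` raises the
index and so shrinks the norm of the average; this produces the factorials in `modeOp_pow_apply`. -/
theorem avg_X_mul (p : ℕ) (f : Wiener) : avg p (X * f) = X * avg (p + 1) f := by
  ext n
  cases n with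
  | zero => simp [coeff_X_mul_zero]
  | succ n =>
    rw [coeff_avg, coeff_X_mul_succ, coeff_X_mul_succ, coeff_avg]
    push_cast
    ring

theorem avg_X_pow_mul (p m : ℕ) (f : Wiener) :
    avg p (X ^ m * f) = X ^ m * avg (p + m) f := by
  induction m generalizing p with
  | zero => simp
  | succ m ih =>
    rw [pow_succ', mul_assoc, avg_X_mul, ih, mul_assoc]
    congr 4
    ring

/-- Termwise differentiation of `∑ aₙ xⁿ⁺ᵖ / (n + p)`. It is the bridge from the algebraic equations
between series back to differential equations. -/
theorem hasDerivAt_pow_mul_ev_avg {p : ℕ} (hp : p ≠ 0) (f : Wiener) {x : ℝ}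
    (hx : |x| < convRadius) :
    HasDerivAt (fun t => t ^ p * ev (avg p f) t) (x ^ (p - 1) * ev f x) x := by
  have key : HasDerivAt (fun t => ∑' n, coeff n f / ((n : ℝ) + p) * t ^ (n + p))
      (∑' n, coeff n f * x ^ (n + p - 1)) x := by
    refine hasDerivAt_tsum_of_isPreconnected
      (u := fun n => ‖coeff n f * convRadius ^ n‖ * convRadius ^ (p - 1))
      (t := Metric.ball (0 : ℝ) convRadius) (y₀ := (0 : ℝ))
      (g := fun n t => coeff n f / ((n : ℝ) + p) * t ^ (n + p))
      (g' := fun n t => coeff n f * t ^ (n + p - 1)) ((summable_coeff f).mul_right _)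
      Metric.isOpen_ball (convex_ball _ _).isPreconnected ?_ ?_
      (Metric.mem_ball_self convRadius_pos) ?_ (by simpa [Real.norm_eq_abs] using hx)
    · intro n y _
      have h := (hasDerivAt_pow (n + p) y).const_mul (coeff n f / ((n : ℝ) + p))
      refine h.congr_deriv ?_
      have : ((n : ℝ) + p) ≠ 0 := by
        have : (0 : ℝ) < p := by exact_mod_cast Nat.pos_of_ne_zero hp
        positivity
      push_cast
      field_simp
    · intro n y hy
      have hy' : |y| ≤ convRadius := by simpa using (Metric.mem_ball.1 hy).le
      have e : n + p - 1 = n + (p - 1) := by omega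
      rw [e, pow_add, ← mul_assoc, norm_mul]
      refine mul_le_mul (norm_term_le f hy' n) ?_ (norm_nonneg _) (norm_nonneg _)
      rw [norm_pow]
      exact pow_le_pow_left₀ (norm_nonneg _) hy' _
    · refine summable_zero.congr fun n => ?_
      simp [hp]
  have e : (fun t => t ^ p * ev (avg p f) t)
      = fun t => ∑' n, coeff n f / ((n : ℝ) + p) * t ^ (n + p) := by
    funext t
    rw [ev, ← tsum_mul_left]
    refine tsum_congr fun n => ?_
    rw [coeff_avg, pow_add]
    ring
  rw [e]
  refine key.congr_deriv ?_
  rw [ev, ← tsum_mul_left]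
  refine tsum_congr fun n => ?_
  have e : n + p - 1 = n + (p - 1) := by omega
  rw [e, pow_add]
  ring

/-! ### Joint analyticity of evaluation. -/

/-- Evaluation at `x` as a power series in `x` with values in the dual space. -/
noncomputable def evSeries : FormalMultilinearSeries ℝ ℝ (Wiener →L[ℝ] ℝ) :=
  fun n => ContinuousMultilinearMap.mkPiRing ℝ (Fin n) (coeffL n)

theorem evSeries_radius : ENNReal.ofReal convRadius ≤ evSeries.radius := by
  have := evSeries.le_radius_of_bound (r := convRadius.toNNReal) 1 fun n => ?_
  · exact this
  · rw [Real.coe_toNNReal _ convRadius_pos.le]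
    have h : ‖evSeries n‖ = ‖coeffL n‖ := ContinuousMultilinearMap.norm_mkPiRing _
    rw [h]
    have hp := pow_pos convRadius_pos n
    calc ‖coeffL n‖ * convRadius ^ n ≤ (convRadius ^ n)⁻¹ * convRadius ^ n :=
          mul_le_mul_of_nonneg_right (norm_coeffL_le n) hp.le
      _ = 1 := inv_mul_cancel₀ hp.ne'

/-- Evaluation is the bilinear pairing of the series with a functional that depends on the point
through a convergent power series, because `‖coeffL n‖ ≤ convRadius⁻ⁿ`; a pairing of analytic maps
is analytic. -/
theorem analyticAt_ev (f : Wiener) {x : ℝ} (hx : |x| < convRadius) :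
    AnalyticAt ℝ (fun p : Wiener × ℝ => ev p.1 p.2) (f, x) := by
  have hpos : 0 < evSeries.radius :=
    lt_of_lt_of_le (ENNReal.ofReal_pos.2 convRadius_pos) evSeries_radius
  have hs := evSeries.hasFPowerSeriesOnBall hpos
  have hmem : ∀ y : ℝ, |y| < convRadius → y ∈ Metric.eball (0 : ℝ) evSeries.radius := by
    intro y hy
    refine Metric.mem_eball.2 (lt_of_lt_of_le ?_ evSeries_radius)
    rw [edist_dist, dist_zero_right]
    exact (ENNReal.ofReal_lt_ofReal_iff convRadius_pos).2 hy
  have ha : AnalyticAt ℝ evSeries.sum x := hs.analyticAt_of_mem (hmem x hx)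
  have hb : AnalyticAt ℝ (fun p : Wiener × ℝ => evSeries.sum p.2 p.1) (f, x) := by
    have h2 : AnalyticAt ℝ (fun p : Wiener × ℝ => evSeries.sum p.2) (f, x) :=
      AnalyticAt.fun_comp (g := evSeries.sum) (f := Prod.snd) (x := (f, x)) ha analyticAt_snd
    exact AnalyticAt.fun_comp (x := (f, x))
      ((ContinuousLinearMap.id ℝ (Wiener →L[ℝ] ℝ)).analyticAt_bilinear (evSeries.sum x, f))
      (h2.prod analyticAt_fst)
  refine hb.congr ?_
  have hopen : {p : Wiener × ℝ | |p.2| < convRadius} ∈ 𝓝 (f, x) :=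
    (isOpen_lt (by fun_prop) continuous_const).mem_nhds hx
  filter_upwards [hopen] with p hp
  have h1 := hs.hasSum (hmem p.2 hp)
  rw [zero_add] at h1
  have h2 := h1.mapL (ContinuousLinearMap.apply ℝ ℝ p.1)
  refine h2.unique ?_
  have h3 := hasSum_ev p.1 hp.le
  convert! h3 using 2 with n
  simp [evSeries, coeffL, mul_comm]

end Wiener

/-! ### Evaluation as a homomorphism, and antiderivatives. -/

namespace Wiener

/-- Evaluation at a point of the disc of convergence, as a continuous functional. -/
noncomputable def evL (x : ℝ) (hx : |x| ≤ convRadius) : Wiener →L[ℝ] ℝ :=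
  (evHom x hx).toLinearMap.mkContinuous 1 fun f => by
    simpa [evHom_apply] using abs_ev_le f hx

theorem eventually_abs_lt {x : ℝ} (hx : |x| < convRadius) : ∀ᶠ t in 𝓝 x, |t| < convRadius :=
  (isOpen_lt continuous_abs continuous_const).mem_nhds hx

theorem ev_mul (f g : Wiener) {x : ℝ} (hx : |x| ≤ convRadius) :
    ev (f * g) x = ev f x * ev g x := map_mul (evHom x hx) f g

theorem ev_add (f g : Wiener) {x : ℝ} (hx : |x| ≤ convRadius) :
    ev (f + g) x = ev f x + ev g x := map_add (evHom x hx) f g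

theorem ev_sub (f g : Wiener) {x : ℝ} (hx : |x| ≤ convRadius) :
    ev (f - g) x = ev f x - ev g x := map_sub (evHom x hx) f g

theorem ev_pow (f : Wiener) (n : ℕ) {x : ℝ} (hx : |x| ≤ convRadius) :
    ev (f ^ n) x = ev f x ^ n := map_pow (evHom x hx) f n

theorem ev_smul (r : ℝ) (f : Wiener) {x : ℝ} (hx : |x| ≤ convRadius) :
    ev (r • f) x = r * ev f x := map_smul (evHom x hx) r f

theorem ev_algebraMap (r : ℝ) {x : ℝ} (hx : |x| ≤ convRadius) :
    ev (algebraMap ℝ Wiener r) x = r := (evHom x hx).commutes r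

theorem ev_one {x : ℝ} (hx : |x| ≤ convRadius) : ev 1 x = 1 := map_one (evHom x hx)

theorem ev_zero (x : ℝ) : ev 0 x = 0 := by simp [ev]

theorem ev_sum {ι : Type*} (s : Finset ι) (f : ι → Wiener) {x : ℝ} (hx : |x| ≤ convRadius) :
    ev (∑ i ∈ s, f i) x = ∑ i ∈ s, ev (f i) x := map_sum (evHom x hx) f s

theorem ev_neg (f : Wiener) {x : ℝ} (hx : |x| ≤ convRadius) :
    ev (-f) x = -ev f x := map_neg (evHom x hx) f

theorem analyticAt_ev_right (f : Wiener) {x : ℝ} (hx : |x| < convRadius) :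
    AnalyticAt ℝ (ev f) x :=
  AnalyticAt.fun_comp (g := fun p : Wiener × ℝ => ev p.1 p.2) (f := fun t => (f, t))
    (analyticAt_ev f hx) (analyticAt_const.prod analyticAt_id)

theorem hasDerivAt_ev_pow_mul_avg {p : ℕ} (hp : p ≠ 0) (f : Wiener) {x : ℝ}
    (hx : |x| < convRadius) :
    HasDerivAt (ev (X ^ p * avg p f)) (x ^ (p - 1) * ev f x) x := by
  refine (hasDerivAt_pow_mul_ev_avg hp f hx).congr_of_eventuallyEq ?_
  filter_upwards [eventually_abs_lt hx] with t ht
  rw [ev_mul _ _ ht.le, ev_pow _ _ ht.le, ev_X]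

theorem hasDerivAt_ev_X_mul_avg (f : Wiener) {x : ℝ} (hx : |x| < convRadius) :
    HasDerivAt (ev (X * avg 1 f)) (ev f x) x := by
  simpa using hasDerivAt_ev_pow_mul_avg one_ne_zero f hx

/-- The antiderivative that vanishes at `x₀`. -/
noncomputable def primitive (x₀ : ℝ) (hx₀ : |x₀| ≤ convRadius) : Wiener →L[ℝ] Wiener :=
  let I : Wiener →L[ℝ] Wiener := (ContinuousLinearMap.mul ℝ Wiener X).comp (avg 1)
  I - (((evL x₀ hx₀).comp I).smulRight (1 : Wiener))

theorem primitive_apply (x₀ : ℝ) (hx₀ : |x₀| ≤ convRadius) (f : Wiener) :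
    primitive x₀ hx₀ f = X * avg 1 f - ev (X * avg 1 f) x₀ • (1 : Wiener) := rfl

theorem ev_primitive_self (x₀ : ℝ) (hx₀ : |x₀| ≤ convRadius) (f : Wiener) :
    ev (primitive x₀ hx₀ f) x₀ = 0 := by
  rw [primitive_apply, ev_sub _ _ hx₀, ev_smul _ _ hx₀, ev_one hx₀]
  ring

theorem hasDerivAt_ev_primitive (x₀ : ℝ) (hx₀ : |x₀| ≤ convRadius) (f : Wiener) {x : ℝ}
    (hx : |x| < convRadius) : HasDerivAt (ev (primitive x₀ hx₀ f)) (ev f x) x := by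
  have h := (hasDerivAt_ev_X_mul_avg f hx).sub_const (ev (X * avg 1 f) x₀)
  refine h.congr_of_eventuallyEq ?_
  filter_upwards [eventually_abs_lt hx] with t ht
  rw [primitive_apply, ev_sub _ _ ht.le, ev_smul _ _ ht.le, ev_one ht.le, mul_one]

theorem isUnit_of_norm_one_sub_lt {f : Wiener} (h : ‖1 - f‖ < 1) : IsUnit f := by
  have := isUnit_one_sub_of_norm_lt_one h
  rwa [sub_sub_cancel] at this

/-! ### Trigonometric series and the two inverses. -/

/-- The power series of the cosine. -/
noncomputable def cosW : Wiener :=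
  mk (fun n => if Even n then (-1) ^ (n / 2) / (n.factorial : ℝ) else 0) (by
    refine (Real.summable_pow_div_factorial convRadius).of_nonneg_of_le
      (fun _ => norm_nonneg _) fun n => ?_
    have := convRadius_pos
    split_ifs
    · rw [norm_mul, norm_div, norm_pow, norm_neg, norm_one, one_pow,
        Real.norm_of_nonneg (by positivity), Real.norm_of_nonneg (by positivity), one_div_mul_eq_div]
    · simp only [zero_mul, norm_zero]
      positivity)

theorem ev_cosW (x : ℝ) : ev cosW x = Real.cos x := by
  refine HasSum.tsum_eq ?_
  refine ((mul_right_injective₀ (two_ne_zero (α := ℕ))).hasSum_iff ?_).1 ?_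
  · intro n hn
    have : ¬ Even n := fun h => hn (by
      obtain ⟨m, rfl⟩ := h
      exact ⟨m, by simp; ring⟩)
    simp [cosW, this]
  · refine (Real.hasSum_cos x).congr_fun ?_
    intro n
    simp only [cosW, Function.comp, coeff_mk, even_two_mul, if_true]
    rw [Nat.mul_div_cancel_left _ two_pos]
    ring

/-- The power series of `sin x / x`. -/
noncomputable def sincW : Wiener := avg 1 cosW

/-- The power series of the sine. -/
noncomputable def sinW : Wiener := X * sincW

/-- This is `cos x = 1 - ∫₀ˣ sin t dt` with `sin t = t · sinc t`, checked on coefficients. -/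
theorem cosW_eq : cosW = 1 - X ^ 2 * avg 2 sincW := by
  ext n
  rw [map_sub, pow_two, mul_assoc]
  rcases n with _ | _ | n
  · simp [coeff_X_mul_zero, cosW, coeff_one]
  · simp [coeff_X_mul_zero, coeff_X_mul_succ, cosW, coeff_one]
  · rw [coeff_X_mul_succ, coeff_X_mul_succ, coeff_avg, sincW, coeff_avg, coeff_one, cosW, coeff_mk,
      coeff_mk]
    have e : Even (n + 1 + 1) ↔ Even n := by
      rw [add_assoc]; simp [Nat.even_add]
    simp only [e]
    split_ifs with h1 h2
    · simp at h2
    · have e2 : (n + 1 + 1) / 2 = n / 2 + 1 := by omega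
      rw [e2, pow_succ, Nat.factorial_succ, Nat.factorial_succ]
      push_cast
      field_simp
      ring
    · simp at *
    · simp

/-- Both sides are antiderivatives of the cosine that vanish at `0`. -/
theorem ev_sinW {x : ℝ} (hx : |x| < convRadius) : ev sinW x = Real.sin x := by
  have hd : ∀ t ∈ Metric.ball (0 : ℝ) convRadius,
      HasDerivAt (fun t => ev sinW t - Real.sin t) 0 t := by
    intro t ht
    have ht' : |t| < convRadius := by simpa [Real.norm_eq_abs] using ht
    have h := (hasDerivAt_ev_X_mul_avg cosW ht').sub (Real.hasDerivAt_sin t)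
    rw [ev_cosW, sub_self] at h
    exact h
  have h0 : (0 : ℝ) ∈ Metric.ball (0 : ℝ) convRadius := Metric.mem_ball_self convRadius_pos
  have hx' : x ∈ Metric.ball (0 : ℝ) convRadius := by simpa [Real.norm_eq_abs] using hx
  have := (convex_ball (0 : ℝ) convRadius).is_const_of_fderivWithin_eq_zero (𝕜 := ℝ)
    (f := fun t => ev sinW t - Real.sin t)
    (fun t ht => (hd t ht).differentiableAt.differentiableWithinAt)
    (fun t ht => by
      rw [fderivWithin_of_isOpen Metric.isOpen_ball ht]
      have := (hd t ht).hasFDerivAt.fderiv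
      rw [this]; ext; simp) hx' h0
  have h00 : |(0 : ℝ)| ≤ convRadius := by simpa using convRadius_pos.le
  simp only [sinW, ev_mul _ _ h00, ev_X, Real.sin_zero, zero_mul, sub_zero] at this
  exact sub_eq_zero.1 this

/-- Integrating the cosine twice gives `1 - sinc = x² avg₃ (avg₂ sinc)`. With `ρ = convRadius` and
`t = ‖1 - sinc‖`, this yields `t ≤ (ρ² / 6) (1 + t)`, and `ρ² / 6 = 32 / 75 < 1 / 2` forces `t < 1`.
-/
theorem isUnit_sincW : IsUnit sincW := by
  refine isUnit_of_norm_one_sub_lt ?_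
  have e : 1 - sincW = X ^ 2 * avg 3 (avg 2 sincW) := by
    have h1 : avg 1 (1 : Wiener) = 1 := by
      ext n
      rw [coeff_avg, coeff_one]
      split_ifs with h
      · simp [h]
      · simp
    conv_lhs => rw [sincW, cosW_eq, map_sub, h1, avg_X_pow_mul]
    rw [sub_sub_cancel]
  set t := ‖1 - sincW‖ with ht
  have h2 : ‖sincW‖ ≤ 1 + t := by
    calc ‖sincW‖ = ‖1 - (1 - sincW)‖ := by rw [sub_sub_cancel]
      _ ≤ ‖(1 : Wiener)‖ + ‖1 - sincW‖ := norm_sub_le _ _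
      _ = 1 + t := by rw [norm_one]
  have h3 : t ≤ convRadius ^ 2 * ((3 : ℕ) : ℝ)⁻¹ * (((2 : ℕ) : ℝ)⁻¹ * ‖sincW‖) := by
    calc t = ‖X ^ 2 * avg 3 (avg 2 sincW)‖ := by rw [ht, e]
      _ ≤ ‖X ^ 2‖ * ‖avg 3 (avg 2 sincW)‖ := norm_mul_le _ _
      _ ≤ convRadius ^ 2 * (((3 : ℕ) : ℝ)⁻¹ * (((2 : ℕ) : ℝ)⁻¹ * ‖sincW‖)) := by
        refine mul_le_mul ?_ ?_ (norm_nonneg _) (by have := convRadius_pos; positivity)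
        · exact (norm_pow_le _ _).trans (by rw [norm_X])
        · refine (norm_avg_le (by norm_num) _).trans ?_
          gcongr
          exact norm_avg_le (by norm_num) _
      _ = _ := by ring
  simp only [convRadius] at h3
  push_cast at h3
  linarith

/-- The power series of `x / sin x`. -/
noncomputable def invSincW : Wiener := Ring.inverse sincW

theorem sincW_mul_invSincW : sincW * invSincW = 1 := Ring.mul_inverse_cancel _ isUnit_sincW

/-- The power series of `(cot x - 1 / x) / x`. -/
noncomputable def cotW : Wiener := invSincW * (avg 3 (avg 2 sincW) - avg 2 sincW)

/-- The regular form of `x cot x = 1 + x² cotW`. The singular part `1 / x` of the cotangent is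
thereby separated; in the mode equations it is absorbed into the index of `avg`. -/
theorem cosW_eq_sincW_mul : cosW = sincW * (1 + X ^ 2 * cotW) := by
  have e : cosW - sincW = X ^ 2 * (avg 3 (avg 2 sincW) - avg 2 sincW) := by
    have h1 : avg 1 (1 : Wiener) = 1 := by
      ext n
      rw [coeff_avg, coeff_one]
      split_ifs with h
      · simp [h]
      · simp
    have h2 : sincW = 1 - X ^ 2 * avg 3 (avg 2 sincW) := by
      conv_lhs => rw [sincW, cosW_eq, map_sub, h1, avg_X_pow_mul]
    have h3 := cosW_eq
    linear_combination h3 - h2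
  rw [cotW]
  linear_combination e - (X ^ 2 * (avg 3 (avg 2 sincW) - avg 2 sincW)) * sincW_mul_invSincW

/-- The polynomial `3 - 3 x + x²`. -/
noncomputable def horizonPoly : Wiener := 3 - 3 * X + X ^ 2

/-- The product `(3 - 3 x + x²) (3 + 3 x + x²) (3 + x²) = 27 + x⁶` is a unit because `(8 / 5)⁶ <
27`. A direct Neumann series for `3 - 3 x + x²` would fail, as its linear term is too large. -/
theorem isUnit_horizonPoly : IsUnit horizonPoly := by
  have h : IsUnit (1 + (27 : ℝ)⁻¹ • X ^ 6 : Wiener) := by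
    refine isUnit_of_norm_one_sub_lt ?_
    rw [sub_add_cancel_left, norm_neg, norm_smul]
    have : ‖X ^ 6‖ ≤ convRadius ^ 6 := (norm_pow_le _ _).trans (by rw [norm_X])
    calc ‖(27 : ℝ)⁻¹‖ * ‖X ^ 6‖ ≤ ‖(27 : ℝ)⁻¹‖ * convRadius ^ 6 := by gcongr
      _ < 1 := by norm_num [convRadius]
  refine isUnit_of_dvd_unit (Dvd.intro ((27 : ℝ)⁻¹ • ((X ^ 2 + 3) * (X ^ 2 + 3 * X + 3))) ?_) h
  rw [horizonPoly, mul_smul_comm]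
  have : (1 : Wiener) = (27 : ℝ)⁻¹ • (27 : Wiener) := by
    rw [show (27 : Wiener) = algebraMap ℝ Wiener 27 from (map_ofNat _ _).symm,
      Algebra.algebraMap_eq_smul_one, smul_smul]
    norm_num
  rw [this, ← smul_add]
  congr 1
  ring

/-- The inverse of `3 - 3 x + x²`. -/
noncomputable def invHorizonPoly : Wiener := Ring.inverse horizonPoly

theorem horizonPoly_mul_inv : horizonPoly * invHorizonPoly = 1 :=
  Ring.mul_inverse_cancel _ isUnit_horizonPoly

end Wiener

/-! ### Volterra operators. -/

/-- A bounded operator with a power of norm less than one can be subtracted from the identity. -/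
theorem ContinuousLinearMap.bijective_one_sub_of_pow {E : Type*} [NormedAddCommGroup E]
    [NormedSpace ℝ E] [CompleteSpace E] (V : E →L[ℝ] E) (m : ℕ) (h : ‖V ^ m‖ < 1) :
    IsUnit (1 - V) := by
  have h1 : IsUnit (1 - V ^ m) := isUnit_one_sub_of_norm_lt_one h
  have hc : Commute (1 - V) (∑ i ∈ Finset.range m, V ^ i) :=
    (Commute.sum_right _ _ _ fun i _ => ((Commute.one_left V).sub_left (Commute.refl V)).pow_right i)
  have h2 : (1 - V) * (∑ i ∈ Finset.range m, V ^ i) = 1 - V ^ m := mul_neg_geom_sum V m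
  exact (hc.isUnit_mul_iff.1 (h2 ▸ h1)).1

namespace Wiener

/-- The Volterra type operator of the linearised equation of an eigenmode. -/
noncomputable def modeOp (p : ℕ) (c : ℝ) (g : Wiener) : Wiener →L[ℝ] Wiener :=
  c • (ContinuousLinearMap.mul ℝ Wiener (X ^ 2)).comp ((avg 2).comp (avg p)) +
    (ContinuousLinearMap.mul ℝ Wiener (g * X ^ 2)).comp (avg p)

theorem modeOp_apply (p : ℕ) (c : ℝ) (g f : Wiener) :
    modeOp p c g f = c • (X ^ 2 * avg 2 (avg p f)) + g * X ^ 2 * avg p f := rfl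

/-- Each application pulls out a factor `x²` and therefore raises the index of the next average by
`2`; its norm is then at most `1 / (m + 1)`, and the product of these bounds is `1 / m!`. -/
theorem modeOp_pow_apply {p : ℕ} (hp : p ≠ 0) (c : ℝ) (g : Wiener) (m : ℕ) (f : Wiener) :
    ∃ f' : Wiener, (modeOp p c g ^ m) f = X ^ (2 * m) * f' ∧
      ‖f'‖ ≤ (|c| + ‖g‖) ^ m / (m.factorial : ℝ) * ‖f‖ := by
  induction m with
  | zero => exact ⟨f, by simp⟩
  | succ m ih =>
    obtain ⟨f', h1, h2⟩ := ih
    refine ⟨c • avg (2 + 2 * m) (avg (p + 2 * m) f') + g * avg (p + 2 * m) f', ?_, ?_⟩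
    · rw [pow_succ', mul_apply_eq_comp, h1, modeOp_apply, avg_X_pow_mul, avg_X_pow_mul,
        show 2 * (m + 1) = 2 * m + 2 by ring, pow_add, mul_add, mul_smul_comm]
      congr 1
      · congr 1
        ring
      · ring
    · have hA : ‖avg (p + 2 * m) f'‖ ≤ ((m : ℝ) + 1)⁻¹ * ‖f'‖ := by
        refine (norm_avg_le (by omega) f').trans ?_
        gcongr
        push_cast
        have : (1 : ℝ) ≤ p := by exact_mod_cast Nat.pos_of_ne_zero hp
        have hm : (0 : ℝ) ≤ m := m.cast_nonneg
        linarith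
      have hB : ‖avg (2 + 2 * m) (avg (p + 2 * m) f')‖ ≤ ‖avg (p + 2 * m) f'‖ := by
        refine (norm_avg_le (by omega) _).trans ?_
        refine mul_le_of_le_one_left (norm_nonneg _) ?_
        refine inv_le_one_of_one_le₀ ?_
        push_cast
        have hm : (0 : ℝ) ≤ m := m.cast_nonneg
        linarith
      calc _ ≤ ‖c • avg (2 + 2 * m) (avg (p + 2 * m) f')‖ + ‖g * avg (p + 2 * m) f'‖ :=
            norm_add_le _ _
        _ ≤ |c| * ‖avg (p + 2 * m) f'‖ + ‖g‖ * ‖avg (p + 2 * m) f'‖ := by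
          refine add_le_add ?_ (norm_mul_le _ _)
          rw [norm_smul, Real.norm_eq_abs]
          gcongr
        _ = (|c| + ‖g‖) * ‖avg (p + 2 * m) f'‖ := by ring
        _ ≤ (|c| + ‖g‖) * (((m : ℝ) + 1)⁻¹ * ((|c| + ‖g‖) ^ m / (m.factorial : ℝ) * ‖f‖)) := by
          gcongr
          exact hA.trans (by gcongr)
        _ = _ := by
          rw [Nat.factorial_succ, pow_succ]
          push_cast
          field_simp

/-- Some power of the operator has norm below `1`, since `Cᵐ / m! → 0`. No smallness of `c` or `g`
is needed, which is why the magnetic amplitudes of solitons can be arbitrary. -/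
theorem isUnit_one_sub_modeOp {p : ℕ} (hp : p ≠ 0) (c : ℝ) (g : Wiener) :
    IsUnit (1 - modeOp p c g) := by
  set C := convRadius ^ 2 * (|c| + ‖g‖) with hC
  have hlim := FloorSemiring.tendsto_pow_div_factorial_atTop C
  obtain ⟨m, hm⟩ := (hlim.eventually (gt_mem_nhds one_pos)).exists
  refine ContinuousLinearMap.bijective_one_sub_of_pow _ m (lt_of_le_of_lt ?_ hm)
  have hρ := convRadius_pos
  refine ContinuousLinearMap.opNorm_le_bound _ (by positivity) fun f => ?_
  obtain ⟨f', h1, h2⟩ := modeOp_pow_apply hp c g m f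
  rw [h1]
  calc ‖X ^ (2 * m) * f'‖ ≤ ‖X ^ (2 * m)‖ * ‖f'‖ := norm_mul_le _ _
    _ ≤ convRadius ^ (2 * m) * ((|c| + ‖g‖) ^ m / (m.factorial : ℝ) * ‖f‖) := by
      refine mul_le_mul ?_ h2 (norm_nonneg _) (by positivity)
      exact (norm_pow_le _ _).trans (by rw [norm_X])
    _ = _ := by
      rw [hC, mul_pow, ← pow_mul]
      ring

end Wiener

/-! ### The analytic implicit function theorem. -/

/-- Analytic solution of `L u = u₀(p) + ℓ T(ℓ, p, u)` for small `ℓ` and `p`. -/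
theorem exists_analytic_solution {P E : Type*} [NormedAddCommGroup P] [NormedSpace ℝ P]
    [CompleteSpace P] [NormedAddCommGroup E] [NormedSpace ℝ E] [CompleteSpace E]
    (L : E ≃L[ℝ] E) (u₀ : P → E) (hu₀ : ContDiff ℝ ⊤ u₀) (T : ℝ × P × E → E)
    (hT : ContDiff ℝ ⊤ T) (O : Set (ℝ × P × E)) (hO : O ∈ 𝓝 ((0 : ℝ), (0 : P), L.symm (u₀ 0))) :
    ∃ δ > (0 : ℝ), ∃ U : ℝ × P → E, AnalyticOnNhd ℝ U (Metric.ball 0 δ) ∧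
      ∀ x ∈ Metric.ball (0 : ℝ × P) δ,
        L (U x) = u₀ x.2 + x.1 • T (x.1, x.2, U x) ∧ (x.1, x.2, U x) ∈ O := by
  set b : ℝ × P × E := (0, 0, L.symm (u₀ 0)) with hb
  set Φ : ℝ × P × E → ℝ × P × E :=
    fun y => (y.1, y.2.1, L y.2.2 - u₀ y.2.1 - y.1 • T y) with hΦ
  have hΦc : ContDiff ℝ ⊤ Φ := by
    have h1 : ContDiff ℝ ⊤ fun y : ℝ × P × E => u₀ y.2.1 := hu₀.comp (by fun_prop)
    have h2 : ContDiff ℝ ⊤ fun y : ℝ × P × E => L y.2.2 := L.contDiff.comp (by fun_prop)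
    exact contDiff_fst.prodMk (contDiff_snd.fst.prodMk ((h2.sub h1).sub (contDiff_fst.smul hT)))
  obtain ⟨D, hD⟩ : ∃ D : P →L[ℝ] E, HasFDerivAt u₀ D 0 :=
    ⟨_, (hu₀.differentiable (by simp) 0).hasFDerivAt⟩
  -- At the base point `ℓ = 0`, so `ℓ T` contributes only `T b dℓ`. The derivative of `Φ` is block
  -- triangular with diagonal blocks `1`, `1` and `L`, and is inverted explicitly.
  let Φ' : (ℝ × P × E) ≃L[ℝ] (ℝ × P × E) := ContinuousLinearEquiv.equivOfInverse
    ((ContinuousLinearMap.fst ℝ ℝ (P × E)).prod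
      (((ContinuousLinearMap.fst ℝ P E).comp (ContinuousLinearMap.snd ℝ ℝ (P × E))).prod
        ((L : E →L[ℝ] E).comp ((ContinuousLinearMap.snd ℝ P E).comp
            (ContinuousLinearMap.snd ℝ ℝ (P × E)))
          - D.comp ((ContinuousLinearMap.fst ℝ P E).comp (ContinuousLinearMap.snd ℝ ℝ (P × E)))
          - (ContinuousLinearMap.fst ℝ ℝ (P × E)).smulRight (T b))))
    ((ContinuousLinearMap.fst ℝ ℝ (P × E)).prod
      (((ContinuousLinearMap.fst ℝ P E).comp (ContinuousLinearMap.snd ℝ ℝ (P × E))).prod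
        ((L.symm : E →L[ℝ] E).comp ((ContinuousLinearMap.snd ℝ P E).comp
            (ContinuousLinearMap.snd ℝ ℝ (P × E))
          + D.comp ((ContinuousLinearMap.fst ℝ P E).comp (ContinuousLinearMap.snd ℝ ℝ (P × E)))
          + (ContinuousLinearMap.fst ℝ ℝ (P × E)).smulRight (T b)))))
    (by rintro ⟨a, p, e⟩; simp; abel) (by rintro ⟨a, p, e⟩; simp; abel)
  have hder : HasFDerivAt Φ (Φ' : (ℝ × P × E) →L[ℝ] (ℝ × P × E)) b := by
    have hf : HasFDerivAt (fun y : ℝ × P × E => y.1) (ContinuousLinearMap.fst ℝ ℝ (P × E)) b :=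
      hasFDerivAt_fst
    have hs : HasFDerivAt (fun y : ℝ × P × E => y.2) (ContinuousLinearMap.snd ℝ ℝ (P × E)) b :=
      hasFDerivAt_snd
    have hp : HasFDerivAt (fun y : ℝ × P × E => y.2.1)
        ((ContinuousLinearMap.fst ℝ P E).comp (ContinuousLinearMap.snd ℝ ℝ (P × E))) b := hs.fst
    have he : HasFDerivAt (fun y : ℝ × P × E => y.2.2)
        ((ContinuousLinearMap.snd ℝ P E).comp (ContinuousLinearMap.snd ℝ ℝ (P × E))) b := hs.snd
    have h1 : HasFDerivAt (fun y : ℝ × P × E => u₀ y.2.1)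
        (D.comp ((ContinuousLinearMap.fst ℝ P E).comp (ContinuousLinearMap.snd ℝ ℝ (P × E)))) b :=
      HasFDerivAt.comp (g := u₀) b hD hp
    have h2 : HasFDerivAt (fun y : ℝ × P × E => L y.2.2)
        ((L : E →L[ℝ] E).comp ((ContinuousLinearMap.snd ℝ P E).comp
            (ContinuousLinearMap.snd ℝ ℝ (P × E)))) b :=
      HasFDerivAt.comp (g := L) b L.hasFDerivAt he
    have h3 : HasFDerivAt (fun y : ℝ × P × E => y.1 • T y)
        ((ContinuousLinearMap.fst ℝ ℝ (P × E)).smulRight (T b)) b := by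
      have := hf.smul (hT.differentiable (by simp) b).hasFDerivAt
      refine this.congr_fderiv ?_
      simp [hb]
    exact hf.prodMk (hp.prodMk ((h2.sub h1).sub h3))
  have hc : ContDiffAt ℝ ⊤ Φ b := hΦc.contDiffAt
  have hΦb : Φ b = (0, 0, 0) := by simp [hΦ, hb]
  set e := hc.toOpenPartialHomeomorph Φ hder (by simp) with he
  have hinv : ContDiffAt ℝ ⊤ e.symm (Φ b) := hc.to_localInverse hder (by simp)
  have htgt : e.target ∈ 𝓝 (Φ b) :=
    e.open_target.mem_nhds (hc.image_mem_toOpenPartialHomeomorph_target hder (by simp))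
  have hsymm : e.symm (Φ b) = b := hc.localInverse_apply_image hder (by simp)
  -- In `WithTop ℕ∞` the order `⊤` means real analyticity, so the local inverse is analytic.
  have hanal : AnalyticAt ℝ e.symm (Φ b) := hinv.analyticAt
  set ι : ℝ × P → ℝ × P × E := fun x => (x.1, x.2, 0) with hι
  have hιa : ∀ x, AnalyticAt ℝ ι x := fun x =>
    analyticAt_fst.prod (analyticAt_snd.prod analyticAt_const)
  have hι0 : ι 0 = Φ b := by rw [hΦb]; rfl
  have hιc : Tendsto ι (𝓝 0) (𝓝 (Φ b)) := hι0 ▸ (hιa 0).continuousAt.tendsto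
  have hO' : ∀ᶠ z in 𝓝 (Φ b), e.symm z ∈ O := by
    have : Tendsto e.symm (𝓝 (Φ b)) (𝓝 b) := by
      have := hanal.continuousAt.tendsto
      rwa [hsymm] at this
    exact this.eventually hO
  obtain ⟨δ, hδ, hball⟩ := Metric.eventually_nhds_iff_ball.1
    (hιc.eventually (hanal.eventually_analyticAt.and (Filter.Eventually.and htgt hO')))
  refine ⟨δ, hδ, fun x => (e.symm (ι x)).2.2, ?_, ?_⟩
  · intro x hx
    have h1 : AnalyticAt ℝ (fun x => e.symm (ι x)) x :=
      AnalyticAt.fun_comp (g := e.symm) (f := ι) (hball x hx).1 (hιa x)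
    have h2 : AnalyticAt ℝ (fun y : ℝ × P × E => y.2.2) (e.symm (ι x)) :=
      ((ContinuousLinearMap.snd ℝ P E).comp (ContinuousLinearMap.snd ℝ ℝ (P × E))).analyticAt _
    exact AnalyticAt.fun_comp (g := fun y : ℝ × P × E => y.2.2) h2 h1
  · intro x hx
    obtain ⟨-, ht, ho⟩ := hball x hx
    have hr : Φ (e.symm (ι x)) = ι x := e.right_inv ht
    have h1 : (e.symm (ι x)).1 = x.1 := congrArg Prod.fst hr
    have h2 : (e.symm (ι x)).2.1 = x.2 := congrArg (fun z => z.2.1) hr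
    have h3 : L (e.symm (ι x)).2.2 - u₀ (e.symm (ι x)).2.1
        - (e.symm (ι x)).1 • T (e.symm (ι x)) = 0 := congrArg (fun z => z.2.2) hr
    have h4 : (x.1, x.2, (e.symm (ι x)).2.2) = e.symm (ι x) := by
      rw [← h1, ← h2]
    refine ⟨?_, ?_⟩
    · rw [h4]
      rw [h1, h2] at h3
      rw [sub_sub, sub_eq_zero] at h3
      exact h3
    · rw [h4]
      exact ho

/-! ### Families over the index `j`, and traceless potentials. -/

/-- Extension by zero of a family indexed by `1, …, N - 1`. -/
def extendZero {A : Type*} [Zero A] {N : ℕ} (u : Finset.Icc 1 (N - 1) → A) (j : ℕ) : A :=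
  if h : j ∈ Finset.Icc 1 (N - 1) then u ⟨j, h⟩ else 0

theorem extendZero_of_mem {A : Type*} [Zero A] {N : ℕ} (u : Finset.Icc 1 (N - 1) → A) {j : ℕ}
    (h : j ∈ Finset.Icc 1 (N - 1)) : extendZero u j = u ⟨j, h⟩ := dif_pos h

theorem extendZero_of_notMem {A : Type*} [Zero A] {N : ℕ} (u : Finset.Icc 1 (N - 1) → A) {j : ℕ}
    (h : j ∉ Finset.Icc 1 (N - 1)) : extendZero u j = 0 := dif_neg h

@[fun_prop]
theorem ContDiff.extendZero {E A : Type*} [NormedAddCommGroup E] [NormedSpace ℝ E]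
    [NormedAddCommGroup A] [NormedSpace ℝ A] {N : ℕ} {n : WithTop ℕ∞}
    {f : E → Finset.Icc 1 (N - 1) → A} (hf : ContDiff ℝ n f) (j : ℕ) :
    ContDiff ℝ n fun x => extendZero (f x) j := by
  by_cases h : j ∈ Finset.Icc 1 (N - 1)
  · simp only [extendZero_of_mem _ h]
    fun_prop
  · simp only [extendZero_of_notMem _ h]
    fun_prop

/-- The coefficients of the traceless potentials `α_j` in terms of the differences
`α_i - α_{i+1}`. -/
noncomputable def tracelessCoeff (N j i : ℕ) : ℝ :=
  if j ∈ Finset.Icc 1 N then ((N : ℝ) - i) / N - (if i < j then 1 else 0) else 0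

/-- The traceless potentials with given differences. -/
noncomputable def traceless {A : Type*} [AddCommMonoid A] [Module ℝ A] (N : ℕ) (E : ℕ → A)
    (j : ℕ) : A :=
  ∑ i ∈ Finset.Icc 1 (N - 1), tracelessCoeff N j i • E i

theorem tracelessCoeff_of_notMem {N j : ℕ} (i : ℕ) (h : j ∉ Finset.Icc 1 N) :
    tracelessCoeff N j i = 0 := if_neg h

theorem traceless_of_notMem {A : Type*} [AddCommMonoid A] [Module ℝ A] {N j : ℕ} (E : ℕ → A)
    (h : j ∉ Finset.Icc 1 N) : traceless N E j = 0 := by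
  simp [traceless, tracelessCoeff_of_notMem _ h]

theorem sum_tracelessCoeff {N i : ℕ} (hi : i ∈ Finset.Icc 1 (N - 1)) :
    ∑ j ∈ Finset.Icc 1 N, tracelessCoeff N j i = 0 := by
  obtain ⟨h1, h2⟩ := Finset.mem_Icc.1 hi
  have hN : (N : ℝ) ≠ 0 := by
    have : N ≠ 0 := by omega
    exact_mod_cast this
  rw [Finset.sum_congr rfl fun j hj => show tracelessCoeff N j i = _ from if_pos hj,
    Finset.sum_sub_distrib, Finset.sum_const,
    Finset.sum_ite, Finset.sum_const_zero, add_zero, Finset.sum_const]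
  have e : (Finset.Icc 1 N).filter (fun j => i < j) = Finset.Icc (i + 1) N := by
    ext j
    simp only [Finset.mem_filter, Finset.mem_Icc]
    omega
  have hc : ((N + 1 - (i + 1) : ℕ) : ℝ) = N - i := by
    rw [Nat.add_sub_add_right, Nat.cast_sub (by omega)]
  rw [e, Nat.card_Icc, Nat.card_Icc, Nat.add_sub_cancel]
  simp only [nsmul_eq_mul, mul_one, hc]
  field_simp
  ring

theorem sum_traceless {A : Type*} [AddCommMonoid A] [Module ℝ A] (N : ℕ) (E : ℕ → A) :
    ∑ j ∈ Finset.Icc 1 N, traceless N E j = 0 := by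
  simp only [traceless]
  rw [Finset.sum_comm]
  refine Finset.sum_eq_zero fun i hi => ?_
  rw [← Finset.sum_smul, sum_tracelessCoeff hi, zero_smul]

theorem traceless_sub_traceless {A : Type*} [AddCommGroup A] [Module ℝ A] {N j : ℕ} (E : ℕ → A)
    (hj : j ∈ Finset.Icc 1 (N - 1)) : traceless N E j - traceless N E (j + 1) = E j := by
  obtain ⟨h1, h2⟩ := Finset.mem_Icc.1 hj
  rw [traceless, traceless, ← Finset.sum_sub_distrib, Finset.sum_eq_single_of_mem j hj]
  · rw [← sub_smul, tracelessCoeff, tracelessCoeff, if_pos (Finset.mem_Icc.2 (by omega)),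
      if_pos (Finset.mem_Icc.2 (by omega)), if_neg (lt_irrefl j), if_pos (Nat.lt_succ_self j)]
    simp
  · intro i hi hij
    rw [← sub_smul, tracelessCoeff, tracelessCoeff, if_pos (Finset.mem_Icc.2 (by omega)),
      if_pos (Finset.mem_Icc.2 (by omega))]
    have : i < j ↔ i < j + 1 := by omega
    simp [this]

theorem traceless_eq_zero_of_notMem_or {A : Type*} [AddCommMonoid A] [Module ℝ A] {N : ℕ}
    {E : ℕ → A} (hE : ∀ i ∈ Finset.Icc 1 (N - 1), E i = 0) (j : ℕ) : traceless N E j = 0 :=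
  Finset.sum_eq_zero fun i hi => by rw [hE i hi, smul_zero]

theorem HasDerivAt.traceless {N : ℕ} {E : ℕ → ℝ → ℝ} {E' : ℕ → ℝ} {r : ℝ}
    (hE : ∀ i ∈ Finset.Icc 1 (N - 1), HasDerivAt (E i) (E' i) r) (j : ℕ) :
    HasDerivAt (fun t => traceless N (fun i => E i t) j) (_root_.traceless N E' j) r := by
  simp only [_root_.traceless, smul_eq_mul]
  exact HasDerivAt.fun_sum fun i hi => (hE i hi).const_mul _

@[fun_prop]
theorem ContDiff.traceless {V A : Type*} [NormedAddCommGroup V] [NormedSpace ℝ V]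
    [NormedAddCommGroup A] [NormedSpace ℝ A] {N : ℕ} {n : WithTop ℕ∞} {f : V → ℕ → A}
    (hf : ∀ i, ContDiff ℝ n fun x => f x i) (j : ℕ) :
    ContDiff ℝ n fun x => traceless N (f x) j :=
  ContDiff.sum fun i _ => (hf i).const_smul _

theorem AnalyticAt.traceless {V : Type*} [NormedAddCommGroup V] [NormedSpace ℝ V] {N : ℕ}
    {f : V → ℕ → ℝ} {x : V}
    (hf : ∀ i ∈ Finset.Icc 1 (N - 1), AnalyticAt ℝ (fun x => f x i) x) (j : ℕ) :
    AnalyticAt ℝ (fun x => traceless N (f x) j) x := by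
  simp only [_root_.traceless, smul_eq_mul]
  exact Finset.analyticAt_fun_sum _ fun i hi => analyticAt_const.mul (hf i hi)

theorem Wiener.ev_traceless (N : ℕ) (E : ℕ → Wiener) (j : ℕ) {x : ℝ} (hx : |x| ≤ convRadius) :
    ev (traceless N E j) x = traceless N (fun i => ev (E i) x) j := by
  simp only [traceless, ev_sum _ _ hx, ev_smul _ _ hx, smul_eq_mul]

/-! ### Derivatives, field equations and order of vanishing. -/

/-- The second derivative of a composition. -/
theorem hasDerivAt_comp_and_deriv {g g₁ : ℝ → ℝ} {g₂ : ℝ} {x x₁ : ℝ → ℝ} {x₂ r : ℝ}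
    (hg : ∀ᶠ y in 𝓝 (x r), HasDerivAt g (g₁ y) y) (hg₁ : HasDerivAt g₁ g₂ (x r))
    (hx : ∀ᶠ t in 𝓝 r, HasDerivAt x (x₁ t) t) (hx₁ : HasDerivAt x₁ x₂ r) :
    (∀ᶠ t in 𝓝 r, HasDerivAt (fun t => g (x t)) (g₁ (x t) * x₁ t) t) ∧
      HasDerivAt (fun t => g₁ (x t) * x₁ t) (g₂ * x₁ r ^ 2 + g₁ (x r) * x₂) r := by
  have hxr : HasDerivAt x (x₁ r) r := hx.self_of_nhds
  refine ⟨?_, ?_⟩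
  · filter_upwards [hxr.continuousAt.eventually hg, hx] with t h1 h2
    exact h1.comp t h2
  · have h1 : HasDerivAt (fun t => g₁ (x t)) (g₂ * x₁ r) r := hg₁.comp r hxr
    refine (h1.mul hx₁).congr_deriv ?_
    ring

namespace EYMFields

/-- The field equations from the values of the derivatives. -/
theorem fieldEquations_of_hasDerivAt {F : EYMFields} {N : ℕ} {k : ℤ} {ℓ r m₁ S₁ μ₁ : ℝ}
    {α₁ ω₂ E₂ : ℕ → ℝ} {ω₁ E₁ : ℕ → ℝ → ℝ}
    (hm : HasDerivAt F.m m₁ r) (hS : HasDerivAt F.S S₁ r) (hμ : HasDerivAt (F.mu k ℓ) μ₁ r)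
    (hα : ∀ j ∈ Finset.Icc 1 N, HasDerivAt (F.α j) (α₁ j) r)
    (hω : ∀ j ∈ Finset.Icc 1 (N - 1), (∀ᶠ t in 𝓝 r, HasDerivAt (F.ω j) (ω₁ j t) t) ∧
      HasDerivAt (ω₁ j) (ω₂ j) r)
    (hE : ∀ j ∈ Finset.Icc 1 (N - 1), (∀ᶠ t in 𝓝 r, HasDerivAt (F.elec j) (E₁ j t) t) ∧
      HasDerivAt (E₁ j) (E₂ j) r)
    (eq_m : m₁ = r ^ 2 * (∑ j ∈ Finset.Icc 1 N, α₁ j ^ 2) / (4 * F.S r ^ 2)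
      + F.zeta N r / (4 * F.mu k ℓ r * F.S r ^ 2)
      + F.mu k ℓ r * (∑ j ∈ Finset.Icc 1 (N - 1), ω₁ j r ^ 2) + F.potP N k r)
    (eq_S : S₁ / F.S r = F.zeta N r / (2 * F.mu k ℓ r ^ 2 * F.S r ^ 2 * r)
      + 2 * (∑ j ∈ Finset.Icc 1 (N - 1), ω₁ j r ^ 2) / r)
    (eq_E : ∀ j ∈ Finset.Icc 1 (N - 1), E₂ j = (S₁ / F.S r - 2 / r) * E₁ j r
      + 1 / (F.mu k ℓ r * r ^ 2) * F.potZ j r)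
    (eq_ω : ∀ j ∈ Finset.Icc 1 (N - 1), ω₂ j = -(S₁ / F.S r + μ₁ / F.mu k ℓ r) * ω₁ j r
        - 1 / (4 * F.mu k ℓ r ^ 2 * F.S r ^ 2) * F.ω j r * (F.elec j r) ^ 2
        - F.potW k j r * F.ω j r / (F.mu k ℓ r * r ^ 2)) :
    F.FieldEquations N k ℓ r := by
  have hω₁ : ∀ j ∈ Finset.Icc 1 (N - 1), deriv (F.ω j) =ᶠ[𝓝 r] ω₁ j := fun j hj =>
    (hω j hj).1.mono fun t ht => ht.deriv
  have hE₁ : ∀ j ∈ Finset.Icc 1 (N - 1), deriv (F.elec j) =ᶠ[𝓝 r] E₁ j := fun j hj =>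
    (hE j hj).1.mono fun t ht => ht.deriv
  have hG : F.gradG N r = ∑ j ∈ Finset.Icc 1 (N - 1), ω₁ j r ^ 2 :=
    Finset.sum_congr rfl fun j hj => by rw [(hω₁ j hj).eq_of_nhds]
  have hη : F.eta N r = ∑ j ∈ Finset.Icc 1 N, α₁ j ^ 2 :=
    Finset.sum_congr rfl fun j hj => by rw [(hα j hj).deriv]
  refine ⟨?_, ?_, fun j hj => ?_, fun j hj => ?_⟩
  · rw [hm.deriv, hG, hη, eq_m]
  · rw [hS.deriv, hG, eq_S]
  · rw [(hE₁ j hj).deriv_eq, (hE j hj).2.deriv, (hE₁ j hj).eq_of_nhds, hS.deriv, eq_E j hj]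
  · rw [(hω₁ j hj).deriv_eq, (hω j hj).2.deriv, (hω₁ j hj).eq_of_nhds, hS.deriv, hμ.deriv,
      eq_ω j hj]

end EYMFields

/-- A function with a derivative `O(zⁿ)` that vanishes at the origin is `O(zⁿ⁺¹)`. -/
theorem isBigO_pow_succ_of_hasDerivAt {f f' : ℝ → ℝ} {n : ℕ}
    (hf : ∀ᶠ z in 𝓝 0, HasDerivAt f (f' z) z) (h0 : f 0 = 0)
    (hf' : f' =O[𝓝 0] fun z : ℝ => z ^ n) : f =O[𝓝 0] fun z : ℝ => z ^ (n + 1) := by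
  obtain ⟨C, hC⟩ := hf'.bound
  obtain ⟨δ, hδ, hball⟩ := Metric.eventually_nhds_iff_ball.1 (hf.and hC)
  refine Asymptotics.IsBigO.of_bound C ?_
  filter_upwards [Metric.ball_mem_nhds (0 : ℝ) hδ] with z hz
  have hsub : Metric.closedBall (0 : ℝ) |z| ⊆ Metric.ball 0 δ :=
    Metric.closedBall_subset_ball (by simpa [Real.norm_eq_abs] using hz)
  have hC0 : 0 ≤ C * |z| ^ n := by
    have := (norm_nonneg _).trans (hball z hz).2
    rwa [norm_pow, Real.norm_eq_abs] at this
  have hCnn : z ≠ 0 → 0 ≤ C := fun hz0 =>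
    nonneg_of_mul_nonneg_left hC0 (pow_pos (abs_pos.2 hz0) n)
  by_cases hz0 : z = 0
  · simp [hz0, h0]
  -- Mean value inequality on the closed ball of radius `|z|`, where the derivative is at most `C
  -- |z|ⁿ`.
  have := (convex_closedBall (0 : ℝ) |z|).norm_image_sub_le_of_norm_hasDerivWithin_le
    (f := f) (f' := f') (C := C * |z| ^ n) (x := 0) (y := z)
    (fun t ht => (hball t (hsub ht)).1.hasDerivWithinAt)
    (fun t ht => by
      refine (hball t (hsub ht)).2.trans ?_
      rw [norm_pow]
      have : ‖t‖ ≤ |z| := by simpa using ht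
      have hc := hCnn hz0
      gcongr)
    (by simp) (by simp)
  rw [h0, sub_zero, sub_zero] at this
  calc ‖f z‖ ≤ C * |z| ^ n * ‖z‖ := this
    _ = C * ‖z ^ (n + 1)‖ := by rw [norm_pow, Real.norm_eq_abs, pow_succ, mul_assoc]

/-! ### Black holes: the integrated equations in `x = 1 - h / r`. -/

open Wiener in
/-- The unknown power series in the compactified radius `x = 1 - h / r` of the black hole problem
with horizon radius `h`: the lapse `n`, its inverse `q`, the inverse `a` of the metric function,
and the rates of change `φ j` of the electric and `ℓ ψ j` of the magnetic functions. -/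
structure HorizonData where
  N : ℕ
  k : ℤ
  h : ℝ
  w : ℕ → ℝ
  ℓ : ℝ
  n : Wiener
  q : Wiener
  a : Wiener
  φ : ℕ → Wiener
  ψ : ℕ → Wiener

namespace HorizonData

open Wiener

variable (D : HorizonData)

/-- The magnetic functions. -/
noncomputable def omega (j : ℕ) : Wiener :=
  if j ∈ Finset.Icc 1 (D.N - 1) then
    algebraMap ℝ Wiener (D.w j) + D.ℓ • (X * avg 1 (D.ψ j)) else 0

/-- The electric functions divided by `x`. -/
noncomputable def ehat (j : ℕ) : Wiener := avg 1 (D.φ j)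

/-- The sum of the squares of the products of electric and magnetic functions, divided by `x²`. -/
noncomputable def zsum : Wiener := ∑ j ∈ Finset.Icc 1 (D.N - 1), D.omega j ^ 2 * D.ehat j ^ 2

/-- The sum of the squares of the rates `ψ j`. -/
noncomputable def gsum : Wiener := ∑ j ∈ Finset.Icc 1 (D.N - 1), D.ψ j ^ 2

/-- The logarithmic derivative of the metric function, divided by `ℓ²`. -/
noncomputable def logS : Wiener :=
  (1 - X) ^ 3 * ((D.ℓ ^ 2 / (2 * D.h ^ 4)) • (D.a ^ 2 * D.q ^ 2 * D.zsum) + (2 / D.h ^ 2) • D.gsum)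

/-- The sum of the squares of the rates of the electric potentials. -/
noncomputable def etasum : Wiener := ∑ j ∈ Finset.Icc 1 D.N, traceless D.N D.φ j ^ 2

/-- The magnetic potential energy. -/
noncomputable def psum : Wiener := ∑ j ∈ Finset.Icc 1 D.N,
  (D.omega j ^ 2 - D.omega (j - 1) ^ 2
    - algebraMap ℝ Wiener ((D.k : ℝ) * ((D.N : ℝ) + 1 - 2 * (j : ℝ)))) ^ 2

/-- The derivative of the rescaled mass function, divided by `ℓ²`. -/
noncomputable def massRate : Wiener :=
  D.h⁻¹ • ((D.h ^ 2 / 4) • (D.etasum * D.a ^ 2) + (D.ℓ ^ 2 / 4) • (X * D.zsum * D.q * D.a ^ 2)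
    + D.h ^ 2 • (X * D.n * D.gsum) + (1 / 4 : ℝ) • D.psum)

/-- The correction of the lapse, divided by `ℓ²`. -/
noncomputable def lapse : Wiener :=
  ((D.k : ℝ) / D.h ^ 2) • (1 - X) ^ 2 - (2 / D.h ^ 3) • ((1 - X) ^ 3 * avg 1 D.massRate)

/-- The potentials `W_j`. -/
noncomputable def pot (j : ℕ) : Wiener :=
  algebraMap ℝ Wiener D.k - D.omega j ^ 2 + (1 / 2 : ℝ) • (D.omega (j + 1) ^ 2 + D.omega (j - 1) ^ 2)

/-- The electric source terms, divided by `x`. -/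
noncomputable def zvec (j : ℕ) : Wiener :=
  2 * D.omega j ^ 2 * D.ehat j - D.omega (j - 1) ^ 2 * D.ehat (j - 1)
    - D.omega (j + 1) ^ 2 * D.ehat (j + 1)

/-- The magnetic source terms, divided by `ℓ`. -/
noncomputable def magRate (j : ℕ) : Wiener :=
  -(D.ℓ • (X * D.logS * D.n * D.ψ j)) - (1 / D.h ^ 2) •
    ((D.ℓ ^ 2 / 4) • (X * D.omega j * D.ehat j ^ 2 * D.a ^ 2 * D.q) + D.pot j * D.omega j)

theorem abs_one_le : |(1 : ℝ)| ≤ convRadius := by norm_num [convRadius]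

/-- The integrated field equations with the initial rates `e j` of the electric functions. -/
structure IsSolution (e : ℕ → ℝ) : Prop where
  -- Here `ℓ² μ / r² = x n`. Every correction carries `ℓ²`; one factor `ℓ` is kept inside to match
  -- the form `u₀ + ℓ T`.
  n_eq : D.n = horizonPoly + D.ℓ • (D.ℓ • D.lapse)
  -- Multiplied by `3 - 3 x + x²` this says `n q = 1`. Making the inverse an unknown keeps the
  -- system polynomial.
  q_eq : D.q = invHorizonPoly + D.ℓ • (-(D.ℓ • (invHorizonPoly * D.lapse * D.q)))
  -- With `a = 1 / S` this is `a' = -ℓ² a logS`, normalised at `x = 1`, that is, at infinity.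
  a_eq : D.a = 1 + D.ℓ • (-(D.ℓ • primitive 1 abs_one_le (D.a * D.logS)))
  -- The rate is `𝓔_j' = φ_j h / r²`, so prescribing `e j` at `r = h` means `φ_j = h e_j` at `x =
  -- 0`.
  φ_eq : ∀ j ∈ Finset.Icc 1 (D.N - 1), D.φ j = algebraMap ℝ Wiener (D.h * e j) +
    D.ℓ • (D.ℓ • (X * avg 1 (D.logS * D.φ j + (1 / D.h ^ 2) • (D.q * D.zvec j))))
  -- The magnetic equation is `(x n ψ)' = ℓ magRate`. Since `x n ψ` vanishes at the horizon,
  -- integration and division by `x n` give this regular form; the solutions singular at the horizon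
  -- are excluded.
  ψ_eq : ∀ j ∈ Finset.Icc 1 (D.N - 1), D.ψ j = D.ℓ • (D.q * avg 1 (D.magRate j))

/-- The rescaled fields as functions of the radius. -/
noncomputable def fields : EYMFields where
  m := fun r => (1 + D.ℓ ^ 2 * D.k / D.h ^ 2) * D.h ^ 3 / 2
    + D.ℓ ^ 2 * ev (X * avg 1 D.massRate) (1 - D.h / r)
  S := fun r => (ev D.a (1 - D.h / r))⁻¹
  ω := fun j r => ev (D.omega j) (1 - D.h / r)
  α := fun j r => traceless D.N (fun i => ev (X * D.ehat i) (1 - D.h / r)) j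

variable {D} {e : ℕ → ℝ}

theorem IsSolution.n_mul_q (hD : D.IsSolution e) : D.n * D.q = 1 := by
  have h1 := hD.q_eq
  have h2 := hD.n_eq
  have h3 := horizonPoly_mul_inv
  simp only [Algebra.smul_def] at h1 h2
  generalize algebraMap ℝ Wiener D.ℓ = L at h1 h2
  linear_combination D.q * h2 + horizonPoly * h1 + (1 - L * L * D.lapse * D.q) * h3

theorem IsSolution.X_mul_n (hD : D.IsSolution e) :
    X * D.n = 1 - (1 - X) ^ 3 + (D.ℓ ^ 2) • (X * D.lapse) := by
  conv_lhs => rw [hD.n_eq]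
  rw [smul_smul, horizonPoly, mul_add, mul_smul_comm, pow_two D.ℓ]
  congr 1
  ring

variable {r : ℝ}

theorem abs_compact_lt (h0 : 0 < D.h) (hr : D.h ≤ r) : |1 - D.h / r| < convRadius := by
  have hr0 : 0 < r := h0.trans_le hr
  have h1 : 0 ≤ 1 - D.h / r := sub_nonneg.2 ((div_le_one hr0).2 hr)
  have h2 : 0 < D.h / r := by positivity
  rw [abs_of_nonneg h1, convRadius]
  linarith

theorem hasDerivAt_compact (h : ℝ) (hr : r ≠ 0) :
    HasDerivAt (fun r : ℝ => 1 - h / r) (h / r ^ 2) r := by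
  have := ((hasDerivAt_inv hr).const_mul h).const_sub 1
  refine this.congr_deriv ?_
  ring

theorem hasDerivAt_compact_deriv (h : ℝ) (hr : r ≠ 0) :
    HasDerivAt (fun r : ℝ => h / r ^ 2) (-2 * h / r ^ 3) r := by
  have := (((hasDerivAt_pow 2 r).inv (pow_ne_zero 2 hr)).const_mul h)
  refine this.congr_deriv ?_
  push_cast
  field_simp

theorem eventually_hasDerivAt_compact (h : ℝ) (hr : r ≠ 0) :
    ∀ᶠ t in 𝓝 r, HasDerivAt (fun r : ℝ => 1 - h / r) (h / t ^ 2) t :=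
  (eventually_ne_nhds hr).mono fun _ ht => hasDerivAt_compact h ht

theorem eventually_abs_compact (h0 : 0 < D.h) (hr : D.h ≤ r) :
    ∀ᶠ t in 𝓝 r, t ≠ 0 ∧ |1 - D.h / t| < convRadius := by
  have hr0 : r ≠ 0 := (h0.trans_le hr).ne'
  exact (eventually_ne_nhds hr0).and
    ((hasDerivAt_compact D.h hr0).continuousAt.eventually
      (eventually_abs_lt (abs_compact_lt h0 hr)))

theorem hasDerivAt_omega {j : ℕ} (hj : j ∈ Finset.Icc 1 (D.N - 1)) {x : ℝ} (hx : |x| < convRadius) :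
    HasDerivAt (ev (D.omega j)) (D.ℓ * ev (D.ψ j) x) x := by
  have h := ((hasDerivAt_ev_X_mul_avg (D.ψ j) hx).const_mul D.ℓ).const_add (D.w j)
  refine h.congr_of_eventuallyEq ?_
  filter_upwards [eventually_abs_lt hx] with t ht
  rw [omega, if_pos hj, ev_add _ _ ht.le, ev_algebraMap _ ht.le, ev_smul _ _ ht.le]

theorem IsSolution.hasDerivAt_phi (hD : D.IsSolution e) {j : ℕ} (hj : j ∈ Finset.Icc 1 (D.N - 1))
    {x : ℝ} (hx : |x| < convRadius) :
    HasDerivAt (ev (D.φ j))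
      (D.ℓ ^ 2 * (ev D.logS x * ev (D.φ j) x + ev D.q x * ev (D.zvec j) x / D.h ^ 2)) x := by
  have h := ((hasDerivAt_ev_X_mul_avg (D.logS * D.φ j + (1 / D.h ^ 2) • (D.q * D.zvec j))
    hx).const_mul (D.ℓ ^ 2)).const_add (D.h * e j)
  rw [ev_add _ _ hx.le, ev_mul _ _ hx.le, ev_smul _ _ hx.le, ev_mul _ _ hx.le] at h
  refine (h.congr_deriv (by ring)).congr_of_eventuallyEq ?_
  filter_upwards [eventually_abs_lt hx] with t ht
  rw [hD.φ_eq j hj]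
  simp only [ev_add _ _ ht.le, ev_algebraMap _ ht.le, ev_smul _ _ ht.le]
  rw [← hD.φ_eq j hj]
  ring

theorem IsSolution.hasDerivAt_a (hD : D.IsSolution e) {x : ℝ} (hx : |x| < convRadius) :
    HasDerivAt (ev D.a) (-(D.ℓ ^ 2 * (ev D.a x * ev D.logS x))) x := by
  have h := ((hasDerivAt_ev_primitive 1 abs_one_le (D.a * D.logS) hx).const_mul
    (-(D.ℓ ^ 2))).const_add 1
  rw [ev_mul _ _ hx.le] at h
  refine (h.congr_deriv (by ring)).congr_of_eventuallyEq ?_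
  filter_upwards [eventually_abs_lt hx] with t ht
  have ha : ev D.a t = ev (1 + D.ℓ • (-(D.ℓ • primitive 1 abs_one_le (D.a * D.logS)))) t := by
    rw [← hD.a_eq]
  rw [ha]
  simp only [ev_add _ _ ht.le, ev_one ht.le, ev_smul _ _ ht.le, ev_neg _ ht.le]
  ring

theorem IsSolution.ev_X_mul_n (hD : D.IsSolution e) {x : ℝ} (hx : |x| ≤ convRadius) :
    ev (X * D.n) x = 1 - (1 - x) ^ 3 + D.ℓ ^ 2 * ((D.k : ℝ) / D.h ^ 2 * x * (1 - x) ^ 2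
      - 2 / D.h ^ 3 * (1 - x) ^ 3 * ev (X * avg 1 D.massRate) x) := by
  rw [hD.X_mul_n, lapse]
  simp only [ev_add _ _ hx, ev_sub _ _ hx, ev_smul _ _ hx, ev_mul _ _ hx, ev_pow _ _ hx, ev_one hx,
    ev_X]
  ring

theorem IsSolution.hasDerivAt_X_mul_n (hD : D.IsSolution e) {x : ℝ} (hx : |x| < convRadius) :
    HasDerivAt (ev (X * D.n)) (3 * (1 - x) ^ 2 + D.ℓ ^ 2 *
      ((D.k : ℝ) / D.h ^ 2 * ((1 - x) ^ 2 - 2 * x * (1 - x))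
        + 6 / D.h ^ 3 * (1 - x) ^ 2 * ev (X * avg 1 D.massRate) x
        - 2 / D.h ^ 3 * (1 - x) ^ 3 * ev D.massRate x)) x := by
  have hy : HasDerivAt (fun t : ℝ => 1 - t) (-1) x := (hasDerivAt_id x).const_sub 1
  have hI := hasDerivAt_ev_X_mul_avg D.massRate hx
  have h := (((hy.pow 3).const_sub 1).add (((((hasDerivAt_id x).const_mul
    ((D.k : ℝ) / D.h ^ 2)).mul (hy.pow 2)).sub (((hy.pow 3).const_mul (2 / D.h ^ 3)).mul
      hI)).const_mul (D.ℓ ^ 2)))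
  refine (h.congr_deriv ?_).congr_of_eventuallyEq ?_
  · simp only [Pi.pow_apply, id]
    push_cast
    ring
  · filter_upwards [eventually_abs_lt hx] with t ht
    rw [hD.ev_X_mul_n ht.le]
    rfl

/-- The magnetic equations, integrated once. -/
theorem IsSolution.magnetic_eq (hD : D.IsSolution e) {j : ℕ} (hj : j ∈ Finset.Icc 1 (D.N - 1))
    {x : ℝ} (hx : |x| < convRadius) :
    ∃ ψ' N' : ℝ, HasDerivAt (ev (D.ψ j)) ψ' x ∧ HasDerivAt (ev (X * D.n)) N' x ∧
      N' * ev (D.ψ j) x + ev (X * D.n) x * ψ' = D.ℓ * ev (D.magRate j) x := by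
  have h1 := (analyticAt_ev_right (D.ψ j) hx).differentiableAt.hasDerivAt
  have h2 := hD.hasDerivAt_X_mul_n hx
  refine ⟨_, _, h1, h2, ?_⟩
  have h3 : HasDerivAt (ev (X * D.n * D.ψ j)) (D.ℓ * ev (D.magRate j) x) x := by
    have e1 : X * D.n * D.ψ j = D.ℓ • (X * avg 1 (D.magRate j)) := by
      conv_lhs => rw [hD.ψ_eq j hj]
      rw [mul_smul_comm]
      congr 1
      linear_combination (X * avg 1 (D.magRate j)) * hD.n_mul_q
    rw [e1]
    refine ((hasDerivAt_ev_X_mul_avg (D.magRate j) hx).const_mul D.ℓ).congr_of_eventuallyEq ?_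
    filter_upwards [eventually_abs_lt hx] with t ht
    rw [ev_smul _ _ ht.le]
  refine (h2.mul h1).unique (h3.congr_of_eventuallyEq ?_)
  filter_upwards [eventually_abs_lt hx] with t ht
  rw [ev_mul _ _ ht.le]
  rfl

end HorizonData

/-! ### Black holes: verification of the field equations. -/

namespace HorizonData

open Wiener

variable {D : HorizonData} {e : ℕ → ℝ} {r : ℝ}

theorem omega_of_mem {j : ℕ} (hj : j ∈ Finset.Icc 1 (D.N - 1)) :
    D.omega j = algebraMap ℝ Wiener (D.w j) + D.ℓ • (X * avg 1 (D.ψ j)) := if_pos hj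

theorem omega_of_notMem {j : ℕ} (hj : j ∉ Finset.Icc 1 (D.N - 1)) : D.omega j = 0 := if_neg hj

/-- The physical fields of the black hole. -/
noncomputable def phys (D : HorizonData) : EYMFields := EYMFields.ofBlackHoleScaling D.ℓ D.fields

theorem phys_ω (j : ℕ) (r : ℝ) : D.phys.ω j r = ev (D.omega j) (1 - D.h / r) := rfl

theorem phys_elec {j : ℕ} (hj : j ∈ Finset.Icc 1 (D.N - 1)) (r : ℝ) :
    D.phys.elec j r = ev (X * D.ehat j) (1 - D.h / r) :=
  traceless_sub_traceless (fun i => ev (X * D.ehat i) (1 - D.h / r)) hj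

theorem IsSolution.phys_mu (hD : D.IsSolution e) (h0 : 0 < D.h) (hℓ : 0 < D.ℓ) (hr : r ≠ 0)
    (hx : |1 - D.h / r| ≤ convRadius) :
    D.phys.mu D.k D.ℓ r = ev (X * D.n) (1 - D.h / r) * r ^ 2 / D.ℓ ^ 2 := by
  rw [hD.ev_X_mul_n hx]
  simp only [EYMFields.mu, phys, EYMFields.ofBlackHoleScaling, fields]
  field_simp
  ring

/-- For `i = 0` and `i = N` the difference `𝓔_i` is not given by `ehat`, but the factor `ω_i = 0`
removes it. -/
theorem phys_sq_mul_elec (i : ℕ) {r : ℝ} (hx : |1 - D.h / r| ≤ convRadius) :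
    D.phys.ω i r ^ 2 * D.phys.elec i r
      = (1 - D.h / r) * (ev (D.omega i) (1 - D.h / r) ^ 2 * ev (D.ehat i) (1 - D.h / r)) := by
  by_cases hi : i ∈ Finset.Icc 1 (D.N - 1)
  · rw [phys_elec hi, phys_ω, ev_mul _ _ hx, ev_X]
    ring
  · rw [phys_ω, omega_of_notMem hi, ev_zero]
    ring

theorem phys_zeta {r : ℝ} (hx : |1 - D.h / r| ≤ convRadius) :
    D.phys.zeta D.N r = (1 - D.h / r) ^ 2 * ev D.zsum (1 - D.h / r) := by
  rw [EYMFields.zeta, zsum, ev_sum _ _ hx, Finset.mul_sum]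
  refine Finset.sum_congr rfl fun j hj => ?_
  rw [phys_elec hj, phys_ω]
  simp only [ev_mul _ _ hx, ev_pow _ _ hx, ev_X]
  ring

theorem phys_potP {r : ℝ} (hx : |1 - D.h / r| ≤ convRadius) :
    D.phys.potP D.N D.k r = 1 / (4 * r ^ 2) * ev D.psum (1 - D.h / r) := by
  rw [EYMFields.potP, psum, ev_sum _ _ hx]
  congr 1
  refine Finset.sum_congr rfl fun j _ => ?_
  simp only [phys_ω, ev_pow _ _ hx, ev_sub _ _ hx, ev_algebraMap _ hx]

theorem phys_potW (j : ℕ) {r : ℝ} (hx : |1 - D.h / r| ≤ convRadius) :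
    D.phys.potW D.k j r = ev (D.pot j) (1 - D.h / r) := by
  simp only [EYMFields.potW, pot, phys_ω, ev_pow _ _ hx, ev_sub _ _ hx, ev_add _ _ hx,
    ev_smul _ _ hx, ev_algebraMap _ hx]

theorem phys_potZ (j : ℕ) {r : ℝ} (hx : |1 - D.h / r| ≤ convRadius) :
    D.phys.potZ j r = (1 - D.h / r) * ev (D.zvec j) (1 - D.h / r) := by
  have h2 : (2 : Wiener) = algebraMap ℝ Wiener 2 := (map_ofNat _ _).symm
  rw [EYMFields.potZ, phys_sq_mul_elec _ hx, phys_sq_mul_elec _ hx, mul_assoc 2,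
    phys_sq_mul_elec _ hx, zvec, h2]
  simp only [ev_mul _ _ hx, ev_pow _ _ hx, ev_sub _ _ hx, ev_algebraMap _ hx]
  ring

theorem traceless_mul_const (N : ℕ) (E : ℕ → ℝ) (c : ℝ) (j : ℕ) :
    traceless N (fun i => E i * c) j = traceless N E j * c := by
  simp only [traceless, Finset.sum_mul, smul_eq_mul, mul_assoc]

theorem phys_elec_hasDerivAt (hD : D.IsSolution e) (h0 : 0 < D.h) (hr : D.h ≤ r) {j : ℕ}
    (hj : j ∈ Finset.Icc 1 (D.N - 1)) :
    (∀ᶠ t in 𝓝 r, HasDerivAt (D.phys.elec j)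
      (ev (D.φ j) (1 - D.h / t) * (D.h / t ^ 2)) t) ∧
    HasDerivAt (fun t => ev (D.φ j) (1 - D.h / t) * (D.h / t ^ 2))
      (D.ℓ ^ 2 * (ev D.logS (1 - D.h / r) * ev (D.φ j) (1 - D.h / r)
        + ev D.q (1 - D.h / r) * ev (D.zvec j) (1 - D.h / r) / D.h ^ 2) * (D.h / r ^ 2) ^ 2
        + ev (D.φ j) (1 - D.h / r) * (-2 * D.h / r ^ 3)) r := by
  have hr0 : r ≠ 0 := (h0.trans_le hr).ne'
  have hx := abs_compact_lt h0 hr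
  have e1 : D.phys.elec j = fun t => ev (X * D.ehat j) (1 - D.h / t) :=
    funext fun t => phys_elec hj t
  rw [e1]
  exact hasDerivAt_comp_and_deriv (g := ev (X * D.ehat j)) (g₁ := ev (D.φ j))
    ((eventually_abs_lt hx).mono fun t ht => hasDerivAt_ev_X_mul_avg (D.φ j) ht)
    (hD.hasDerivAt_phi hj hx) (eventually_hasDerivAt_compact D.h hr0)
    (hasDerivAt_compact_deriv D.h hr0)

theorem phys_mu_hasDerivAt (hD : D.IsSolution e) (h0 : 0 < D.h) (hℓ : 0 < D.ℓ) (hr : D.h ≤ r)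
    {N' : ℝ} (hN' : HasDerivAt (ev (X * D.n)) N' (1 - D.h / r)) :
    HasDerivAt (D.phys.mu D.k D.ℓ) ((N' * (D.h / r ^ 2) * r ^ 2
      + ev (X * D.n) (1 - D.h / r) * (2 * r)) / D.ℓ ^ 2) r := by
  have hr0 : r ≠ 0 := (h0.trans_le hr).ne'
  have h1 : HasDerivAt (fun t => ev (X * D.n) (1 - D.h / t)) (N' * (D.h / r ^ 2)) r :=
    HasDerivAt.comp (h₂ := ev (X * D.n)) r hN' (hasDerivAt_compact D.h hr0)
  have h2 := (h1.mul (hasDerivAt_pow 2 r)).div_const (D.ℓ ^ 2)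
  refine (h2.congr_deriv (by simp)).congr_of_eventuallyEq ?_
  filter_upwards [eventually_abs_compact h0 hr] with t ht
  exact hD.phys_mu h0 hℓ ht.1 ht.2.le

/-- The term `-2 / r` of the electric equation is absorbed by `dx/dr = h / r²`. After inserting `q =
1 / n`, each equation is a rational identity; `r > h` gives `x ≠ 0`, so that `μ` can be divided out.
-/
theorem IsSolution.fieldEquations (hD : D.IsSolution e) (h0 : 0 < D.h) (hℓ : 0 < D.ℓ)
    (hr : D.h < r) (hn : ev D.n (1 - D.h / r) ≠ 0) (ha : ev D.a (1 - D.h / r) ≠ 0) :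
    D.phys.FieldEquations D.N D.k D.ℓ r := by
  have hr0 : r ≠ 0 := (h0.trans hr).ne'
  have hx := abs_compact_lt h0 hr.le
  have hh : D.h ≠ 0 := h0.ne'
  have hl : D.ℓ ≠ 0 := hℓ.ne'
  obtain ⟨x, hxdef⟩ : ∃ x, x = 1 - D.h / r := ⟨_, rfl⟩
  have hx0 : x ≠ 0 := by
    rw [hxdef]
    exact (sub_pos.2 ((div_lt_one (h0.trans hr)).2 hr)).ne'
  have hq : ev D.n x * ev D.q x = 1 := by
    rw [hxdef, ← ev_mul _ _ hx.le, hD.n_mul_q, ev_one hx.le]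
  have hcpt := hasDerivAt_compact D.h hr0
  choose! ψ' N₁ hψ' hN₁ hmag using fun (j : ℕ) (hj : j ∈ Finset.Icc 1 (D.N - 1)) =>
    hD.magnetic_eq hj hx
  have hNder := hD.hasDerivAt_X_mul_n hx
  obtain ⟨N', hN'⟩ : ∃ N', HasDerivAt (ev (X * D.n)) N' (1 - D.h / r) := ⟨_, hNder⟩
  have hmag' : ∀ j ∈ Finset.Icc 1 (D.N - 1),
      N' * ev (D.ψ j) x + x * ev D.n x * ψ' j = D.ℓ * ev (D.magRate j) x := by
    intro j hj
    have := hmag j hj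
    rw [(hN₁ j hj).unique hN', ev_mul _ _ hx.le, ev_X, ← hxdef] at this
    exact this
  have hmu : D.phys.mu D.k D.ℓ r = x * ev D.n x * r ^ 2 / D.ℓ ^ 2 := by
    rw [hD.phys_mu h0 hℓ hr0 hx.le, ev_mul _ _ hx.le, ev_X, hxdef]
  have hS : D.phys.S r = (ev D.a x)⁻¹ := by rw [hxdef]; rfl
  have hder_S : HasDerivAt D.phys.S (D.ℓ ^ 2 * ev D.logS x / ev D.a x * (D.h / r ^ 2)) r := by
    have h1 : HasDerivAt (fun t => ev D.a (1 - D.h / t)) _ r :=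
      HasDerivAt.comp (h₂ := ev D.a) r (hD.hasDerivAt_a hx) hcpt
    refine (h1.inv ha).congr_deriv ?_
    rw [← hxdef] at ha ⊢
    field_simp
  have hlogS : D.ℓ ^ 2 * ev D.logS x / ev D.a x * (D.h / r ^ 2) / D.phys.S r
      = D.ℓ ^ 2 * ev D.logS x * (D.h / r ^ 2) := by
    rw [← hxdef] at ha
    rw [hS]
    field_simp
  rw [← hxdef] at ha hn
  refine EYMFields.fieldEquations_of_hasDerivAt
    (m₁ := ev D.massRate x * (D.h / r ^ 2)) (S₁ := D.ℓ ^ 2 * ev D.logS x / ev D.a x * (D.h / r ^ 2))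
    (μ₁ := (N' * (D.h / r ^ 2) * r ^ 2 + ev (X * D.n) (1 - D.h / r) * (2 * r)) / D.ℓ ^ 2)
    (α₁ := fun j => traceless D.N (fun i => ev (D.φ i) x) j * (D.h / r ^ 2))
    (ω₁ := fun j t => D.ℓ * ev (D.ψ j) (1 - D.h / t) * (D.h / t ^ 2))
    (ω₂ := fun j => D.ℓ * ψ' j * (D.h / r ^ 2) ^ 2 + D.ℓ * ev (D.ψ j) (1 - D.h / r)
      * (-2 * D.h / r ^ 3)) (E₁ := fun j t => ev (D.φ j) (1 - D.h / t) * (D.h / t ^ 2))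
    ?_ hder_S (phys_mu_hasDerivAt hD h0 hℓ hr.le hN') ?_ ?_
    (fun j hj => phys_elec_hasDerivAt hD h0 hr.le hj) ?_ ?_ ?_ ?_
  · have h1 : HasDerivAt (fun t => ev (X * avg 1 D.massRate) (1 - D.h / t)) _ r :=
      HasDerivAt.comp (h₂ := ev (X * avg 1 D.massRate)) r
        (hasDerivAt_ev_X_mul_avg D.massRate hx) hcpt
    have h2 := ((h1.const_mul (D.ℓ ^ 2)).const_add
      ((1 + D.ℓ ^ 2 * D.k / D.h ^ 2) * D.h ^ 3 / 2)).div_const (D.ℓ ^ 2)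
    refine h2.congr_deriv ?_
    rw [hxdef]
    field_simp
  · intro j hj
    rw [← traceless_mul_const]
    refine HasDerivAt.traceless (E := fun i t => ev (X * D.ehat i) (1 - D.h / t)) (fun i hi => ?_) j
    rw [hxdef]
    exact (hasDerivAt_ev_X_mul_avg (D.φ i) hx).comp r hcpt
  · intro j hj
    exact hasDerivAt_comp_and_deriv (g := ev (D.omega j)) (g₁ := fun y => D.ℓ * ev (D.ψ j) y)
      ((eventually_abs_lt hx).mono fun t ht => hasDerivAt_omega hj ht)
      ((hψ' j hj).const_mul D.ℓ) (eventually_hasDerivAt_compact D.h hr0)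
      (hasDerivAt_compact_deriv D.h hr0)
  · have h1 : ∑ j ∈ Finset.Icc 1 D.N, (traceless D.N (fun i => ev (D.φ i) x) j * (D.h / r ^ 2)) ^ 2
        = ev D.etasum x * (D.h / r ^ 2) ^ 2 := by
      rw [hxdef, etasum, ev_sum _ _ hx.le, Finset.sum_mul]
      refine Finset.sum_congr rfl fun j _ => ?_
      rw [ev_pow _ _ hx.le, ev_traceless _ _ _ hx.le, mul_pow]
    have h2 : ∑ j ∈ Finset.Icc 1 (D.N - 1),
        (D.ℓ * ev (D.ψ j) (1 - D.h / r) * (D.h / r ^ 2)) ^ 2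
        = D.ℓ ^ 2 * ev D.gsum x * (D.h / r ^ 2) ^ 2 := by
      rw [hxdef, gsum, ev_sum _ _ hx.le, Finset.mul_sum, Finset.sum_mul]
      refine Finset.sum_congr rfl fun j _ => ?_
      rw [ev_pow _ _ hx.le, mul_pow, mul_pow]
    rw [h1, h2, phys_zeta hx.le, phys_potP hx.le, hmu, hS, ← hxdef]
    have h3 : ev D.massRate x = D.h⁻¹ * (D.h ^ 2 / 4 * (ev D.etasum x * ev D.a x ^ 2)
        + D.ℓ ^ 2 / 4 * (x * ev D.zsum x * ev D.q x * ev D.a x ^ 2)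
        + D.h ^ 2 * (x * ev D.n x * ev D.gsum x) + 1 / 4 * ev D.psum x) := by
      rw [hxdef, massRate]
      simp only [ev_mul _ _ hx.le, ev_pow _ _ hx.le, ev_add _ _ hx.le, ev_smul _ _ hx.le, ev_X]
    have hq' : ev D.q x = (ev D.n x)⁻¹ := eq_inv_of_mul_eq_one_right hq
    rw [h3, hq']
    field_simp
  · have h2 : ∑ j ∈ Finset.Icc 1 (D.N - 1),
        (D.ℓ * ev (D.ψ j) (1 - D.h / r) * (D.h / r ^ 2)) ^ 2
        = D.ℓ ^ 2 * ev D.gsum x * (D.h / r ^ 2) ^ 2 := by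
      rw [hxdef, gsum, ev_sum _ _ hx.le, Finset.mul_sum, Finset.sum_mul]
      refine Finset.sum_congr rfl fun j _ => ?_
      rw [ev_pow _ _ hx.le, mul_pow, mul_pow]
    rw [h2, hlogS, phys_zeta hx.le, hmu, hS, ← hxdef]
    have h3 : ev D.logS x = (D.h / r) ^ 3 * (D.ℓ ^ 2 / (2 * D.h ^ 4) *
        (ev D.a x ^ 2 * ev D.q x ^ 2 * ev D.zsum x) + 2 / D.h ^ 2 * ev D.gsum x) := by
      rw [hxdef, logS]
      simp only [ev_mul _ _ hx.le, ev_pow _ _ hx.le, ev_add _ _ hx.le, ev_smul _ _ hx.le, ev_X,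
        ev_sub _ _ hx.le, ev_one hx.le, sub_sub_cancel]
    have hq' : ev D.q x = (ev D.n x)⁻¹ := eq_inv_of_mul_eq_one_right hq
    rw [h3, hq']
    field_simp
  · intro j hj
    rw [hlogS, phys_potZ j hx.le, hmu, ← hxdef]
    have hq' : ev D.q x = (ev D.n x)⁻¹ := eq_inv_of_mul_eq_one_right hq
    rw [hq']
    field_simp
    ring
  · intro j hj
    have hm := hmag' j hj
    have h3 : ev (D.magRate j) x = -(D.ℓ * (x * ev D.logS x * ev D.n x * ev (D.ψ j) x))
        - 1 / D.h ^ 2 * (D.ℓ ^ 2 / 4 * (x * ev (D.omega j) x * ev (D.ehat j) x ^ 2 * ev D.a x ^ 2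
          * ev D.q x) + ev (D.pot j) x * ev (D.omega j) x) := by
      rw [hxdef, magRate]
      simp only [ev_mul _ _ hx.le, ev_pow _ _ hx.le, ev_add _ _ hx.le, ev_smul _ _ hx.le, ev_X,
        ev_sub _ _ hx.le, ev_neg _ hx.le]
    have hq' : ev D.q x = (ev D.n x)⁻¹ := eq_inv_of_mul_eq_one_right hq
    rw [hlogS, phys_potW j hx.le, hmu, hS, phys_elec hj, phys_ω, ev_mul _ _ hx.le, ev_X,
      ev_mul _ _ hx.le, ev_X, ← hxdef]
    rw [h3, hq'] at hm
    -- The once integrated magnetic equation, solved for the derivative of the rate.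
    have hψ : ψ' j = (D.ℓ * (-(D.ℓ * (x * ev D.logS x * ev D.n x * ev (D.ψ j) x))
        - 1 / D.h ^ 2 * (D.ℓ ^ 2 / 4 * (x * ev (D.omega j) x * ev (D.ehat j) x ^ 2 * ev D.a x ^ 2
          * (ev D.n x)⁻¹) + ev (D.pot j) x * ev (D.omega j) x)) - N' * ev (D.ψ j) x)
        / (x * ev D.n x) := by
      rw [eq_div_iff (mul_ne_zero hx0 hn)]
      linear_combination hm
    rw [hψ]
    field_simp
    ring

end HorizonData

/-! ### Black holes: analyticity of the right-hand sides, which are polynomial in the unknowns. -/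

namespace HorizonData

open Wiener

/-- The space of unknowns. -/
abbrev State (N : ℕ) : Type :=
  Wiener × Wiener × Wiener × (Finset.Icc 1 (N - 1) → Wiener) × (Finset.Icc 1 (N - 1) → Wiener)

/-- The data with given parameters and unknowns. -/
noncomputable def ofState (N : ℕ) (k : ℤ) (h : ℝ) (w : ℕ → ℝ) (v : ℝ × State N) :
    HorizonData where
  N := N
  k := k
  h := h
  w := w
  ℓ := v.1
  n := v.2.1
  q := v.2.2.1
  a := v.2.2.2.1
  φ := fun j => extendZero v.2.2.2.2.1 j
  ψ := fun j => extendZero v.2.2.2.2.2 j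

section ContDiff

variable (N : ℕ) (k : ℤ) (h : ℝ) (w : ℕ → ℝ)

theorem contDiff_omega (j : ℕ) : ContDiff ℝ ⊤ fun v => (ofState N k h w v).omega j := by
  by_cases hj : j ∈ Finset.Icc 1 (N - 1)
  · have e : (fun v => (ofState N k h w v).omega j) = fun v =>
        algebraMap ℝ Wiener (w j) + v.1 • (X * avg 1 (extendZero v.2.2.2.2.2 j)) :=
      funext fun v => omega_of_mem (D := ofState N k h w v) hj
    rw [e]
    fun_prop
  · have e : (fun v => (ofState N k h w v).omega j) = fun _ => 0 :=
      funext fun v => omega_of_notMem (D := ofState N k h w v) hj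
    rw [e]
    fun_prop

theorem contDiff_ehat (j : ℕ) : ContDiff ℝ ⊤ fun v => (ofState N k h w v).ehat j := by
  simp only [ehat, ofState]
  fun_prop

theorem contDiff_zsum : ContDiff ℝ ⊤ fun v => (ofState N k h w v).zsum := by
  have h1 := contDiff_omega N k h w
  have h2 := contDiff_ehat N k h w
  show ContDiff ℝ ⊤ fun v => ∑ j ∈ Finset.Icc 1 (N - 1),
    (ofState N k h w v).omega j ^ 2 * (ofState N k h w v).ehat j ^ 2
  fun_prop

theorem contDiff_gsum : ContDiff ℝ ⊤ fun v => (ofState N k h w v).gsum := by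
  simp only [gsum, ofState]
  fun_prop

theorem contDiff_logS : ContDiff ℝ ⊤ fun v => (ofState N k h w v).logS := by
  have h1 := contDiff_zsum N k h w
  have h2 := contDiff_gsum N k h w
  simp only [logS]
  simp only [ofState] at h1 h2 ⊢
  fun_prop

theorem contDiff_etasum : ContDiff ℝ ⊤ fun v => (ofState N k h w v).etasum := by
  simp only [etasum, ofState]
  fun_prop

theorem contDiff_psum : ContDiff ℝ ⊤ fun v => (ofState N k h w v).psum := by
  have h1 := contDiff_omega N k h w
  show ContDiff ℝ ⊤ fun v => ∑ j ∈ Finset.Icc 1 N, ((ofState N k h w v).omega j ^ 2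
    - (ofState N k h w v).omega (j - 1) ^ 2
    - algebraMap ℝ Wiener ((k : ℝ) * ((N : ℝ) + 1 - 2 * (j : ℝ)))) ^ 2
  fun_prop

theorem contDiff_massRate : ContDiff ℝ ⊤ fun v => (ofState N k h w v).massRate := by
  have h1 := contDiff_zsum N k h w
  have h2 := contDiff_gsum N k h w
  have h3 := contDiff_etasum N k h w
  have h4 := contDiff_psum N k h w
  simp only [massRate]
  simp only [ofState] at h1 h2 h3 h4 ⊢
  fun_prop

theorem contDiff_lapse : ContDiff ℝ ⊤ fun v => (ofState N k h w v).lapse := by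
  have h1 := contDiff_massRate N k h w
  simp only [lapse]
  simp only [ofState] at h1 ⊢
  fun_prop

theorem contDiff_zvec (j : ℕ) : ContDiff ℝ ⊤ fun v => (ofState N k h w v).zvec j := by
  have h1 := contDiff_omega N k h w
  have h2 := contDiff_ehat N k h w
  simp only [zvec]
  fun_prop

theorem contDiff_pot (j : ℕ) : ContDiff ℝ ⊤ fun v => (ofState N k h w v).pot j := by
  have h1 := contDiff_omega N k h w
  simp only [pot]
  simp only [ofState] at h1 ⊢
  fun_prop

theorem contDiff_magRate (j : ℕ) : ContDiff ℝ ⊤ fun v => (ofState N k h w v).magRate j := by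
  have h1 := contDiff_omega N k h w
  have h2 := contDiff_ehat N k h w
  have h3 := contDiff_logS N k h w
  have h4 := contDiff_pot N k h w
  simp only [magRate]
  simp only [ofState] at h1 h2 h3 h4 ⊢
  fun_prop

/-- The right hand side of the integrated field equations, without the leading order. -/
noncomputable def rhs (v : ℝ × State N) : State N :=
  let D := ofState N k h w v
  (v.1 • D.lapse, -(v.1 • (invHorizonPoly * D.lapse * D.q)),
    -(v.1 • primitive 1 abs_one_le (D.a * D.logS)),
    (fun j => v.1 • (X * avg 1 (D.logS * D.φ j + (1 / D.h ^ 2) • (D.q * D.zvec j)))),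
    fun j => D.q * avg 1 (D.magRate j))

theorem contDiff_rhs : ContDiff ℝ ⊤ (rhs N k h w) := by
  have h1 := contDiff_lapse N k h w
  have h2 := contDiff_logS N k h w
  have h3 := contDiff_zvec N k h w
  have h4 := contDiff_magRate N k h w
  show ContDiff ℝ ⊤ fun v => rhs N k h w v
  simp only [rhs]
  simp only [ofState] at h1 h2 h3 h4 ⊢
  refine ContDiff.prodMk (by fun_prop) (ContDiff.prodMk (by fun_prop) (ContDiff.prodMk
    (by fun_prop) (ContDiff.prodMk ?_ ?_)))
  · exact contDiff_pi.2 fun j => by fun_prop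
  · exact contDiff_pi.2 fun j => by fun_prop

/-- The leading order of the integrated field equations. -/
noncomputable def leading (p : Finset.Icc 1 (N - 1) → ℝ) : State N :=
  (horizonPoly, invHorizonPoly, 1, (fun j => (h * p j) • (1 : Wiener)), 0)

theorem contDiff_leading : ContDiff ℝ ⊤ (leading N h) := by
  show ContDiff ℝ ⊤ fun p => leading N h p
  simp only [leading]
  refine ContDiff.prodMk (by fun_prop) (ContDiff.prodMk (by fun_prop) (ContDiff.prodMk
    (by fun_prop) (ContDiff.prodMk ?_ (by fun_prop))))
  exact contDiff_pi.2 fun j => by fun_prop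

theorem isSolution_ofState {ℓ : ℝ} {u : State N} {e : ℕ → ℝ}
    (hu : u = leading N h (fun j => e j) + ℓ • rhs N k h w (ℓ, u)) :
    (ofState N k h w (ℓ, u)).IsSolution e where
  n_eq := congrArg (fun z => z.1) hu
  q_eq := congrArg (fun z => z.2.1) hu
  a_eq := congrArg (fun z => z.2.2.1) hu
  φ_eq := fun j hj => by
    have := congrFun (congrArg (fun z => z.2.2.2.1) hu) ⟨j, hj⟩
    rw [Algebra.algebraMap_eq_smul_one]
    refine Eq.trans ?_ this
    exact extendZero_of_mem _ hj
  ψ_eq := fun j hj => by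
    have := congrFun (congrArg (fun z => z.2.2.2.2) hu) ⟨j, hj⟩
    refine (Eq.trans ?_ this).trans (zero_add _)
    exact extendZero_of_mem _ hj

end ContDiff

/-! ### Black holes: behaviour at the horizon and at infinity. -/

variable {D : HorizonData} {e : ℕ → ℝ} {r : ℝ}

theorem isSuN (D : HorizonData) : D.phys.IsSuN D.N := fun r => by
  refine ⟨?_, ?_, ?_, ?_, sum_traceless _ _⟩
  · rw [phys_ω, omega_of_notMem (by simp), ev_zero]
  · rw [phys_ω, omega_of_notMem (by simp only [Finset.mem_Icc]; omega), ev_zero]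
  · exact traceless_of_notMem _ (by simp)
  · exact traceless_of_notMem _ (by simp)

theorem analyticAt_ev_compact (h0 : 0 < D.h) (hr : D.h ≤ r) (f : Wiener) :
    AnalyticAt ℝ (fun t => ev f (1 - D.h / t)) r :=
  AnalyticAt.fun_comp (g := ev f) (analyticAt_ev_right f (abs_compact_lt h0 hr))
    (analyticAt_const.sub (analyticAt_const.div analyticAt_id (h0.trans_le hr).ne'))

theorem compact_mem_Icc (h0 : 0 < D.h) (hr : D.h ≤ r) : 1 - D.h / r ∈ Icc (0 : ℝ) 1 := by
  have hr0 : 0 < r := h0.trans_le hr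
  have h1 : D.h / r ≤ 1 := (div_le_one hr0).2 hr
  have h2 : 0 < D.h / r := by positivity
  exact ⟨by linarith, by linarith⟩

theorem isRegular (h0 : 0 < D.h) (hℓ : 0 < D.ℓ) (ha : ∀ x ∈ Icc (0 : ℝ) 1, 0 < ev D.a x) :
    D.phys.IsRegular D.N D.h := by
  refine ⟨fun r hr => ?_, fun r hr => ?_, fun j _ r hr => ?_, fun j _ r hr => ?_⟩
  · exact (analyticAt_const.add (analyticAt_const.mul (analyticAt_ev_compact h0 hr _))).div
      analyticAt_const (pow_ne_zero 2 hℓ.ne')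
  · exact (analyticAt_ev_compact h0 hr _).inv (ha _ (compact_mem_Icc h0 hr)).ne'
  · exact analyticAt_ev_compact h0 hr _
  · exact AnalyticAt.traceless (fun i _ => analyticAt_ev_compact h0 hr _) j

/-- In `z = 1 / r` the compact variable is `x = 1 - h z`, analytic through `z = 0`. The factor `(1 -
x)³ = (h z)³` of `logS` makes `dS/dz = O(z³)`, and `S = 1` at `z = 0`. -/
theorem isAsymptoticallyAdS (hD : D.IsSolution e) (h0 : 0 < D.h) (hℓ : 0 < D.ℓ) :
    D.phys.IsAsymptoticallyAdS D.N := by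
  have h1 : |1 - D.h * (0 : ℝ)| < convRadius := by norm_num [convRadius]
  have han : ∀ f : Wiener, AnalyticAt ℝ (fun z => ev f (1 - D.h * z)) 0 := fun f =>
    AnalyticAt.fun_comp (g := ev f) (analyticAt_ev_right f h1)
      (analyticAt_const.sub (analyticAt_const.mul analyticAt_id))
  have ha1 : ev D.a (1 - D.h * 0) = 1 := by
    rw [mul_zero, sub_zero, hD.a_eq, ev_add _ _ abs_one_le, ev_one abs_one_le,
      ev_smul _ _ abs_one_le, ev_neg _ abs_one_le, ev_smul _ _ abs_one_le, ev_primitive_self]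
    ring
  have ha0 : ∀ᶠ z in 𝓝 (0 : ℝ), ev D.a (1 - D.h * z) ≠ 0 :=
    (han D.a).continuousAt.eventually_ne (by rw [ha1]; exact one_ne_zero)
  have hlt : ∀ᶠ z in 𝓝 (0 : ℝ), |1 - D.h * z| < convRadius :=
    (show ContinuousAt (fun z : ℝ => 1 - D.h * z) 0 by fun_prop).tendsto.eventually
      (eventually_abs_lt h1)
  refine ⟨fun z => ((1 + D.ℓ ^ 2 * D.k / D.h ^ 2) * D.h ^ 3 / 2
      + D.ℓ ^ 2 * ev (X * avg 1 D.massRate) (1 - D.h * z)) / D.ℓ ^ 2,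
    fun z => (ev D.a (1 - D.h * z))⁻¹, fun j z => ev (D.omega j) (1 - D.h * z),
    fun j z => traceless D.N (fun i => ev (X * D.ehat i) (1 - D.h * z)) j, ?_, ?_,
    fun j _ => han _, fun j _ => AnalyticAt.traceless (fun i _ => han _) j, ?_, ?_⟩
  · exact (analyticAt_const.add (analyticAt_const.mul (han _))).div analyticAt_const
      (pow_ne_zero 2 hℓ.ne')
  · exact (han _).inv (by rw [ha1]; exact one_ne_zero)
  · refine isBigO_pow_succ_of_hasDerivAt (n := 3)
      (f' := fun z => -(D.ℓ ^ 2 * D.h ^ 4) * (z ^ 3 * (ev ((D.ℓ ^ 2 / (2 * D.h ^ 4)) •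
        (D.a ^ 2 * D.q ^ 2 * D.zsum) + (2 / D.h ^ 2) • D.gsum) (1 - D.h * z)
          / ev D.a (1 - D.h * z)))) ?_ ?_ ?_
    · filter_upwards [ha0, hlt] with z hz hz'
      have h2 : HasDerivAt (fun z : ℝ => 1 - D.h * z) (-D.h) z := by
        simpa using ((hasDerivAt_id z).const_mul D.h).const_sub 1
      have h3 := ((HasDerivAt.comp (h₂ := ev D.a) z (hD.hasDerivAt_a hz') h2).inv hz).sub_const 1
      refine h3.congr_deriv ?_
      have hl : ev D.logS (1 - D.h * z) = (D.h * z) ^ 3 * ev ((D.ℓ ^ 2 / (2 * D.h ^ 4)) •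
        (D.a ^ 2 * D.q ^ 2 * D.zsum) + (2 / D.h ^ 2) • D.gsum) (1 - D.h * z) := by
        rw [logS, ev_mul _ _ hz'.le, ev_pow _ _ hz'.le, ev_sub _ _ hz'.le, ev_one hz'.le, ev_X,
          sub_sub_cancel]
      simp only [Function.comp]
      rw [hl]
      field_simp
    · simp only [ha1, inv_one, sub_self]
    · refine Asymptotics.IsBigO.const_mul_left ?_ _
      have := (Asymptotics.isBigO_refl (fun z : ℝ => z ^ 3) (𝓝 0)).mul
        (((han ((D.ℓ ^ 2 / (2 * D.h ^ 4)) • (D.a ^ 2 * D.q ^ 2 * D.zsum)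
          + (2 / D.h ^ 2) • D.gsum)).div (han D.a)
            (by rw [ha1]; exact one_ne_zero)).continuousAt.isBigO_one ℝ)
      simpa using this
  · exact Eventually.of_forall fun r => ⟨by simp only [← div_eq_mul_inv]; rfl,
      by simp only [← div_eq_mul_inv]; rfl, fun j _ => by simp only [← div_eq_mul_inv]; rfl,
      fun j _ => by simp only [← div_eq_mul_inv]; rfl⟩

theorem isBlackHole (hD : D.IsSolution e) (h0 : 0 < D.h) (hℓ : 0 < D.ℓ)
    (hn : ∀ x ∈ Icc (0 : ℝ) 1, 0 < ev D.n x) (ha : ∀ x ∈ Icc (0 : ℝ) 1, 0 < ev D.a x) :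
    D.phys.IsBlackHole D.N D.k D.ℓ D.h D.w e := by
  have hx0 : 1 - D.h / D.h = 0 := by rw [div_self h0.ne', sub_self]
  have habs := abs_compact_lt h0 le_rfl
  have h00 : |(0 : ℝ)| ≤ convRadius := by simpa using convRadius_pos.le
  have hmu0 := hD.phys_mu h0 hℓ h0.ne' habs.le
  rw [hx0, ev_mul _ _ h00, ev_X, zero_mul, zero_mul, zero_div] at hmu0
  refine ⟨⟨isSuN D, isRegular h0 hℓ ha, fun r hr => ?_, fun r hr => ?_, fun r hr => ?_,
    isAsymptoticallyAdS hD h0 hℓ⟩, hmu0, ?_, fun j hj => ?_, fun j hj => ⟨?_, ?_⟩⟩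
  · exact inv_pos.2 (ha _ (compact_mem_Icc h0 hr))
  · have hx := abs_compact_lt h0 hr.le
    have hr0 : 0 < r := h0.trans hr
    rw [hD.phys_mu h0 hℓ hr0.ne' hx.le, ev_mul _ _ hx.le, ev_X]
    have h1 := hn _ (compact_mem_Icc h0 hr.le)
    have h2 : 0 < 1 - D.h / r := sub_pos.2 ((div_lt_one hr0).2 hr)
    positivity
  · exact hD.fieldEquations h0 hℓ hr (hn _ (compact_mem_Icc h0 hr.le)).ne'
      (ha _ (compact_mem_Icc h0 hr.le)).ne'
  · obtain ⟨N', hN'⟩ : ∃ N', HasDerivAt (ev (X * D.n)) N' (1 - D.h / D.h) :=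
      ⟨_, hD.hasDerivAt_X_mul_n habs⟩
    -- The derivative of `x n` at `x = 0` is `n 0`; its positivity makes the horizon non-extremal.
    have h1 : N' = ev D.n 0 := by
      have h2 : HasDerivAt (fun t => t * ev D.n t) (1 * ev D.n 0 + 0 * deriv (ev D.n) 0) 0 :=
        (hasDerivAt_id (0 : ℝ)).mul
          (analyticAt_ev_right D.n (by simpa using convRadius_pos)).differentiableAt.hasDerivAt
      rw [hx0] at hN'
      rw [hN'.unique (h2.congr_of_eventuallyEq ?_)]
      · ring
      · filter_upwards [eventually_abs_lt (x := 0) (by simpa using convRadius_pos)] with t ht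
        rw [ev_mul _ _ ht.le, ev_X]
    rw [(phys_mu_hasDerivAt hD h0 hℓ le_rfl hN').deriv, hx0, ev_mul _ _ h00, ev_X, zero_mul,
      zero_mul, add_zero, h1]
    have := hn 0 (by simp)
    positivity
  · show traceless D.N (fun i => ev (X * D.ehat i) (1 - D.h / D.h)) j = 0
    rw [hx0]
    refine traceless_eq_zero_of_notMem_or (fun i _ => ?_) j
    rw [ev_mul _ _ h00, ev_X, zero_mul]
  · rw [phys_ω, hx0, omega, if_pos hj, ev_add _ _ h00, ev_algebraMap _ h00, ev_smul _ _ h00,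
      ev_mul _ _ h00, ev_X, zero_mul, mul_zero, add_zero]
  · rw [(phys_elec_hasDerivAt hD h0 le_rfl hj).1.self_of_nhds.deriv, hx0, hD.φ_eq j hj]
    simp only [ev_add _ _ h00, ev_algebraMap _ h00, ev_smul _ _ h00, ev_mul _ _ h00, ev_X, zero_mul,
      mul_zero, add_zero]
    field_simp

/-- Values at the horizon of a continuous function that vanishes outside. -/
theorem eq_of_eqOn_Ioi {f g : ℝ → ℝ} {h : ℝ} (hf : ContinuousAt f h) (hg : ContinuousAt g h)
    (hfg : ∀ r, h < r → f r = g r) : f h = g h := by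
  have h1 : Tendsto f (𝓝[>] h) (𝓝 (f h)) := hf.tendsto.mono_left nhdsWithin_le_nhds
  have h2 : Tendsto g (𝓝[>] h) (𝓝 (g h)) := hg.tendsto.mono_left nhdsWithin_le_nhds
  refine tendsto_nhds_unique (h1.congr' ?_) h2
  filter_upwards [self_mem_nhdsWithin] with r hr
  exact hfg r hr

/-- Vanishing and embedding hypotheses concern only `r > h`. Analyticity at `h` makes the
derivatives continuous there, so the identity passes to the limit. -/
theorem deriv_eq_of_eqOn_Ioi {f g : ℝ → ℝ} {h : ℝ} (hf : AnalyticAt ℝ f h) (hg : AnalyticAt ℝ g h)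
    (hfg : ∀ r, h < r → f r = g r) : deriv f h = deriv g h := by
  refine eq_of_eqOn_Ioi hf.deriv.continuousAt hg.deriv.continuousAt fun r hr => ?_
  refine Filter.EventuallyEq.deriv_eq ?_
  filter_upwards [lt_mem_nhds hr] with t ht
  exact hfg t ht

end HorizonData

/-! ### Black holes: non-triviality. -/

namespace EYMFields

variable {F : EYMFields} {N : ℕ} {r₀ : ℝ}

theorem IsRegular.analyticAt_elec (hF : F.IsRegular N r₀) {j : ℕ}
    (hj : j ∈ Finset.Icc 1 (N - 1)) : AnalyticAt ℝ (F.elec j) r₀ := by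
  obtain ⟨h1, h2⟩ := Finset.mem_Icc.1 hj
  exact (hF.2.2.2 j (Finset.mem_Icc.2 (by omega)) r₀ self_mem_Ici).sub
    (hF.2.2.2 (j + 1) (Finset.mem_Icc.2 (by omega)) r₀ self_mem_Ici)

theorem IsPurelyMagnetic.elec_eq_zero (hF : F.IsPurelyMagnetic N r₀) {j : ℕ}
    (hj : j ∈ Finset.Icc 1 (N - 1)) {r : ℝ} (hr : r₀ < r) : F.elec j r = 0 := by
  obtain ⟨h1, h2⟩ := Finset.mem_Icc.1 hj
  rw [elec, hF j (Finset.mem_Icc.2 (by omega)) r hr, hF (j + 1) (Finset.mem_Icc.2 (by omega)) r hr,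
    sub_zero]

theorem IsEmbeddedSU2.elec_eq (hF : F.IsEmbeddedSU2 N r₀) :
    ∃ a : ℝ → ℝ, ∀ r, r₀ < r → ∀ j ∈ Finset.Icc 1 (N - 1), F.elec j r = a r := by
  obtain ⟨w, a, h⟩ := hF
  refine ⟨fun r => 2 * a r, fun r hr j hj => ?_⟩
  obtain ⟨h1, h2⟩ := Finset.mem_Icc.1 hj
  rw [elec, (h r hr).2 j (Finset.mem_Icc.2 (by omega)),
    (h r hr).2 (j + 1) (Finset.mem_Icc.2 (by omega))]
  push_cast
  ring

end EYMFields

theorem sqrtGamma_pos {N j : ℕ} (hj : j ∈ Finset.Icc 1 (N - 1)) : 0 < sqrtGamma N j := by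
  obtain ⟨h1, h2⟩ := Finset.mem_Icc.1 hj
  have h3 : (1 : ℝ) ≤ j := by exact_mod_cast h1
  have h4 : (j : ℝ) + 1 ≤ N := by exact_mod_cast (by omega : j + 1 ≤ N)
  exact Real.sqrt_pos.2 (mul_pos (by linarith) (by linarith))

namespace EYMFields.IsBlackHole

variable {F : EYMFields} {N : ℕ} {k : ℤ} {ℓ h : ℝ} {w e : ℕ → ℝ}

theorem not_isPurelyMagnetic (hF : F.IsBlackHole N k ℓ h w e)
    (he : ∃ j ∈ Finset.Icc 1 (N - 1), e j ≠ 0) : ¬ F.IsPurelyMagnetic N h := fun hm => by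
  obtain ⟨j, hj, hej⟩ := he
  refine hej ?_
  rw [← (hF.2.2.2.2 j hj).2, HorizonData.deriv_eq_of_eqOn_Ioi (hF.1.2.1.analyticAt_elec hj)
    (g := fun _ => 0) analyticAt_const fun r hr => hm.elec_eq_zero hj hr]
  simp

theorem not_isAbelian (hF : F.IsBlackHole N k ℓ h w e)
    (hw : ∃ j ∈ Finset.Icc 1 (N - 1), w j ≠ 0) : ¬ F.IsAbelian N h := fun hm => by
  obtain ⟨j, hj, hwj⟩ := hw
  refine hwj ?_
  rw [← (hF.2.2.2.2 j hj).1]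
  exact HorizonData.eq_of_eqOn_Ioi (hF.1.2.1.2.2.1 j hj h self_mem_Ici).continuousAt
    (g := fun _ => 0) continuousAt_const fun r hr => hm j hj r hr

/-- The functions of an embedding carry no regularity, so they are first eliminated in favour of the
component `j = 1`, which is analytic, and only then is the limit `r → h` taken. -/
theorem exists_of_isEmbeddedSU2 (hN : 2 ≤ N) (hF : F.IsBlackHole N k ℓ h w e)
    (hm : F.IsEmbeddedSU2 N h) :
    ∃ c d : ℝ, ∀ j ∈ Finset.Icc 1 (N - 1), w j = sqrtGamma N j * c ∧ e j = d := by
  have h1 : 1 ∈ Finset.Icc 1 (N - 1) := Finset.mem_Icc.2 (by omega)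
  have hs := (sqrtGamma_pos h1).ne'
  obtain ⟨a, ha⟩ := hm.elec_eq
  obtain ⟨v, b, hv⟩ := hm
  refine ⟨w 1 / sqrtGamma N 1, e 1, fun j hj => ⟨?_, ?_⟩⟩
  · rw [← (hF.2.2.2.2 j hj).1, ← (hF.2.2.2.2 1 h1).1]
    have hc1 := (hF.1.2.1.2.2.1 1 h1 h self_mem_Ici).continuousAt
    refine HorizonData.eq_of_eqOn_Ioi (hF.1.2.1.2.2.1 j hj h self_mem_Ici).continuousAt
      (g := fun r => sqrtGamma N j * (F.ω 1 r / sqrtGamma N 1))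
      (continuousAt_const.mul (hc1.div_const _)) fun r hr => ?_
    rw [(hv r hr).1 j hj, (hv r hr).1 1 h1]
    field_simp
  · rw [← (hF.2.2.2.2 j hj).2, ← (hF.2.2.2.2 1 h1).2]
    exact HorizonData.deriv_eq_of_eqOn_Ioi (hF.1.2.1.analyticAt_elec hj)
      (hF.1.2.1.analyticAt_elec h1) fun r hr => by rw [ha r hr j hj, ha r hr 1 h1]

end EYMFields.IsBlackHole

/-! ### Black holes: existence. -/

namespace HorizonData

open Wiener

/-- Each field is built from evaluations of an analytic map of `(ℓ, U ℓ)` at `1 - h / r`, and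
evaluation is jointly analytic; negative `ℓ` plays no special role. -/
theorem isAnalyticFamily {N : ℕ} (k : ℤ) {h : ℝ} (h0 : 0 < h) (w : ℕ → ℝ) {U : ℝ → State N}
    {δ : ℝ} (hU : ∀ ℓ ∈ Ioo (-δ) δ, AnalyticAt ℝ U ℓ)
    (ha : ∀ ℓ ∈ Ioo (-δ) δ, ∀ x ∈ Icc (0 : ℝ) 1, 0 < ev (U ℓ).2.2.1 x) :
    EYMFields.IsAnalyticFamily (fun ℓ => (ofState N k h w (ℓ, U ℓ)).fields) N δ h := by
  have key : ∀ f : ℝ × State N → Wiener, ContDiff ℝ ⊤ f → ∀ p ∈ Ioo (-δ) δ ×ˢ Ici h,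
      AnalyticAt ℝ (fun p : ℝ × ℝ => ev (f (p.1, U p.1)) (1 - h / p.2)) p := by
    rintro f hf p ⟨hp1, hp2⟩
    have hx : |1 - h / p.2| < convRadius :=
      abs_compact_lt (D := ofState N k h w (0, 0)) h0 hp2
    have h1 : AnalyticAt ℝ (fun p : ℝ × ℝ => U p.1) p :=
      AnalyticAt.fun_comp (g := U) (hU p.1 hp1) analyticAt_fst
    have h2 : AnalyticAt ℝ (fun p : ℝ × ℝ => f (p.1, U p.1)) p :=
      AnalyticAt.fun_comp (g := f) (f := fun p : ℝ × ℝ => (p.1, U p.1)) hf.contDiffAt.analyticAt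
        (analyticAt_fst.prod h1)
    have hp0 : p.2 ≠ 0 := (h0.trans_le hp2).ne'
    exact AnalyticAt.fun_comp (g := fun q : Wiener × ℝ => ev q.1 q.2)
      (f := fun p : ℝ × ℝ => (f (p.1, U p.1), 1 - h / p.2)) (analyticAt_ev _ hx)
      (h2.prod (analyticAt_const.sub (analyticAt_const.div analyticAt_snd hp0)))
  refine ⟨fun p hp => ?_, fun p hp => ?_, fun j _ p hp => ?_, fun j _ p hp => ?_⟩
  · have h1 := key (fun v => X * avg 1 (ofState N k h w v).massRate)
      (by have := contDiff_massRate N k h w; fun_prop) p hp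
    have h2 : AnalyticAt ℝ (fun p : ℝ × ℝ => (1 + p.1 ^ 2 * k / h ^ 2) * h ^ 3 / 2) p :=
      ContDiffAt.analyticAt (by fun_prop)
    exact h2.add ((analyticAt_fst.pow 2).mul h1)
  · exact (key (fun v => v.2.2.2.1) (by fun_prop) p hp).inv
      (ha p.1 hp.1 _ (compact_mem_Icc (D := ofState N k h w (0, 0)) h0 hp.2)).ne'
  · exact key _ (contDiff_omega N k h w j) p hp
  · refine AnalyticAt.traceless (fun i _ => ?_) j
    exact key (fun v => X * (ofState N k h w v).ehat i)
      (by have := contDiff_ehat N k h w; fun_prop) p hp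

theorem ev_pos_of_norm_sub_lt {f g : Wiener} {x : ℝ} (hx : x ∈ Icc (0 : ℝ) 1) (h : ‖f - g‖ < 1)
    (hg : 1 ≤ ev g x) : 0 < ev f x := by
  have hx' : |x| ≤ convRadius := by
    rw [abs_of_nonneg hx.1, convRadius]
    linarith [hx.2]
  have h1 := (abs_ev_le (f - g) hx').trans_lt h
  rw [ev_sub _ _ hx'] at h1
  linarith [(abs_lt.1 h1).1]

/-- Existence of black holes for small `ℓ`. -/
theorem exists_blackHole (N : ℕ) (hN : 2 ≤ N) (k : ℤ) (rh : ℝ) (h0 : 0 < rh) (w : ℕ → ℝ) :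
    ∃ ε > (0 : ℝ), ∃ ℓ₀ > (0 : ℝ), ∀ (e : ℕ → ℝ), (∀ j ∈ Finset.Icc 1 (N - 1), |e j| < ε) →
      ∃ G : ℝ → EYMFields, EYMFields.IsAnalyticFamily G N ℓ₀ rh ∧
        ∀ ℓ ∈ Set.Ioo 0 ℓ₀, ∃ F : EYMFields, F = EYMFields.ofBlackHoleScaling ℓ (G ℓ) ∧
          F.IsBlackHole N k ℓ rh w e ∧
          F.IsNodeless {j | j ∈ Finset.Icc 1 (N - 1) ∧ w j ≠ 0} rh ∧
          ((∃ j ∈ Finset.Icc 1 (N - 1), e j ≠ 0) → ¬ F.IsPurelyMagnetic N rh) ∧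
          ((∃ j ∈ Finset.Icc 1 (N - 1), w j ≠ 0) → ¬ F.IsAbelian N rh) ∧
          ((¬ ∃ c d : ℝ, ∀ j ∈ Finset.Icc 1 (N - 1), w j = sqrtGamma N j * c ∧ e j = d) →
            ¬ F.IsEmbeddedSU2 N rh) := by
  -- The norm dominates the supremum on `[0, 1]`, so these open conditions give `n > 0`, `a > 0` and
  -- `|ω_j - w_j| < |w_j|`. They hold at the limit `ℓ = 0`.
  set O : Set (ℝ × (Finset.Icc 1 (N - 1) → ℝ) × State N) :=
    {y | ‖y.2.2.1 - horizonPoly‖ < 1 ∧ ‖y.2.2.2.2.1 - 1‖ < 1 ∧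
      ∀ j : Finset.Icc 1 (N - 1), w j ≠ 0 →
        ‖y.1 • (X * avg 1 (y.2.2.2.2.2.2 j))‖ < |w j|} with hOdef
  have hO : O ∈ 𝓝 ((0 : ℝ), (0 : Finset.Icc 1 (N - 1) → ℝ),
      (ContinuousLinearEquiv.refl ℝ (State N)).symm (leading N rh 0)) := by
    refine Filter.Eventually.and ?_ (Filter.Eventually.and ?_ ?_)
    · refine ContinuousAt.eventually_lt (by fun_prop) continuousAt_const ?_
      simp [leading]
    · refine ContinuousAt.eventually_lt (by fun_prop) continuousAt_const ?_
      simp [leading]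
    · refine eventually_all.2 fun j => ?_
      by_cases hj : w j = 0
      · exact Eventually.of_forall fun y h => absurd hj h
      · refine (ContinuousAt.eventually_lt (f := fun y : ℝ × (Finset.Icc 1 (N - 1) → ℝ) × State N =>
          ‖y.1 • (X * avg 1 (y.2.2.2.2.2.2 j))‖) (by fun_prop) continuousAt_const ?_).mono
            fun y hy _ => hy
        simpa using hj
  obtain ⟨δ, hδ, U, hU, hsol⟩ := exists_analytic_solution
    (ContinuousLinearEquiv.refl ℝ (State N)) (leading N rh) (contDiff_leading N rh)
    (fun y : ℝ × (Finset.Icc 1 (N - 1) → ℝ) × State N => rhs N k rh w (y.1, y.2.2))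
    ((contDiff_rhs N k rh w).comp (by fun_prop)) O hO
  -- The ball in `ℝ × P` is taken in the maximum norm, so its radius bounds `ℓ` and each `e j`
  -- separately.
  refine ⟨δ, hδ, δ, hδ, fun e he => ?_⟩
  set p : Finset.Icc 1 (N - 1) → ℝ := fun j => e j with hp
  have hball : ∀ ℓ ∈ Ioo (-δ) δ, (ℓ, p) ∈ Metric.ball (0 : ℝ × (Finset.Icc 1 (N - 1) → ℝ)) δ := by
    intro ℓ hℓ
    rw [mem_ball_zero_iff, Prod.norm_def, max_lt_iff]
    exact ⟨abs_lt.2 hℓ, (pi_norm_lt_iff hδ).2 fun j => he j j.2⟩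
  have hU' : ∀ ℓ ∈ Ioo (-δ) δ, AnalyticAt ℝ (fun ℓ => U (ℓ, p)) ℓ := fun ℓ hℓ =>
    AnalyticAt.fun_comp (g := U) (f := fun ℓ : ℝ => (ℓ, p)) (hU _ (hball ℓ hℓ))
      (analyticAt_id.prod analyticAt_const)
  have hone : ∀ x ∈ Icc (0 : ℝ) 1, |x| ≤ convRadius := fun x hx => by
    rw [abs_of_nonneg hx.1, convRadius]
    linarith [hx.2]
  have ha : ∀ ℓ ∈ Ioo (-δ) δ, ∀ x ∈ Icc (0 : ℝ) 1, 0 < ev (U (ℓ, p)).2.2.1 x := fun ℓ hℓ x hx =>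
    ev_pos_of_norm_sub_lt hx (hsol _ (hball ℓ hℓ)).2.2.1 (ev_one (hone x hx)).ge
  refine ⟨_, isAnalyticFamily k h0 w hU' ha, fun ℓ hℓ => ⟨_, rfl, ?_⟩⟩
  have hℓ' : ℓ ∈ Ioo (-δ) δ := ⟨by linarith [hℓ.1], hℓ.2⟩
  obtain ⟨heq, hn, -, hw⟩ := hsol _ (hball ℓ hℓ')
  set D := ofState N k rh w (ℓ, U (ℓ, p)) with hDdef
  have hD : D.IsSolution e := isSolution_ofState N k rh w heq
  have hbh : D.phys.IsBlackHole N k ℓ rh w e := by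
    refine isBlackHole hD h0 hℓ.1 (fun x hx => ev_pos_of_norm_sub_lt hx hn ?_) (ha ℓ hℓ')
    have h3 : (3 : Wiener) = algebraMap ℝ Wiener 3 := (map_ofNat _ _).symm
    rw [horizonPoly, h3]
    simp only [ev_add _ _ (hone x hx), ev_sub _ _ (hone x hx), ev_mul _ _ (hone x hx),
      ev_pow _ _ (hone x hx), ev_algebraMap _ (hone x hx), ev_X]
    -- Since `3 - 3 x + x² - 1 = (1 - x) (2 - x) ≥ 0` on `[0, 1]`, a perturbation of norm below `1`
    -- keeps `n` positive.
    nlinarith [hx.1, hx.2]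
  refine ⟨hbh, ?_, hbh.not_isPurelyMagnetic, hbh.not_isAbelian, fun hne hm =>
    hne (hbh.exists_of_isEmbeddedSU2 hN hm)⟩
  rintro j ⟨hj, hwj⟩ r hr hzero
  have hx := abs_compact_lt (D := D) h0 hr
  have h1 := (abs_ev_le _ hx.le).trans_lt (hw ⟨j, hj⟩ hwj)
  have h2 : ev (D.omega j) (1 - D.h / r) = 0 := hzero
  rw [omega_of_mem (D := D) hj, ev_add _ _ hx.le, ev_algebraMap _ hx.le] at h2
  have h3 : D.ψ j = (U (ℓ, p)).2.2.2.2 ⟨j, hj⟩ := extendZero_of_mem _ hj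
  rw [h3] at h2
  have h4 : ev (D.ℓ • (X * avg 1 ((U (ℓ, p)).2.2.2.2 ⟨j, hj⟩))) (1 - D.h / r) = -w j :=
    eq_neg_of_add_eq_zero_right h2
  have h5 : |ev (D.ℓ • (X * avg 1 ((U (ℓ, p)).2.2.2.2 ⟨j, hj⟩))) (1 - D.h / r)| < |w j| := h1
  rw [h4, abs_neg] at h5
  exact lt_irrefl _ h5

end HorizonData

/-! ### Hahn polynomials and the eigenvalue equation. -/

/-- The coefficients of the Hahn polynomial with respect to the functions `(-x)_i`. -/
noncomputable def hahnCoeff (N k i : ℕ) : ℝ :=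
  (ascPochhammer ℝ i).eval (-(k : ℝ)) * (ascPochhammer ℝ i).eval ((k : ℝ) + 1)
    / ((ascPochhammer ℝ i).eval 2 * (ascPochhammer ℝ i).eval (1 - (N : ℝ)) * (i.factorial : ℝ))

theorem hahnQ_eq (N k : ℕ) (x : ℝ) :
    hahnQ N k x = ∑ i ∈ Finset.range (k + 1), hahnCoeff N k i * (ascPochhammer ℝ i).eval (-x) :=
  Finset.sum_congr rfl fun i _ => by rw [hahnCoeff]; ring

theorem ascPochhammer_eval_neg_natCast_ne_zero {k i : ℕ} (h : i ≤ k) :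
    (ascPochhammer ℝ i).eval (-(k : ℝ)) ≠ 0 := by
  induction i with
  | zero => simp
  | succ m ih =>
    rw [ascPochhammer_succ_eval]
    have h2 : (m : ℝ) < k := by exact_mod_cast h
    exact mul_ne_zero (ih (by omega)) (by linarith)

theorem ascPochhammer_eval_one_sub_ne_zero {N i : ℕ} (h : i + 1 ≤ N) :
    (ascPochhammer ℝ i).eval (1 - (N : ℝ)) ≠ 0 := by
  have e : (1 - (N : ℝ)) = -((N - 1 : ℕ) : ℝ) := by
    rw [Nat.cast_sub (by omega)]
    push_cast
    ring
  rw [e]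
  exact ascPochhammer_eval_neg_natCast_ne_zero (by omega)

theorem hahnCoeff_ne_zero {N k : ℕ} (h : k + 1 ≤ N) : hahnCoeff N k k ≠ 0 := by
  have h1 := ascPochhammer_eval_neg_natCast_ne_zero (le_refl k)
  have h2 := ascPochhammer_eval_one_sub_ne_zero h
  have h3 := (ascPochhammer_pos k ((k : ℝ) + 1) (by positivity)).ne'
  have h4 := (ascPochhammer_pos k (2 : ℝ) (by positivity)).ne'
  have h5 : (k.factorial : ℝ) ≠ 0 := by positivity
  exact div_ne_zero (mul_ne_zero h1 h3) (mul_ne_zero (mul_ne_zero h4 h2) h5)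

/-- The ratio of consecutive hypergeometric coefficients, with `(i - k) (k + 1 + i) = i (i + 1) - k
(k + 1)`. -/
theorem hahnCoeff_succ {N k i : ℕ} (hi : i < k) (h : k + 1 ≤ N) :
    hahnCoeff N k (i + 1) * (((i : ℝ) + 1) * ((i : ℝ) + 2) * ((N : ℝ) - 1 - i))
      = hahnCoeff N k i * ((k : ℝ) * (k + 1) - (i : ℝ) * (i + 1)) := by
  have h2 := ascPochhammer_eval_one_sub_ne_zero (show i + 1 ≤ N by omega)
  have h4 := (ascPochhammer_pos i (2 : ℝ) (by positivity)).ne'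
  have h5 : (i.factorial : ℝ) ≠ 0 := by positivity
  have h6 : (i : ℝ) + 2 ≤ N := by exact_mod_cast (show i + 2 ≤ N by omega)
  have h7 : (1 - (N : ℝ) + i) ≠ 0 := by linarith
  have h8 : (2 + (i : ℝ)) ≠ 0 := by positivity
  have h9 : ((i : ℝ) + 1) ≠ 0 := by positivity
  rw [hahnCoeff, hahnCoeff]
  simp only [ascPochhammer_succ_eval, Nat.factorial_succ]
  push_cast
  field_simp
  ring

/-- The second order difference operator of the Hahn polynomials on the functions `(-x)_i`. -/
theorem difference_ascPochhammer (x : ℝ) (i : ℕ) :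
    2 * (x + 1) * (ascPochhammer ℝ (i + 1)).eval (-x)
      - x * (ascPochhammer ℝ (i + 1)).eval (-(x - 1))
      - (x + 2) * (ascPochhammer ℝ (i + 1)).eval (-(x + 1))
      = ((i : ℝ) + 1) * (i + 2) * (ascPochhammer ℝ i).eval (-x) := by
  have h1 : ∀ (y : ℝ) (n : ℕ), (ascPochhammer ℝ (n + 1)).eval y
      = y * (ascPochhammer ℝ n).eval (y + 1) := fun y n => by
    rw [ascPochhammer_succ_left, Polynomial.eval_mul, Polynomial.eval_X, Polynomial.eval_comp]
    simp
  have h2 : x * (ascPochhammer ℝ (i + 1)).eval (-(x - 1))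
      = -((ascPochhammer ℝ (i + 1 + 1)).eval (-x)) := by
    rw [h1 (-x) (i + 1), show -x + 1 = -(x - 1) by ring]
    ring
  rw [h2, h1 (-(x + 1)) i, show -(x + 1) + 1 = -x by ring]
  simp only [ascPochhammer_succ_eval]
  push_cast
  ring

/-- The difference operator lowers `(-x)ᵢ₊₁` to a multiple of `(-x)ᵢ`. Writing `N - 1 - x = (N - 1 -
i) + (i - x)`, the first part yields the coefficient recursion and the second raises the index
again; the terms other than the eigenvalue multiple telescope. -/
theorem hahnQ_difference {N k : ℕ} (h : k + 1 ≤ N) (x : ℝ) :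
    ((N : ℝ) - 1 - x) * (2 * (x + 1) * hahnQ N k x - x * hahnQ N k (x - 1)
      - (x + 2) * hahnQ N k (x + 1)) = (k : ℝ) * (k + 1) * hahnQ N k x := by
  have h1 : 2 * (x + 1) * hahnQ N k x - x * hahnQ N k (x - 1) - (x + 2) * hahnQ N k (x + 1)
      = ∑ i ∈ Finset.range k, hahnCoeff N k (i + 1) * (((i : ℝ) + 1) * (i + 2)
        * (ascPochhammer ℝ i).eval (-x)) := by
    simp only [hahnQ_eq, Finset.mul_sum]
    rw [← Finset.sum_sub_distrib, ← Finset.sum_sub_distrib, Finset.sum_range_succ']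
    simp only [← difference_ascPochhammer]
    simp only [ascPochhammer_zero, Polynomial.eval_one]
    rw [show 2 * (x + 1) * (hahnCoeff N k 0 * 1) - x * (hahnCoeff N k 0 * 1)
      - (x + 2) * (hahnCoeff N k 0 * 1) = 0 by ring, add_zero]
    refine Finset.sum_congr rfl fun i _ => by ring
  rw [h1, hahnQ_eq, Finset.sum_range_succ, Finset.mul_sum, mul_add]
  have h2 : ∀ i ∈ Finset.range k, ((N : ℝ) - 1 - x) * (hahnCoeff N k (i + 1)
      * (((i : ℝ) + 1) * (i + 2) * (ascPochhammer ℝ i).eval (-x)))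
      = (k : ℝ) * (k + 1) * (hahnCoeff N k i * (ascPochhammer ℝ i).eval (-x))
        + (hahnCoeff N k (i + 1) * (((i + 1 : ℕ) : ℝ) * ((i + 1 : ℕ) + 1))
            * (ascPochhammer ℝ (i + 1)).eval (-x)
          - hahnCoeff N k i * ((i : ℝ) * (i + 1)) * (ascPochhammer ℝ i).eval (-x)) := by
    intro i hi
    have h3 := hahnCoeff_succ (Finset.mem_range.1 hi) h
    rw [ascPochhammer_succ_eval]
    push_cast
    linear_combination (ascPochhammer ℝ i).eval (-x) * h3
  rw [Finset.sum_congr rfl h2, Finset.sum_add_distrib, ← Finset.mul_sum,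
    Finset.sum_range_sub (fun i => hahnCoeff N k i * ((i : ℝ) * (i + 1))
      * (ascPochhammer ℝ i).eval (-x))]
  push_cast
  ring

/-- The factor `N - 1 - x` of the difference equation vanishes here, while the eigenvalue `k (k +
1)` does not. -/
theorem hahnQ_eq_zero {N k : ℕ} (hk : 1 ≤ k) (h : k + 1 ≤ N) : hahnQ N k ((N : ℝ) - 1) = 0 := by
  have h1 := hahnQ_difference h ((N : ℝ) - 1)
  rw [sub_self, zero_mul] at h1
  have h2 : (1 : ℝ) ≤ k := by exact_mod_cast hk
  have h3 : (k : ℝ) * (k + 1) ≠ 0 := by positivity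
  exact (mul_eq_zero.1 h1.symm).resolve_left h3

theorem gamma_mul_modeVec {N k : ℕ} (hk : 1 ≤ k) (h : k + 1 ≤ N) (j : ℕ) :
    (j : ℝ) * ((N : ℝ) - j) * modeVec N k j = ((N : ℝ) - 1) * (j * hahnQ N k ((j : ℝ) - 1)) := by
  rw [modeVec]
  -- At `j = N` the convention `1 / 0 = 0` makes `modeVec` vanish, consistently with the zero of the
  -- Hahn polynomial at `N - 1`.
  by_cases hj : (N : ℝ) - j = 0
  · have : (j : ℝ) = N := by linarith
    rw [this, hahnQ_eq_zero hk h]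
    simp
  · field_simp

/-- The eigenvalue equation. -/
theorem modeVec_eigen {N k j : ℕ} (hk : k ∈ Finset.Icc 1 (N - 1)) (hj : j ∈ Finset.Icc 1 (N - 1)) :
    2 * ((j : ℝ) * ((N : ℝ) - j)) * modeVec N k j
      - ((j - 1 : ℕ) : ℝ) * ((N : ℝ) - (j - 1 : ℕ)) * modeVec N k (j - 1)
      - ((j + 1 : ℕ) : ℝ) * ((N : ℝ) - (j + 1 : ℕ)) * modeVec N k (j + 1)
      = (k : ℝ) * (k + 1) * modeVec N k j := by
  obtain ⟨h1, h2⟩ := Finset.mem_Icc.1 hk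
  obtain ⟨h3, h4⟩ := Finset.mem_Icc.1 hj
  have h : k + 1 ≤ N := by omega
  have hNj : (j : ℝ) + 1 ≤ N := by exact_mod_cast (show j + 1 ≤ N by omega)
  have hne : (N : ℝ) - j ≠ 0 := by linarith
  rw [mul_assoc 2, gamma_mul_modeVec h1 h, gamma_mul_modeVec h1 h, gamma_mul_modeVec h1 h, modeVec]
  have h5 := hahnQ_difference h ((j : ℝ) - 1)
  rw [Nat.cast_sub h3]
  push_cast
  have h6 : (j : ℝ) + 1 - 1 = j - 1 + 1 := by ring
  rw [h6]
  have h7 : (k : ℝ) * (k + 1) * (((N : ℝ) - 1) / (N - j) * hahnQ N k (j - 1))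
      = ((N : ℝ) - 1) / (N - j) * ((k : ℝ) * (k + 1) * hahnQ N k (j - 1)) := by ring
  rw [h7, ← h5]
  field_simp
  ring

theorem modeVec_one {N j : ℕ} (hj : j ∈ Finset.Icc 1 (N - 1)) : modeVec N 1 j = 1 := by
  obtain ⟨h3, h4⟩ := Finset.mem_Icc.1 hj
  have hNj : (j : ℝ) + 1 ≤ N := by exact_mod_cast (show j + 1 ≤ N by omega)
  have h3' : (1 : ℝ) ≤ j := by exact_mod_cast h3
  have hne : (N : ℝ) - j ≠ 0 := by linarith
  have hne2 : (N : ℝ) - 1 ≠ 0 := by linarith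
  have hne3 : (1 : ℝ) - N ≠ 0 := by linarith
  rw [modeVec, hahnQ, Finset.sum_range_succ, Finset.sum_range_one]
  simp
  field_simp
  ring

/-! ### Eigenvectors as polynomials in the index: products and independence. -/

open Polynomial in
/-- The Hahn polynomial as a polynomial. -/
noncomputable def hahnPoly (N k : ℕ) : ℝ[X] :=
  ∑ i ∈ Finset.range (k + 1), C (hahnCoeff N k i) * (ascPochhammer ℝ i).comp (-X)

open Polynomial in
theorem eval_hahnPoly (N k : ℕ) (x : ℝ) : (hahnPoly N k).eval x = hahnQ N k x := by
  simp [hahnPoly, hahnQ_eq, eval_finsetSum, eval_comp]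

open Polynomial in
theorem natDegree_ascPochhammer_comp_neg (i : ℕ) :
    ((ascPochhammer ℝ i).comp (-X)).natDegree = i := by
  rw [natDegree_comp, natDegree_neg, natDegree_X, ascPochhammer_natDegree, mul_one]

open Polynomial in
theorem natDegree_hahnPoly {N k : ℕ} (h : k + 1 ≤ N) : (hahnPoly N k).natDegree = k := by
  have h1 := hahnCoeff_ne_zero h
  have h2 : (C (hahnCoeff N k k) * (ascPochhammer ℝ k).comp (-X)).natDegree = k := by
    rw [natDegree_C_mul h1, natDegree_ascPochhammer_comp_neg]
  rw [hahnPoly, Finset.sum_range_succ]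
  rcases Nat.eq_zero_or_pos k with rfl | hk
  · simp
  · rw [natDegree_add_eq_right_of_natDegree_lt]
    · exact h2
    · rw [h2]
      refine lt_of_le_of_lt (natDegree_sum_le_of_forall_le (n := k - 1) _ _ fun i hi => ?_)
        (by omega)
      refine (natDegree_C_mul_le _ _).trans ?_
      rw [natDegree_ascPochhammer_comp_neg]
      have := Finset.mem_range.1 hi
      omega

open Polynomial in
/-- The eigenvectors are polynomials in the index. -/
theorem exists_modePoly {N k : ℕ} (hk : k ∈ Finset.Icc 1 (N - 1)) :
    ∃ P : ℝ[X], P.natDegree = k - 1 ∧ P ≠ 0 ∧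
      ∀ j ∈ Finset.Icc 1 (N - 1), P.eval (j : ℝ) = modeVec N k j := by
  obtain ⟨h1, h2⟩ := Finset.mem_Icc.1 hk
  have h : k + 1 ≤ N := by omega
  have hN1 : (N : ℝ) - 1 ≠ 0 := by
    have : (2 : ℝ) ≤ N := by exact_mod_cast (show 2 ≤ N by omega)
    linarith
  -- The zero at `N - 1` cancels the denominator `N - j`, which lowers the degree from `k` to `k -
  -- 1`.
  have hroot : (X - C ((N : ℝ) - 1)) ∣ hahnPoly N k := by
    rw [dvd_iff_isRoot, IsRoot, eval_hahnPoly, hahnQ_eq_zero h1 h]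
  obtain ⟨q, hq⟩ := hroot
  have hdeg := natDegree_hahnPoly h
  have hne : hahnPoly N k ≠ 0 := fun h0 => by
    rw [h0, natDegree_zero] at hdeg
    omega
  have hq0 : q ≠ 0 := fun h0 => hne (by rw [hq, h0, mul_zero])
  have hqdeg : q.natDegree = k - 1 := by
    rw [hq, natDegree_mul (X_sub_C_ne_zero _) hq0, natDegree_X_sub_C] at hdeg
    omega
  have hcomp : (q.comp (X - C 1)).natDegree = k - 1 := by
    rw [natDegree_comp, natDegree_X_sub_C, mul_one, hqdeg]
  have hcomp0 : q.comp (X - C 1) ≠ 0 := fun h0 => by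
    have h3 : (q.comp (X - C 1)).comp (X + C 1) = q := by
      rw [comp_assoc]
      simp
    rw [h0, zero_comp] at h3
    exact hq0 h3.symm
  have hc : -((N : ℝ) - 1) ≠ 0 := neg_ne_zero.2 hN1
  refine ⟨C (-((N : ℝ) - 1)) * q.comp (X - C 1), ?_, mul_ne_zero (C_ne_zero.2 hc) hcomp0, ?_⟩
  · rw [natDegree_C_mul hc, hcomp]
  · intro j hj
    obtain ⟨h3, h4⟩ := Finset.mem_Icc.1 hj
    have hNj : (j : ℝ) + 1 ≤ N := by exact_mod_cast (show j + 1 ≤ N by omega)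
    have hne : (N : ℝ) - j ≠ 0 := by linarith
    rw [modeVec, ← eval_hahnPoly, hq]
    simp only [eval_mul, eval_C, eval_comp, eval_sub, eval_X]
    field_simp
    ring

open Polynomial in
/-- Polynomials of low degree are combinations of the first eigenvectors. -/
theorem exists_modeVec_expansion {N : ℕ} (d : ℕ) (hd : d ≤ N - 1) (p : ℝ[X])
    (hp : p.degree < d) :
    ∃ c : ℕ → ℝ, (∀ i, i ∉ Finset.Icc 1 d → c i = 0) ∧
      ∀ j ∈ Finset.Icc 1 (N - 1),
        p.eval (j : ℝ) = ∑ i ∈ Finset.Icc 1 (N - 1), c i * modeVec N i j := by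
  induction d generalizing p with
  | zero =>
    have : p = 0 := by
      rw [← degree_eq_bot]
      exact Nat.WithBot.lt_zero_iff.1 hp
    exact ⟨fun _ => 0, fun _ _ => rfl, fun j _ => by simp [this]⟩
  | succ d ih =>
    have hmem : d + 1 ∈ Finset.Icc 1 (N - 1) := Finset.mem_Icc.2 ⟨by omega, hd⟩
    obtain ⟨P, hP, hP0, hPe⟩ := exists_modePoly hmem
    rw [Nat.add_sub_cancel] at hP
    have hlead : P.coeff d ≠ 0 := by
      rw [← hP, coeff_natDegree]
      exact leadingCoeff_ne_zero.2 hP0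
    -- The polynomial of `v_{d+1}` has degree exactly `d`, so subtracting a multiple of it removes
    -- the coefficient of degree `d`.
    obtain ⟨c, hc, hce⟩ := ih (by omega) (p - C (p.coeff d / P.coeff d) * P) (by
      rw [degree_lt_iff_coeff_zero]
      intro m hm
      rw [coeff_sub, coeff_C_mul]
      rcases eq_or_lt_of_le hm with rfl | hm
      · rw [div_mul_cancel₀ _ hlead, sub_self]
      · rw [(degree_lt_iff_coeff_zero _ _).1 hp m hm,
          coeff_eq_zero_of_natDegree_lt (by omega : P.natDegree < m)]
        simp)
    refine ⟨fun i => c i + if i = d + 1 then p.coeff d / P.coeff d else 0, fun i hi => ?_,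
      fun j hj => ?_⟩
    · show c i + (if i = d + 1 then p.coeff d / P.coeff d else 0) = 0
      have h1 : i ≠ d + 1 := by
        rintro rfl
        exact hi (Finset.mem_Icc.2 (by omega))
      have h2 : i ∉ Finset.Icc 1 d := fun h => hi (Finset.mem_Icc.2 (by
        have := Finset.mem_Icc.1 h
        omega))
      rw [hc i h2, if_neg h1, add_zero]
    · have h1 := hce j hj
      rw [eval_sub, eval_mul, eval_C, hPe j hj] at h1
      simp only [add_mul, Finset.sum_add_distrib, ite_mul, zero_mul]
      rw [Finset.sum_ite_eq', if_pos hmem, ← h1]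
      ring

open Polynomial in
/-- The products of eigenvectors are combinations of eigenvectors, with a selection rule. -/
theorem exists_modeVec_mul (N k l : ℕ) :
    ∃ c : ℕ → ℝ, (∀ i, k + l ≤ i → c i = 0) ∧
      (k ∈ Finset.Icc 1 (N - 1) → l ∈ Finset.Icc 1 (N - 1) → ∀ j ∈ Finset.Icc 1 (N - 1),
        modeVec N k j * modeVec N l j = ∑ i ∈ Finset.Icc 1 (N - 1), c i * modeVec N i j) := by
  by_cases hkl : k ∈ Finset.Icc 1 (N - 1) ∧ l ∈ Finset.Icc 1 (N - 1)
  swap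
  · exact ⟨fun _ => 0, fun _ _ => rfl, fun h1 h2 => absurd ⟨h1, h2⟩ hkl⟩
  obtain ⟨hk, hl⟩ := hkl
  obtain ⟨P, hP, hP0, hPe⟩ := exists_modePoly hk
  obtain ⟨Q, hQ, hQ0, hQe⟩ := exists_modePoly hl
  obtain ⟨hk1, hk2⟩ := Finset.mem_Icc.1 hk
  obtain ⟨hl1, hl2⟩ := Finset.mem_Icc.1 hl
  -- The product has degree `k + l - 2`, so only `v_i` with `i ≤ k + l - 1` occur. If `k + l - 1`
  -- exceeds `N - 1`, this rule is void and it suffices to reduce modulo the polynomial that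
  -- vanishes at all indices.
  by_cases hcase : k + l - 1 ≤ N - 1
  · obtain ⟨c, hc, hce⟩ := exists_modeVec_expansion (k + l - 1) hcase (P * Q) (by
      rw [degree_eq_natDegree (mul_ne_zero hP0 hQ0), natDegree_mul hP0 hQ0, hP, hQ]
      exact_mod_cast (by omega : k - 1 + (l - 1) < k + l - 1))
    refine ⟨c, fun i hi => hc i fun h => ?_, fun _ _ j hj => ?_⟩
    · have := Finset.mem_Icc.1 h
      omega
    · rw [← hce j hj, eval_mul, hPe j hj, hQe j hj]
  · set M : ℝ[X] := ∏ j ∈ Finset.Icc 1 (N - 1), (X - C (j : ℝ)) with hM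
    have hmonic : M.Monic := monic_prod_of_monic _ _ fun j _ => monic_X_sub_C _
    have hMdeg : M.degree = (N - 1 : ℕ) := by
      rw [hM, degree_prod, Finset.sum_congr rfl fun j _ => degree_X_sub_C _]
      simp
    obtain ⟨c, hc, hce⟩ := exists_modeVec_expansion (N - 1) le_rfl ((P * Q) %ₘ M) (by
      rw [← hMdeg]
      exact degree_modByMonic_lt _ hmonic)
    refine ⟨c, fun i hi => hc i fun h => ?_, fun _ _ j hj => ?_⟩
    · have := Finset.mem_Icc.1 h
      omega
    · rw [← hce j hj, modByMonic_eq_sub_mul_div, eval_sub, eval_mul, eval_mul, hPe j hj,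
        hQe j hj]
      have : M.eval (j : ℝ) = 0 := by
        rw [hM, eval_prod]
        exact Finset.prod_eq_zero hj (by simp)
      rw [this, zero_mul, sub_zero]

open Polynomial in
/-- The eigenvectors are linearly independent. -/
theorem modeVec_independent {N : ℕ} {c : ℕ → ℝ}
    (h : ∀ j ∈ Finset.Icc 1 (N - 1), ∑ i ∈ Finset.Icc 1 (N - 1), c i * modeVec N i j = 0) :
    ∀ i ∈ Finset.Icc 1 (N - 1), c i = 0 := by
  choose! P hP hP0 hPe using fun (k : ℕ) (hk : k ∈ Finset.Icc 1 (N - 1)) => exists_modePoly hk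
  -- A polynomial of degree below `N - 1` with `N - 1` zeros vanishes.
  have hsum : ∑ i ∈ Finset.Icc 1 (N - 1), C (c i) * P i = 0 := by
    rcases Nat.eq_zero_or_pos (N - 1) with h0 | h0
    · simp [h0]
    refine eq_zero_of_natDegree_lt_card_of_eval_eq_zero' _
      ((Finset.Icc 1 (N - 1)).map Nat.castEmbedding) ?_ ?_
    · intro x hx
      obtain ⟨j, hj, rfl⟩ := Finset.mem_map.1 hx
      rw [eval_finsetSum, ← h j hj]
      refine Finset.sum_congr rfl fun i hi => ?_
      rw [eval_mul, eval_C, ← hPe i hi j hj]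
      rfl
    · rw [Finset.card_map, Nat.card_Icc, Nat.add_sub_cancel]
      refine lt_of_le_of_lt (natDegree_sum_le_of_forall_le (n := N - 1 - 1) _ _ fun i hi => ?_)
        (by omega)
      refine (natDegree_C_mul_le _ _).trans ?_
      rw [hP i hi]
      have := Finset.mem_Icc.1 hi
      omega
  -- The degrees `i - 1` are distinct, so the top coefficients can be removed one after another.
  have key : ∀ d, d ≤ N - 1 → ∑ i ∈ Finset.Icc 1 d, C (c i) * P i = 0 →
      ∀ i ∈ Finset.Icc 1 d, c i = 0 := by
    intro d
    induction d with
    | zero => intro _ _ i hi; simp at hi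
    | succ d ih =>
      intro hd hs i hi
      have hmem : d + 1 ∈ Finset.Icc 1 (N - 1) := Finset.mem_Icc.2 ⟨by omega, hd⟩
      rw [Finset.sum_Icc_succ_top (by omega)] at hs
      have h1 := congrArg (fun p => coeff p d) hs
      simp only [coeff_add, finsetSum_coeff, coeff_C_mul, coeff_zero] at h1
      rw [Finset.sum_eq_zero, zero_add] at h1
      · have hlead : (P (d + 1)).coeff d ≠ 0 := by
          have h2 := hP (d + 1) hmem
          rw [Nat.add_sub_cancel] at h2
          have h4 := leadingCoeff_ne_zero.2 (hP0 _ hmem)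
          rwa [leadingCoeff, h2] at h4
        have h3 := (mul_eq_zero.1 h1).resolve_right hlead
        rcases eq_or_lt_of_le (Finset.mem_Icc.1 hi).2 with rfl | hlt
        · exact h3
        · refine ih (by omega) ?_ i (Finset.mem_Icc.2 ⟨(Finset.mem_Icc.1 hi).1, by omega⟩)
          rw [h3, C_0, zero_mul, add_zero] at hs
          exact hs
      · intro m hm
        have hm' := Finset.mem_Icc.1 hm
        rw [coeff_eq_zero_of_natDegree_lt, mul_zero]
        rw [hP m (Finset.mem_Icc.2 (by omega))]
        omega
  exact key (N - 1) le_rfl hsum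

/-- The structure constants of the product of eigenvectors. -/
noncomputable def structConst (N k l : ℕ) : ℕ → ℝ := Classical.choose (exists_modeVec_mul N k l)

theorem structConst_eq_zero {N k l i : ℕ} (h : k + l ≤ i) : structConst N k l i = 0 :=
  (Classical.choose_spec (exists_modeVec_mul N k l)).1 i h

theorem modeVec_mul_modeVec {N k l j : ℕ} (hk : k ∈ Finset.Icc 1 (N - 1))
    (hl : l ∈ Finset.Icc 1 (N - 1)) (hj : j ∈ Finset.Icc 1 (N - 1)) :
    modeVec N k j * modeVec N l j
      = ∑ i ∈ Finset.Icc 1 (N - 1), structConst N k l i * modeVec N i j :=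
  (Classical.choose_spec (exists_modeVec_mul N k l)).2 hk hl j hj

/-! ### The graded algebra of mode amplitudes. -/

section Modes

variable {A : Type*} [CommRing A] [Algebra ℝ A]

/-- The function of the index with the eigenmode amplitudes `c k`, graded by `z`. -/
noncomputable def modeSum (N : ℕ) (z : A) (c : ℕ → A) (j : ℕ) : A :=
  ∑ k ∈ Finset.Icc 1 (N - 1), modeVec N k j • (z ^ (k - 1) * c k)

/-- The amplitudes of a product. -/
noncomputable def modeMul (N : ℕ) (z : A) (c d : ℕ → A) (i : ℕ) : A :=
  ∑ k ∈ Finset.Icc 1 (N - 1), ∑ l ∈ Finset.Icc 1 (N - 1),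
    structConst N k l i • (z ^ (k + l - 1 - i) * (c k * d l))

/-- Where `i ≥ k + l` the truncated exponent `k + l - 1 - i` is wrong, but the selection rule makes
the structure constant zero; elsewhere the powers add up to `(k - 1) + (l - 1)`. Products of mode
sums thus have regular amplitudes, with no division by `z`. -/
theorem modeSum_modeMul {N : ℕ} (z : A) (c d : ℕ → A) {j : ℕ} (hj : j ∈ Finset.Icc 1 (N - 1)) :
    modeSum N z (modeMul N z c d) j = modeSum N z c j * modeSum N z d j := by
  have h1 : ∀ k ∈ Finset.Icc 1 (N - 1), ∀ l ∈ Finset.Icc 1 (N - 1),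
      modeVec N k j • (z ^ (k - 1) * c k) * modeVec N l j • (z ^ (l - 1) * d l)
      = ∑ i ∈ Finset.Icc 1 (N - 1), modeVec N i j • (z ^ (i - 1) *
          structConst N k l i • (z ^ (k + l - 1 - i) * (c k * d l))) := by
    intro k hk l hl
    rw [smul_mul_smul_comm, modeVec_mul_modeVec hk hl hj, Finset.sum_smul]
    refine Finset.sum_congr rfl fun i hi => ?_
    by_cases hi' : k + l ≤ i
    · simp [structConst_eq_zero hi']
    · rw [mul_smul_comm, smul_smul, mul_comm (structConst N k l i)]
      congr 1
      have hk1 := (Finset.mem_Icc.1 hk).1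
      have hl1 := (Finset.mem_Icc.1 hl).1
      have hi1 := (Finset.mem_Icc.1 hi).1
      have e : k - 1 + (l - 1) = i - 1 + (k + l - 1 - i) := by omega
      rw [mul_mul_mul_comm, ← pow_add, e, pow_add, mul_assoc]
  rw [modeSum, modeSum, modeSum, Finset.sum_mul_sum, Finset.sum_congr rfl fun k hk =>
    Finset.sum_congr rfl fun l hl => h1 k hk l hl]
  simp only [modeMul, Finset.mul_sum, Finset.smul_sum]
  rw [Finset.sum_comm]
  exact Finset.sum_congr rfl fun k _ => Finset.sum_comm

/-- The numbers `γ_j = j (N - j)`. -/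
noncomputable def gammaCoeff (N j : ℕ) : ℝ := (j : ℝ) * ((N : ℝ) - j)

theorem gammaCoeff_zero (N : ℕ) : gammaCoeff N 0 = 0 := by simp [gammaCoeff]

theorem gammaCoeff_self (N : ℕ) : gammaCoeff N N = 0 := by simp [gammaCoeff]

/-- The matrix with the eigenvectors `modeVec`. -/
noncomputable def modeMatrix (N : ℕ) (f : ℕ → A) (j : ℕ) : A :=
  (2 * gammaCoeff N j) • f j - gammaCoeff N (j - 1) • f (j - 1) - gammaCoeff N (j + 1) • f (j + 1)

theorem modeMatrix_modeSum {N : ℕ} (z : A) (c : ℕ → A) {j : ℕ} (hj : j ∈ Finset.Icc 1 (N - 1)) :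
    modeMatrix N (modeSum N z c) j
      = modeSum N z (fun k => ((k : ℝ) * (k + 1)) • c k) j := by
  simp only [modeMatrix, modeSum, Finset.smul_sum]
  rw [← Finset.sum_sub_distrib, ← Finset.sum_sub_distrib]
  refine Finset.sum_congr rfl fun k hk => ?_
  rw [smul_smul, smul_smul, smul_smul, ← sub_smul, ← sub_smul, mul_smul_comm, smul_smul]
  congr 1
  have := modeVec_eigen hk hj
  simp only [gammaCoeff]
  linear_combination this

/-- The matrix only depends on the components `1, …, N - 1`. -/
theorem modeMatrix_congr {N : ℕ} {f g : ℕ → A} {j : ℕ} (hj : j ∈ Finset.Icc 1 (N - 1))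
    (hfg : ∀ i ∈ Finset.Icc 1 (N - 1), f i = g i) : modeMatrix N f j = modeMatrix N g j := by
  have h : ∀ i, i ≤ N → gammaCoeff N i • f i = gammaCoeff N i • g i := by
    intro i hi
    by_cases hmem : i ∈ Finset.Icc 1 (N - 1)
    · rw [hfg i hmem]
    · have : i = 0 ∨ i = N := by
        rw [Finset.mem_Icc] at hmem
        omega
      rcases this with rfl | rfl
      · simp [gammaCoeff_zero]
      · simp [gammaCoeff_self]
  have hj' := Finset.mem_Icc.1 hj
  rw [modeMatrix, modeMatrix, hfg j hj, h (j - 1) (by omega), h (j + 1) (by omega)]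

theorem modeSum_add (N : ℕ) (z : A) (c d : ℕ → A) (j : ℕ) :
    modeSum N z (fun k => c k + d k) j = modeSum N z c j + modeSum N z d j := by
  simp only [modeSum, mul_add, smul_add, Finset.sum_add_distrib]

theorem modeSum_mul_left (N : ℕ) (z : A) (b : A) (c : ℕ → A) (j : ℕ) :
    modeSum N z (fun k => b * c k) j = b * modeSum N z c j := by
  simp only [modeSum, Finset.mul_sum]
  refine Finset.sum_congr rfl fun k _ => ?_
  rw [mul_smul_comm]
  congr 1
  ring

theorem modeSum_smul (N : ℕ) (z : A) (b : ℝ) (c : ℕ → A) (j : ℕ) :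
    modeSum N z (fun k => b • c k) j = b • modeSum N z c j := by
  simp only [modeSum, Finset.smul_sum]
  refine Finset.sum_congr rfl fun k _ => ?_
  rw [mul_smul_comm, smul_comm]

theorem map_modeSum {A' : Type*} [CommRing A'] [Algebra ℝ A'] (φ : A →ₐ[ℝ] A') (N : ℕ) (z : A)
    (c : ℕ → A) (j : ℕ) : φ (modeSum N z c j) = modeSum N (φ z) (fun k => φ (c k)) j := by
  simp [modeSum]

end Modes

/-! ### Solitons: the integrated equations in `x = arctan (r / ℓ)`. -/

open Wiener in
/-- The unknown power series in the angle `x = arctan (r / ℓ)` of the soliton problem. -/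
structure OriginData where
  N : ℕ
  β : ℕ → ℝ
  θ : ℕ → ℝ
  ℓ : ℝ
  M : Wiener
  q : Wiener
  a : Wiener
  h : ℕ → Wiener
  g : ℕ → Wiener

namespace OriginData

open Wiener

variable (D : OriginData)

/-- The grading parameter `ℓ sin x`. -/
noncomputable def grade : Wiener := D.ℓ • sinW

/-- The magnetic amplitudes. -/
noncomputable def B (k : ℕ) : Wiener :=
  algebraMap ℝ Wiener (D.β k) + X ^ 2 * avg 2 (avg (2 * k + 3) (D.h k))

/-- The electric amplitudes. -/
noncomputable def T (k : ℕ) : Wiener :=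
  algebraMap ℝ Wiener (D.θ k) + X ^ 2 * avg 2 (avg (2 * k + 3) (D.g k))

/-- The amplitudes of the derivatives of the magnetic functions. -/
noncomputable def DB (k : ℕ) : Wiener :=
  sinW * X * avg (2 * k + 3) (D.h k) + ((k : ℝ) + 1) • (cosW * D.B k)

/-- The amplitudes of the derivatives of the electric functions. -/
noncomputable def DT (k : ℕ) : Wiener :=
  sinW * X * avg (2 * k + 3) (D.g k) + (k : ℝ) • (cosW * D.T k)

/-- The function of the index with given amplitudes. -/
noncomputable def val (c : ℕ → Wiener) (j : ℕ) : Wiener := modeSum D.N D.grade c j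

/-- The amplitudes of a product. -/
noncomputable def mulA (c d : ℕ → Wiener) (k : ℕ) : Wiener := modeMul D.N D.grade c d k

/-- The magnetic functions divided by `√γ_j`. -/
noncomputable def ym (j : ℕ) : Wiener := 1 + D.ℓ ^ 2 • (sinW ^ 2 * D.val D.B j)

/-- The sum of the squares of the products of electric and magnetic functions, divided by `ℓ² sin² x`. -/
noncomputable def zsum : Wiener :=
  ∑ j ∈ Finset.Icc 1 (D.N - 1), gammaCoeff D.N j • (D.ym j ^ 2 * D.val D.T j ^ 2)

/-- The sum of the squares of the derivatives of the magnetic functions, divided by `ℓ⁴ sin² x`. -/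
noncomputable def gsum : Wiener :=
  ∑ j ∈ Finset.Icc 1 (D.N - 1), gammaCoeff D.N j • D.val D.DB j ^ 2

/-- The sum of the squares of the derivatives of the electric potentials, divided by `ℓ²`. -/
noncomputable def etasum : Wiener :=
  ∑ j ∈ Finset.Icc 1 D.N, traceless D.N (D.val D.DT) j ^ 2

/-- The deviation `ω_j² - γ_j`, divided by `ℓ² sin² x`. -/
noncomputable def ghat (j : ℕ) : Wiener :=
  gammaCoeff D.N j • ((2 : ℝ) • D.val D.B j + D.ℓ ^ 2 • (sinW ^ 2 * D.val D.B j ^ 2))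

/-- The magnetic potential energy, divided by `ℓ⁴ sin⁴ x`. -/
noncomputable def psum : Wiener := ∑ j ∈ Finset.Icc 1 D.N, (D.ghat j - D.ghat (j - 1)) ^ 2

/-- The rescaled function `μ cos² x`. -/
noncomputable def nu : Wiener := 1 - (2 * D.ℓ) • (cosW ^ 3 * sinW ^ 2 * D.M)

/-- The derivative of the mass function, divided by `ℓ² sin² x`. -/
noncomputable def massRate : Wiener :=
  (1 / 4 : ℝ) • (D.etasum * D.a ^ 2) + (1 / 4 : ℝ) • (D.zsum * D.q * D.a ^ 2) + D.nu * D.gsum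
    + (1 / 4 : ℝ) • D.psum

/-- The rescaled mass function, divided by `ℓ² x³`. -/
noncomputable def massInt : Wiener := avg 3 (sincW ^ 2 * D.massRate)

/-- The logarithmic derivative of the metric function, divided by `ℓ² sin x`. -/
noncomputable def logS : Wiener :=
  cosW ^ 3 * ((1 / 2 : ℝ) • (D.zsum * D.q ^ 2 * D.a ^ 2) + (2 : ℝ) • D.gsum)

/-- The correction of the inverse of `nu`, divided by `ℓ sin² x`. -/
noncomputable def qcorr : Wiener := (2 : ℝ) • (cosW ^ 3 * D.M * D.q)

/-- The derivative of `nu`, divided by `ℓ sin x`. -/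
noncomputable def nuRate : Wiener :=
  (2 : ℝ) • (cosW ^ 2 * ((3 : ℝ) • sinW ^ 2 + cosW ^ 2) * D.M)
    - (2 * D.ℓ) • (cosW ^ 3 * D.massRate)

/-- The amplitudes of the square of the magnetic function. -/
noncomputable def BB (k : ℕ) : Wiener := D.mulA D.B D.B k

/-- The amplitudes of the magnetic potential, before the application of the matrix. -/
noncomputable def potAmp (k : ℕ) : Wiener :=
  D.B k + (D.ℓ ^ 2 / 2) • (sinW ^ 2 * D.BB k)

/-- The nonlinear magnetic source, divided by `ℓ`. -/
noncomputable def magSource (k : ℕ) : Wiener :=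
  (-(D.ℓ • D.logS + D.nuRate * D.q)) * D.DB k
    + (-((D.ℓ / 4) • (D.q ^ 2 * D.a ^ 2))) * (D.mulA D.T D.T k
        + (D.ℓ ^ 2 • sinW ^ 2) * D.mulA D.B (D.mulA D.T D.T) k)
    + (D.ℓ / 2) • ((k : ℝ) * (k + 1)) • D.BB k
    + (D.ℓ • D.q) * D.mulA (fun k => ((k : ℝ) * (k + 1)) • D.potAmp k) D.B k
    + D.qcorr * ((k : ℝ) * (k + 1)) • D.potAmp k

/-- The nonlinear electric source, divided by `ℓ`. -/
noncomputable def elSource (k : ℕ) : Wiener :=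
  (D.ℓ • D.logS) * D.DT k
    + (D.ℓ • D.q) * ((k : ℝ) * (k + 1)) • D.mulA (fun k => (2 : ℝ) • D.potAmp k) D.T k
    + D.qcorr * ((k : ℝ) * (k + 1)) • D.T k

theorem abs_pi_div_two_le : |Real.pi / 2| ≤ convRadius := by
  rw [abs_of_pos (by positivity), convRadius]
  linarith [Real.pi_lt_d2]

/-- The integrated field equations. -/
structure IsSolution : Prop where
  -- Since `sin x = x sinc x`, this says `sin³ x · M = ℓ x³ massInt`, so that `ν` has no division by
  -- `sin x`.
  M_eq : D.M = D.ℓ • (invSincW ^ 3 * D.massInt)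
  q_eq : D.q = 1 + D.ℓ • (sinW ^ 2 * D.qcorr)
  a_eq : D.a = 1 + D.ℓ •
    (-(D.ℓ • primitive (Real.pi / 2) abs_pi_div_two_le (D.a * D.logS * sinW)))
  -- Put `B' = x H` with `x H' + (2k + 3) H = h`, that is, `H = avg (2k + 3) h`. For `u = sinᵏ⁺¹ B`
  -- the linear equation `u'' = k (k + 1) u / sin²` reads `B'' + 2 (k + 1) cot x · B' = (k + 1)² B`;
  -- inserting `cot x = 1 / x + x cotW` leaves a Volterra equation for `h`.
  h_eq : ∀ k ∈ Finset.Icc 1 (D.N - 1),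
    D.h k - modeOp (2 * k + 3) (((k : ℝ) + 1) ^ 2) ((-(2 * ((k : ℝ) + 1))) • cotW) (D.h k)
      = (((k : ℝ) + 1) ^ 2 * D.β k) • (1 : Wiener) + D.ℓ • D.magSource k
  -- The same reduction for `u = sinᵏ T` with `u'' = -2 cot x · u' + k (k + 1) u / sin²`, which
  -- reads `T'' + 2 (k + 1) cot x · T' = k (k + 2) T`.
  g_eq : ∀ k ∈ Finset.Icc 1 (D.N - 1),
    D.g k - modeOp (2 * k + 3) ((k : ℝ) * (k + 2)) ((-(2 * ((k : ℝ) + 1))) • cotW) (D.g k)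
      = ((k : ℝ) * (k + 2) * D.θ k) • (1 : Wiener) + D.ℓ • D.elSource k

/-- The rescaled fields as functions of the rescaled radius. -/
noncomputable def fields : EYMFields where
  m := fun x => D.ℓ ^ 2 * ev (X ^ 3 * D.massInt) (Real.arctan x)
  S := fun x => (ev D.a (Real.arctan x))⁻¹
  ω := fun j x => sqrtGamma D.N j * ev (D.ym j) (Real.arctan x)
  α := fun j x => traceless D.N (fun i => D.ℓ * ev (sinW * D.val D.T i) (Real.arctan x)) j

/-- The magnetic amplitudes, rescaled to powers of the radius. -/
noncomputable def magAmp (k : ℕ) (x : ℝ) : ℝ :=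
  ev (D.B k) (Real.arctan x) * Real.cos (Real.arctan x) ^ (k + 1)

/-- The electric amplitudes, rescaled to powers of the radius. -/
noncomputable def elAmp (k : ℕ) (x : ℝ) : ℝ :=
  ev (D.T k) (Real.arctan x) * Real.cos (Real.arctan x) ^ k

end OriginData

/-! ### Solitons: second derivatives of the modes. -/

namespace Wiener

/-- Differential form of the averaging operator. -/
theorem exists_hasDerivAt_avg (p : ℕ) (f : Wiener) {x : ℝ} (hx : |x| < convRadius) (hx0 : x ≠ 0) :
    ∃ d, HasDerivAt (ev (avg (p + 1) f)) d x ∧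
      x * d + ((p : ℝ) + 1) * ev (avg (p + 1) f) x = ev f x := by
  have h1 := (analyticAt_ev_right (avg (p + 1) f) hx).differentiableAt.hasDerivAt
  refine ⟨_, h1, ?_⟩
  have h2 := hasDerivAt_pow_mul_ev_avg (Nat.succ_ne_zero p) f hx
  have h3 := ((hasDerivAt_pow (p + 1) x).mul h1).unique h2
  simp only [Nat.succ_eq_add_one, Nat.add_sub_cancel] at h3
  have h4 : x ^ p ≠ 0 := pow_ne_zero _ hx0
  refine mul_left_cancel₀ h4 ?_
  rw [← h3]
  push_cast
  ring

end Wiener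

/-- Second derivative of a magnetic mode `sᵏ⁺¹ B`. -/
theorem hasDerivAt_magnetic_mode {B H s c : ℝ → ℝ} {H' x f κ : ℝ} (k : ℕ)
    (hB : HasDerivAt B (x * H x) x) (hH : HasDerivAt H H' x) (hs : HasDerivAt s (c x) x)
    (hc : HasDerivAt c (-s x) x) (hsc : s x ^ 2 + c x ^ 2 = 1)
    (hκ : c x * x = s x * (1 + x ^ 2 * κ))
    (heq : x * H' + (2 * k + 3) * H x = (k + 1) ^ 2 * B x - 2 * (k + 1) * κ * x ^ 2 * H x + f) :
    HasDerivAt (fun t => s t ^ (k + 1) * B t) (s x ^ k * (s x * x * H x + (k + 1) * (c x * B x))) x ∧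
    HasDerivAt (fun t => s t ^ (k + 1) * (t * H t) + (k + 1) * (s t ^ k * (c t * B t)))
      (k * (k + 1) * s x ^ (k - 1) * B x + s x ^ (k + 1) * f) x := by
  have h1 := hs.pow (k + 1)
  refine ⟨(h1.mul hB).congr_deriv ?_, ?_⟩
  · simp only [Pi.pow_apply, Nat.add_sub_cancel]
    push_cast
    ring
  · refine ((h1.mul ((hasDerivAt_id x).mul hH)).add
      (((hs.pow k).mul (hc.mul hB)).const_mul ((k : ℝ) + 1))).congr_deriv ?_
    -- The exponent `k - 1` is truncated at `k = 0`, where its coefficient vanishes.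
    rcases k with _ | k
    · simp only [Pi.pow_apply, Pi.mul_apply, id, Nat.add_sub_cancel]
      push_cast at *
      have e : x * H' = B x - 2 * κ * x ^ 2 * H x + f - 3 * H x := by linarith
      simp only [zero_add, pow_one, pow_zero, zero_mul, one_mul, mul_one]
      linear_combination s x * e + 2 * H x * hκ
    · simp only [Pi.pow_apply, Pi.mul_apply, id, Nat.add_sub_cancel]
      push_cast at *
      have e : x * H' = ((k : ℝ) + 1 + 1) ^ 2 * B x - 2 * (k + 1 + 1) * κ * x ^ 2 * H x + f
        - (2 * (k + 1) + 3) * H x := by linarith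
      linear_combination s x ^ (k + 1 + 1) * e
        + 2 * ((k : ℝ) + 1 + 1) * s x ^ (k + 1) * H x * hκ
        + ((k : ℝ) + 1) * (k + 1 + 1) * s x ^ k * B x * hsc

/-- Second derivative of an electric mode `sᵏ⁺¹ T`. -/
theorem hasDerivAt_electric_mode {T H s c : ℝ → ℝ} {H' x f κ : ℝ} (k : ℕ)
    (hT : HasDerivAt T (x * H x) x) (hH : HasDerivAt H H' x) (hs : HasDerivAt s (c x) x)
    (hc : HasDerivAt c (-s x) x) (hsc : s x ^ 2 + c x ^ 2 = 1)
    (hκ : c x * x = s x * (1 + x ^ 2 * κ))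
    (heq : x * H' + (2 * (k + 1) + 3) * H x
      = (k + 1) * (k + 3) * T x - 2 * (k + 2) * κ * x ^ 2 * H x + f) :
    HasDerivAt (fun t => s t ^ (k + 1) * T t) (s x ^ k * (s x * x * H x + (k + 1) * (c x * T x))) x ∧
    ∃ d, HasDerivAt (fun t => s t ^ (k + 1) * (t * H t) + (k + 1) * (s t ^ k * (c t * T t))) d x ∧
      s x ^ 2 * d = -2 * c x * s x * (s x ^ k * (s x * x * H x + (k + 1) * (c x * T x)))
        + (k + 1) * (k + 2) * s x ^ (k + 1) * T x + s x ^ (k + 3) * f := by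
  have h1 := hs.pow (k + 1)
  refine ⟨(h1.mul hT).congr_deriv ?_, _, (h1.mul ((hasDerivAt_id x).mul hH)).add
      (((hs.pow k).mul (hc.mul hT)).const_mul ((k : ℝ) + 1)), ?_⟩
  · simp only [Pi.pow_apply, Nat.add_sub_cancel]
    push_cast
    ring
  · have e : x * H' = ((k : ℝ) + 1) * (k + 3) * T x - 2 * (k + 2) * κ * x ^ 2 * H x + f
        - (2 * (k + 1) + 3) * H x := by linarith
    rcases k with _ | k
    · simp only [Pi.pow_apply, Pi.mul_apply, id, Nat.add_sub_cancel]
      push_cast at *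
      simp only [zero_add, pow_one, pow_zero, zero_mul, one_mul, mul_one] at *
      linear_combination s x ^ 3 * e + 4 * s x ^ 2 * H x * hκ + 2 * s x * T x * hsc
    · simp only [Pi.pow_apply, Pi.mul_apply, id, Nat.add_sub_cancel]
      push_cast at *
      linear_combination s x ^ (k + 4) * e + 2 * ((k : ℝ) + 3) * s x ^ (k + 3) * H x * hκ
        + ((k : ℝ) + 2) * (k + 3) * s x ^ (k + 2) * T x * hsc

namespace OriginData

open Wiener

variable {D : OriginData} {x : ℝ}

theorem ev_val (D : OriginData) (c : ℕ → Wiener) (j : ℕ) (hx : |x| < convRadius) :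
    ev (D.val c j) x = modeSum D.N (D.ℓ * Real.sin x) (fun k => ev (c k) x) j := by
  have h := map_modeSum (evHom x hx.le) D.N D.grade c j
  have hg : evHom x hx.le D.grade = D.ℓ * Real.sin x := by
    rw [evHom_apply, grade, ev_smul _ _ hx.le, ev_sinW hx]
  rw [hg] at h
  exact h

theorem ev_val_mulA (D : OriginData) (c d : ℕ → Wiener) {j : ℕ} (hj : j ∈ Finset.Icc 1 (D.N - 1))
    (hx : |x| < convRadius) :
    ev (D.val (D.mulA c d) j) x = ev (D.val c j) x * ev (D.val d j) x := by
  rw [← ev_mul _ _ hx.le]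
  exact congrArg (fun f => ev f x) (modeSum_modeMul D.grade c d hj)

theorem ev_val_eigen (D : OriginData) (c : ℕ → Wiener) {j : ℕ} (hj : j ∈ Finset.Icc 1 (D.N - 1))
    (hx : |x| < convRadius) :
    ev (D.val (fun k => ((k : ℝ) * (k + 1)) • c k) j) x
      = modeMatrix D.N (fun i => ev (D.val c i) x) j := by
  have h : D.val (fun k => ((k : ℝ) * (k + 1)) • c k) j = modeMatrix D.N (D.val c) j :=
    (modeMatrix_modeSum D.grade c hj).symm
  rw [h]
  simp only [modeMatrix, ev_sub _ _ hx.le, ev_smul _ _ hx.le, smul_eq_mul]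

theorem val_add (D : OriginData) (c d : ℕ → Wiener) (j : ℕ) :
    D.val (fun k => c k + d k) j = D.val c j + D.val d j := modeSum_add _ _ _ _ _

theorem val_mul_left (D : OriginData) (b : Wiener) (c : ℕ → Wiener) (j : ℕ) :
    D.val (fun k => b * c k) j = b * D.val c j := modeSum_mul_left _ _ _ _ _

theorem val_smul (D : OriginData) (b : ℝ) (c : ℕ → Wiener) (j : ℕ) :
    D.val (fun k => b • c k) j = b • D.val c j := modeSum_smul _ _ _ _ _

theorem ev_cotW_eq (hx : |x| < convRadius) :
    Real.cos x * x = Real.sin x * (1 + x ^ 2 * ev cotW x) := by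
  have h := congrArg (fun f => ev f x) cosW_eq_sincW_mul
  simp only [ev_mul _ _ hx.le, ev_add _ _ hx.le, ev_one hx.le, ev_pow _ _ hx.le, ev_X,
    ev_cosW] at h
  rw [h, ← ev_sinW hx, sinW, ev_mul _ _ hx.le, ev_X]
  ring

theorem hasDerivAt_affine_avg (b : ℝ) (f : Wiener) (hx : |x| < convRadius) :
    HasDerivAt (ev (algebraMap ℝ Wiener b + X ^ 2 * avg 2 f)) (x * ev f x) x := by
  have h := (hasDerivAt_ev_pow_mul_avg two_ne_zero f hx).const_add b
  simp only [show 2 - 1 = 1 from rfl, pow_one] at h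
  refine h.congr_of_eventuallyEq ?_
  filter_upwards [eventually_abs_lt hx] with t ht
  rw [ev_add _ _ ht.le, ev_algebraMap _ ht.le]

theorem ev_DB (D : OriginData) (k : ℕ) (hx : |x| < convRadius) :
    ev (D.DB k) x = Real.sin x * x * ev (avg (2 * k + 3) (D.h k)) x
      + (k + 1) * (Real.cos x * ev (D.B k) x) := by
  simp only [DB, ev_add _ _ hx.le, ev_mul _ _ hx.le, ev_smul _ _ hx.le, ev_sinW hx, ev_cosW, ev_X]

theorem ev_DT (D : OriginData) (k : ℕ) (hx : |x| < convRadius) :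
    ev (D.DT k) x = Real.sin x * x * ev (avg (2 * k + 3) (D.g k)) x
      + k * (Real.cos x * ev (D.T k) x) := by
  simp only [DT, ev_add _ _ hx.le, ev_mul _ _ hx.le, ev_smul _ _ hx.le, ev_sinW hx, ev_cosW, ev_X]

/-- The derivatives of the magnetic functions. -/
theorem IsSolution.hasDerivAt_magnetic (hD : D.IsSolution) (j : ℕ) (hx : |x| < convRadius)
    (hx0 : x ≠ 0) :
    HasDerivAt (ev (sinW ^ 2 * D.val D.B j)) (Real.sin x * ev (D.val D.DB j) x) x ∧
    HasDerivAt (fun t => Real.sin t * ev (D.val D.DB j) t)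
      (ev (D.val (fun k => ((k : ℝ) * (k + 1)) • D.B k) j) x
        + Real.sin x ^ 2 * (D.ℓ * ev (D.val D.magSource j) x)) x := by
  -- The averages are traded for the relation `x H' + (2k + 3) H = h`, with `h` given by the
  -- integrated equation.
  choose d hd hd' using fun k => exists_hasDerivAt_avg (2 * k + 2) (D.h k) hx hx0
  have hmode := fun k (hk : k ∈ Finset.Icc 1 (D.N - 1)) => by
    refine hasDerivAt_magnetic_mode (B := ev (D.B k)) (H := ev (avg (2 * k + 3) (D.h k)))
      (f := D.ℓ * ev (D.magSource k) x) (κ := ev cotW x) k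
      (hasDerivAt_affine_avg _ _ hx) (hd k) (Real.hasDerivAt_sin x) (Real.hasDerivAt_cos x)
      (Real.sin_sq_add_cos_sq x) (ev_cotW_eq hx) ?_
    replace hd' := hd' k
    have h := congrArg (fun f => ev f x) (hD.h_eq k hk)
    simp only [modeOp_apply, ev_mul _ _ hx.le, ev_add _ _ hx.le, ev_sub _ _ hx.le,
      ev_smul _ _ hx.le, ev_pow _ _ hx.le, ev_X, ev_one hx.le] at h
    have hB : ev (D.B k) x = D.β k + x ^ 2 * ev (avg 2 (avg (2 * k + 3) (D.h k))) x := by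
      simp only [B, ev_add _ _ hx.le, ev_mul _ _ hx.le, ev_algebraMap _ hx.le, ev_pow _ _ hx.le,
        ev_X]
    push_cast at hd'
    rw [hB]
    linear_combination hd' + h
  constructor
  · refine ((HasDerivAt.fun_sum fun k hk => ((hmode k hk).1.const_mul
      (modeVec D.N k j * D.ℓ ^ (k - 1)))).congr_deriv ?_).congr_of_eventuallyEq ?_
    · rw [ev_val _ _ _ hx, modeSum, Finset.mul_sum]
      refine Finset.sum_congr rfl fun k hk => ?_
      obtain ⟨k, rfl⟩ := Nat.exists_eq_add_of_le' (Finset.mem_Icc.1 hk).1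
      rw [ev_DB _ _ hx, Nat.add_sub_cancel, smul_eq_mul, mul_pow]
      ring
    · filter_upwards [eventually_abs_lt hx] with t ht
      rw [ev_mul _ _ ht.le, ev_pow _ _ ht.le, ev_sinW ht, ev_val _ _ _ ht, modeSum, Finset.mul_sum]
      refine Finset.sum_congr rfl fun k hk => ?_
      obtain ⟨k, rfl⟩ := Nat.exists_eq_add_of_le' (Finset.mem_Icc.1 hk).1
      rw [Nat.add_sub_cancel, smul_eq_mul, mul_pow]
      ring
  · refine ((HasDerivAt.fun_sum fun k hk => ((hmode k hk).2.const_mul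
      (modeVec D.N k j * D.ℓ ^ (k - 1)))).congr_deriv ?_).congr_of_eventuallyEq ?_
    · rw [ev_val _ _ _ hx, ev_val _ _ _ hx, modeSum, modeSum, Finset.mul_sum, Finset.mul_sum,
        ← Finset.sum_add_distrib]
      refine Finset.sum_congr rfl fun k hk => ?_
      obtain ⟨k, rfl⟩ := Nat.exists_eq_add_of_le' (Finset.mem_Icc.1 hk).1
      rw [ev_smul _ _ hx.le, Nat.add_sub_cancel, smul_eq_mul, smul_eq_mul,
        mul_pow]
      ring
    · filter_upwards [eventually_abs_lt hx] with t ht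
      rw [ev_val _ _ _ ht, modeSum, Finset.mul_sum]
      refine Finset.sum_congr rfl fun k hk => ?_
      obtain ⟨k, rfl⟩ := Nat.exists_eq_add_of_le' (Finset.mem_Icc.1 hk).1
      rw [ev_DB _ _ ht, Nat.add_sub_cancel, smul_eq_mul, mul_pow]
      ring

/-- The derivatives of the electric functions. -/
theorem IsSolution.hasDerivAt_electric (hD : D.IsSolution) (j : ℕ) (hx : |x| < convRadius)
    (hx0 : x ≠ 0) :
    HasDerivAt (ev (sinW * D.val D.T j)) (ev (D.val D.DT j) x) x ∧
    ∃ d, HasDerivAt (ev (D.val D.DT j)) d x ∧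
      Real.sin x ^ 2 * d = -2 * Real.cos x * Real.sin x * ev (D.val D.DT j) x
        + Real.sin x * ev (D.val (fun k => ((k : ℝ) * (k + 1)) • D.T k) j) x
        + Real.sin x ^ 3 * (D.ℓ * ev (D.val D.elSource j) x) := by
  choose d hd hd' using fun k =>
    exists_hasDerivAt_avg (2 * (k + 1) + 2) (D.g (k + 1)) hx hx0
  have hmode := fun k (hk : k + 1 ∈ Finset.Icc 1 (D.N - 1)) => by
    refine hasDerivAt_electric_mode (T := ev (D.T (k + 1)))
      (H := ev (avg (2 * (k + 1) + 3) (D.g (k + 1))))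
      (f := D.ℓ * ev (D.elSource (k + 1)) x) (κ := ev cotW x) k
      (hasDerivAt_affine_avg _ _ hx) (hd k) (Real.hasDerivAt_sin x) (Real.hasDerivAt_cos x)
      (Real.sin_sq_add_cos_sq x) (ev_cotW_eq hx) ?_
    replace hd' := hd' k
    have h := congrArg (fun f => ev f x) (hD.g_eq (k + 1) hk)
    simp only [modeOp_apply, ev_mul _ _ hx.le, ev_add _ _ hx.le, ev_sub _ _ hx.le,
      ev_smul _ _ hx.le, ev_pow _ _ hx.le, ev_X, ev_one hx.le] at h
    have hB : ev (D.T (k + 1)) x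
        = D.θ (k + 1) + x ^ 2 * ev (avg 2 (avg (2 * (k + 1) + 3) (D.g (k + 1)))) x := by
      simp only [T, ev_add _ _ hx.le, ev_mul _ _ hx.le, ev_algebraMap _ hx.le, ev_pow _ _ hx.le,
        ev_X]
    push_cast at hd' h
    rw [hB]
    linear_combination hd' + h
  have hmode' : ∀ k ∈ Finset.Icc 1 (D.N - 1), ∃ d,
      HasDerivAt (fun t => Real.sin t ^ k * ev (D.T k) t) (Real.sin x ^ (k - 1) * ev (D.DT k) x) x ∧
      HasDerivAt (fun t => Real.sin t ^ (k - 1) * ev (D.DT k) t) d x ∧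
      Real.sin x ^ 2 * d = -2 * Real.cos x * Real.sin x * (Real.sin x ^ (k - 1) * ev (D.DT k) x)
        + k * (k + 1) * Real.sin x ^ k * ev (D.T k) x
        + Real.sin x ^ (k + 2) * (D.ℓ * ev (D.elSource k) x) := by
    intro k hk
    obtain ⟨k, rfl⟩ := Nat.exists_eq_add_of_le' (Finset.mem_Icc.1 hk).1
    obtain ⟨h1, d, h2, h3⟩ := hmode k hk
    refine ⟨d, h1.congr_deriv ?_, h2.congr_of_eventuallyEq ?_, ?_⟩
    · rw [ev_DT _ _ hx, Nat.add_sub_cancel]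
      push_cast
      ring
    · filter_upwards [eventually_abs_lt hx] with t ht
      rw [ev_DT _ _ ht, Nat.add_sub_cancel]
      push_cast
      ring
    · rw [h3, ev_DT _ _ hx, Nat.add_sub_cancel]
      push_cast
      ring
  choose! d hd1 hd2 hd3 using hmode'
  constructor
  · refine ((HasDerivAt.fun_sum fun k hk => ((hd1 k hk).const_mul
      (modeVec D.N k j * D.ℓ ^ (k - 1)))).congr_deriv ?_).congr_of_eventuallyEq ?_
    · rw [ev_val _ _ _ hx, modeSum]
      refine Finset.sum_congr rfl fun k _ => ?_
      rw [smul_eq_mul, mul_pow]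
      ring
    · filter_upwards [eventually_abs_lt hx] with t ht
      rw [ev_mul _ _ ht.le, ev_sinW ht, ev_val _ _ _ ht, modeSum, Finset.mul_sum]
      refine Finset.sum_congr rfl fun k hk => ?_
      obtain ⟨k, rfl⟩ := Nat.exists_eq_add_of_le' (Finset.mem_Icc.1 hk).1
      rw [Nat.add_sub_cancel, smul_eq_mul, mul_pow]
      ring
  · refine ⟨_, (HasDerivAt.fun_sum fun k hk => ((hd2 k hk).const_mul
      (modeVec D.N k j * D.ℓ ^ (k - 1)))).congr_of_eventuallyEq ?_, ?_⟩
    · filter_upwards [eventually_abs_lt hx] with t ht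
      rw [ev_val _ _ _ ht, modeSum]
      refine Finset.sum_congr rfl fun k _ => ?_
      rw [smul_eq_mul, mul_pow]
      ring
    · rw [ev_val _ _ _ hx, ev_val _ _ _ hx, ev_val _ _ _ hx, modeSum, modeSum, modeSum]
      simp only [Finset.mul_sum]
      rw [← Finset.sum_add_distrib, ← Finset.sum_add_distrib]
      refine Finset.sum_congr rfl fun k hk => ?_
      have h3 := hd3 k hk
      obtain ⟨k, rfl⟩ := Nat.exists_eq_add_of_le' (Finset.mem_Icc.1 hk).1
      simp only [Nat.add_sub_cancel, smul_eq_mul, mul_pow,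
        ev_smul _ _ hx.le] at h3 ⊢
      linear_combination modeVec D.N (k + 1) j * D.ℓ ^ k * h3

end OriginData

/-! ### Solitons: metric functions and pointwise form of the sources. -/

namespace OriginData

open Wiener

variable {D : OriginData} {x : ℝ}

theorem hasDerivAt_massInt (D : OriginData) (hx : |x| < convRadius) :
    HasDerivAt (ev (X ^ 3 * D.massInt)) (Real.sin x ^ 2 * ev D.massRate x) x := by
  refine (hasDerivAt_ev_pow_mul_avg three_ne_zero _ hx).congr_deriv ?_
  rw [← ev_sinW hx, sinW]
  simp only [ev_mul _ _ hx.le, ev_pow _ _ hx.le, ev_X]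
  ring

theorem IsSolution.mass_eq (hD : D.IsSolution) (hx : |x| < convRadius) :
    D.ℓ * ev (X ^ 3 * D.massInt) x = Real.sin x ^ 3 * ev D.M x := by
  have h : sinW ^ 3 * D.M = D.ℓ • (X ^ 3 * D.massInt) := by
    have h1 : sincW ^ 3 * invSincW ^ 3 = 1 := by
      rw [← mul_pow, sincW_mul_invSincW, one_pow]
    conv_lhs => rw [hD.M_eq]
    rw [mul_smul_comm, sinW]
    congr 1
    linear_combination (X ^ 3 * D.massInt) * h1
  have h2 := congrArg (fun f => ev f x) h
  simp only [ev_smul _ _ hx.le] at h2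
  rw [← h2, ev_mul _ _ hx.le, ev_pow _ _ hx.le, ev_sinW hx]

theorem ev_nu (D : OriginData) (hx : |x| < convRadius) :
    ev D.nu x = 1 - 2 * D.ℓ * (Real.cos x ^ 3 * Real.sin x ^ 2 * ev D.M x) := by
  simp only [nu, ev_sub _ _ hx.le, ev_smul _ _ hx.le, ev_mul _ _ hx.le, ev_pow _ _ hx.le,
    ev_one hx.le, ev_sinW hx, ev_cosW]

/-- The factor `sin²` of `q - 1` cancels the `1 / sin²` of the mode potentials, so that the
corrections to the linear equations are regular at the origin. -/
theorem IsSolution.q_eq' (hD : D.IsSolution) (hx : |x| < convRadius) :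
    ev D.q x = 1 + D.ℓ * (Real.sin x ^ 2 * ev D.qcorr x) := by
  have h := congrArg (fun f => ev f x) hD.q_eq
  simpa only [ev_add _ _ hx.le, ev_smul _ _ hx.le, ev_mul _ _ hx.le, ev_pow _ _ hx.le,
    ev_one hx.le, ev_sinW hx] using h

theorem IsSolution.nu_mul_q (hD : D.IsSolution) (hx : |x| < convRadius) :
    ev D.nu x * ev D.q x = 1 := by
  have h1 := hD.q_eq' hx
  simp only [qcorr, ev_smul _ _ hx.le, ev_mul _ _ hx.le, ev_pow _ _ hx.le, ev_cosW] at h1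
  rw [D.ev_nu hx]
  linear_combination h1

theorem IsSolution.hasDerivAt_nu (hD : D.IsSolution) (hx : |x| < convRadius)
    (hs : Real.sin x ≠ 0) :
    HasDerivAt (ev D.nu) (D.ℓ * Real.sin x * ev D.nuRate x) x := by
  have h1 := hD.mass_eq hx
  -- The unknown `M` comes with no formula for its derivative, so `ν` is rewritten through the mass
  -- integral, away from the zeros of the sine.
  have hnu : (ev D.nu) =ᶠ[𝓝 x] fun t =>
      1 - 2 * D.ℓ ^ 2 * (Real.cos t ^ 3 * ev (X ^ 3 * D.massInt) t / Real.sin t) := by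
    filter_upwards [eventually_abs_lt hx, (Real.continuous_sin.tendsto x).eventually_ne hs]
      with t ht hst
    have h2 := hD.mass_eq ht
    rw [D.ev_nu ht]
    field_simp
    linear_combination 2 * Real.cos t ^ 3 * D.ℓ * h2
  have h3 := ((((Real.hasDerivAt_cos x).pow 3).mul (D.hasDerivAt_massInt hx)).div
    (Real.hasDerivAt_sin x) hs).const_mul (2 * D.ℓ ^ 2) |>.const_sub 1
  refine (h3.congr_deriv ?_).congr_of_eventuallyEq hnu
  simp only [Pi.pow_apply, Pi.mul_apply]
  generalize ev (X ^ 3 * D.massInt) x = m at h1 ⊢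
  simp only [nuRate, ev_smul _ _ hx.le, ev_sub _ _ hx.le, ev_add _ _ hx.le, ev_mul _ _ hx.le,
    ev_pow _ _ hx.le, ev_cosW, ev_sinW hx]
  field_simp
  push_cast
  linear_combination (D.ℓ * Real.cos x ^ 2 * (3 * Real.sin x ^ 2 + Real.cos x ^ 2)) * h1

theorem IsSolution.hasDerivAt_a (hD : D.IsSolution) (hx : |x| < convRadius) :
    HasDerivAt (ev D.a) (-(D.ℓ ^ 2 * (ev D.a x * ev D.logS x * Real.sin x))) x := by
  have h := ((hasDerivAt_ev_primitive (Real.pi / 2) abs_pi_div_two_le (D.a * D.logS * sinW)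
    hx).const_mul (-(D.ℓ ^ 2))).const_add 1
  rw [ev_mul _ _ hx.le, ev_mul _ _ hx.le, ev_sinW hx] at h
  refine (h.congr_deriv (by ring)).congr_of_eventuallyEq ?_
  filter_upwards [eventually_abs_lt hx] with t ht
  have ha := congrArg (fun f => ev f t) hD.a_eq
  simp only [ev_add _ _ ht.le, ev_one ht.le, ev_smul _ _ ht.le, ev_neg _ ht.le] at ha
  rw [ha]
  ring

/-- Passing from amplitudes to functions of `j` is linear and turns `mulA` into the pointwise
product, so the amplitude equations become the field equations for each `j`. -/
theorem ev_magSource (D : OriginData) {j : ℕ} (hj : j ∈ Finset.Icc 1 (D.N - 1))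
    (hx : |x| < convRadius) :
    ev (D.val D.magSource j) x
      = -(D.ℓ * ev D.logS x + ev D.nuRate x * ev D.q x) * ev (D.val D.DB j) x
        - D.ℓ / 4 * (ev D.q x ^ 2 * ev D.a x ^ 2)
          * ((1 + D.ℓ ^ 2 * Real.sin x ^ 2 * ev (D.val D.B j) x) * ev (D.val D.T j) x ^ 2)
        + D.ℓ / 2 * ev (D.val (fun k => ((k : ℝ) * (k + 1)) • D.BB k) j) x
        + (D.ℓ * ev D.q x * ev (D.val D.B j) x + ev D.qcorr x)
          * ev (D.val (fun k => ((k : ℝ) * (k + 1)) • D.potAmp k) j) x := by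
  have h : D.val D.magSource j = (-(D.ℓ • D.logS + D.nuRate * D.q)) * D.val D.DB j
    + (-((D.ℓ / 4) • (D.q ^ 2 * D.a ^ 2))) * (D.val (D.mulA D.T D.T) j
        + (D.ℓ ^ 2 • sinW ^ 2) * D.val (D.mulA D.B (D.mulA D.T D.T)) j)
    + (D.ℓ / 2) • D.val (fun k => ((k : ℝ) * (k + 1)) • D.BB k) j
    + (D.ℓ • D.q) * D.val (D.mulA (fun k => ((k : ℝ) * (k + 1)) • D.potAmp k) D.B) j
    + D.qcorr * D.val (fun k => ((k : ℝ) * (k + 1)) • D.potAmp k) j := by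
    rw [← val_mul_left, ← val_mul_left, ← val_add, ← val_mul_left, ← val_add, ← val_smul,
      ← val_add, ← val_mul_left, ← val_add, ← val_mul_left, ← val_add]
    rfl
  rw [h]
  simp only [ev_add _ _ hx.le, ev_mul _ _ hx.le, ev_neg _ hx.le, ev_smul _ _ hx.le,
    ev_pow _ _ hx.le, ev_sinW hx, D.ev_val_mulA _ _ hj hx]
  ring

theorem ev_elSource (D : OriginData) (j : ℕ) (hx : |x| < convRadius) :
    ev (D.val D.elSource j) x
      = D.ℓ * ev D.logS x * ev (D.val D.DT j) x
        + D.ℓ * ev D.q x * ev (D.val (fun k => ((k : ℝ) * (k + 1)) •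
            D.mulA (fun k => (2 : ℝ) • D.potAmp k) D.T k) j) x
        + ev D.qcorr x * ev (D.val (fun k => ((k : ℝ) * (k + 1)) • D.T k) j) x := by
  have h : D.val D.elSource j = (D.ℓ • D.logS) * D.val D.DT j
    + (D.ℓ • D.q) * D.val (fun k => ((k : ℝ) * (k + 1)) •
        D.mulA (fun k => (2 : ℝ) • D.potAmp k) D.T k) j
    + D.qcorr * D.val (fun k => ((k : ℝ) * (k + 1)) • D.T k) j := by
    rw [← val_mul_left, ← val_mul_left, ← val_add, ← val_mul_left, ← val_add]
    rfl
  rw [h]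
  simp only [ev_add _ _ hx.le, ev_mul _ _ hx.le, ev_smul _ _ hx.le]

theorem ev_potAmp (D : OriginData) {j : ℕ} (hj : j ∈ Finset.Icc 1 (D.N - 1))
    (hx : |x| < convRadius) :
    ev (D.val D.potAmp j) x = ev (D.val D.B j) x
      + D.ℓ ^ 2 / 2 * (Real.sin x ^ 2 * ev (D.val D.B j) x ^ 2) := by
  have h : D.val D.potAmp j
      = D.val D.B j + (D.ℓ ^ 2 / 2) • (sinW ^ 2 * D.val (D.mulA D.B D.B) j) := by
    rw [← val_mul_left, ← val_smul, ← val_add]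
    rfl
  rw [h]
  simp only [ev_add _ _ hx.le, ev_mul _ _ hx.le, ev_smul _ _ hx.le, ev_pow _ _ hx.le, ev_sinW hx,
    D.ev_val_mulA _ _ hj hx]
  ring

theorem ev_potAmp_eigen (D : OriginData) (j : ℕ) (hx : |x| < convRadius) :
    ev (D.val (fun k => ((k : ℝ) * (k + 1)) • D.potAmp k) j) x
      = ev (D.val (fun k => ((k : ℝ) * (k + 1)) • D.B k) j) x
        + D.ℓ ^ 2 / 2 * (Real.sin x ^ 2 *
          ev (D.val (fun k => ((k : ℝ) * (k + 1)) • D.BB k) j) x) := by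
  have h : D.val (fun k => ((k : ℝ) * (k + 1)) • D.potAmp k) j
      = D.val (fun k => ((k : ℝ) * (k + 1)) • D.B k) j
        + (D.ℓ ^ 2 / 2) • (sinW ^ 2 * D.val (fun k => ((k : ℝ) * (k + 1)) • D.BB k) j) := by
    rw [← val_mul_left, ← val_smul, ← val_add]
    refine congrArg (fun c => D.val c j) (funext fun k => ?_)
    simp only [potAmp, smul_add, mul_smul_comm]
    rw [smul_comm]
  rw [h]
  simp only [ev_add _ _ hx.le, ev_mul _ _ hx.le, ev_smul _ _ hx.le, ev_pow _ _ hx.le, ev_sinW hx]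

theorem ev_ym (D : OriginData) (j : ℕ) (hx : |x| < convRadius) :
    ev (D.ym j) x = 1 + D.ℓ ^ 2 * (Real.sin x ^ 2 * ev (D.val D.B j) x) := by
  simp only [ym, ev_add _ _ hx.le, ev_mul _ _ hx.le, ev_smul _ _ hx.le, ev_pow _ _ hx.le,
    ev_sinW hx, ev_one hx.le]

theorem ev_ghat (D : OriginData) (j : ℕ) (hx : |x| < convRadius) :
    gammaCoeff D.N j * ev (D.ym j) x ^ 2
      = gammaCoeff D.N j + D.ℓ ^ 2 * Real.sin x ^ 2 * ev (D.ghat j) x := by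
  rw [D.ev_ym _ hx]
  simp only [ghat, ev_add _ _ hx.le, ev_mul _ _ hx.le, ev_smul _ _ hx.le, ev_pow _ _ hx.le,
    ev_sinW hx]
  ring

theorem ev_massRate (D : OriginData) (hx : |x| < convRadius) :
    ev D.massRate x = 1 / 4 * (ev D.etasum x * ev D.a x ^ 2)
      + 1 / 4 * (ev D.zsum x * ev D.q x * ev D.a x ^ 2) + ev D.nu x * ev D.gsum x
      + 1 / 4 * ev D.psum x := by
  simp only [massRate, ev_add _ _ hx.le, ev_mul _ _ hx.le, ev_smul _ _ hx.le, ev_pow _ _ hx.le]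

theorem ev_logS (D : OriginData) (hx : |x| < convRadius) :
    ev D.logS x = Real.cos x ^ 3 * (1 / 2 * (ev D.zsum x * ev D.q x ^ 2 * ev D.a x ^ 2)
      + 2 * ev D.gsum x) := by
  simp only [logS, ev_add _ _ hx.le, ev_mul _ _ hx.le, ev_smul _ _ hx.le, ev_pow _ _ hx.le, ev_cosW]

end OriginData

/-! ### Solitons: the physical fields as functions of the angle. -/

namespace OriginData

open Wiener

variable {D : OriginData} {r : ℝ}

/-- The physical fields of the soliton. -/
noncomputable def phys (D : OriginData) : EYMFields := EYMFields.ofSolitonScaling D.ℓ D.fields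

theorem abs_arctan_lt (t : ℝ) : |Real.arctan t| < convRadius := by
  have h1 := Real.arctan_lt_pi_div_two t
  have h2 := Real.neg_pi_div_two_lt_arctan t
  have h3 : Real.pi / 2 < convRadius := by
    rw [convRadius]
    linarith [Real.pi_lt_d2]
  exact abs_lt.2 ⟨by linarith, by linarith⟩

theorem radius_eq (hℓ : D.ℓ ≠ 0) (r : ℝ) :
    r = D.ℓ * Real.sin (Real.arctan (r / D.ℓ)) / Real.cos (Real.arctan (r / D.ℓ)) := by
  rw [mul_div_assoc, ← Real.tan_eq_sin_div_cos, Real.tan_arctan]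
  field_simp

theorem cos_sq_arctan_eq (t : ℝ) : 1 / (1 + t ^ 2) = Real.cos (Real.arctan t) ^ 2 :=
  (Real.cos_sq_arctan t).symm

theorem hasDerivAt_angle (D : OriginData) (r : ℝ) :
    HasDerivAt (fun t => Real.arctan (t / D.ℓ)) (Real.cos (Real.arctan (r / D.ℓ)) ^ 2 / D.ℓ) r := by
  have h := (Real.hasDerivAt_arctan (r / D.ℓ)).comp r ((hasDerivAt_id r).div_const D.ℓ)
  refine h.congr_deriv ?_
  rw [cos_sq_arctan_eq]
  ring

theorem hasDerivAt_angle_deriv (D : OriginData) (r : ℝ) :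
    HasDerivAt (fun t => Real.cos (Real.arctan (t / D.ℓ)) ^ 2 / D.ℓ)
      (-2 * Real.sin (Real.arctan (r / D.ℓ)) * Real.cos (Real.arctan (r / D.ℓ)) ^ 3 / D.ℓ ^ 2)
      r := by
  have h := (((Real.hasDerivAt_cos _).comp r (D.hasDerivAt_angle r)).pow 2).div_const D.ℓ
  refine h.congr_deriv ?_
  simp only [Function.comp]
  push_cast
  ring

theorem phys_m (r : ℝ) : D.phys.m r
    = D.ℓ * (D.ℓ ^ 2 * ev (X ^ 3 * D.massInt) (Real.arctan (r / D.ℓ))) := rfl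

theorem phys_S (r : ℝ) : D.phys.S r = (ev D.a (Real.arctan (r / D.ℓ)))⁻¹ := rfl

theorem phys_ω (j : ℕ) (r : ℝ) :
    D.phys.ω j r = sqrtGamma D.N j * ev (D.ym j) (Real.arctan (r / D.ℓ)) := rfl

theorem phys_elec {j : ℕ} (hj : j ∈ Finset.Icc 1 (D.N - 1)) (r : ℝ) :
    D.phys.elec j r = D.ℓ * ev (sinW * D.val D.T j) (Real.arctan (r / D.ℓ)) :=
  traceless_sub_traceless (fun i => D.ℓ * ev (sinW * D.val D.T i) (Real.arctan (r / D.ℓ))) hj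

theorem gammaCoeff_nonneg {N j : ℕ} (hj : j ≤ N) : 0 ≤ gammaCoeff N j := by
  have : (j : ℝ) ≤ N := by exact_mod_cast hj
  exact mul_nonneg (Nat.cast_nonneg _) (sub_nonneg.2 this)

theorem sqrtGamma_sq {N j : ℕ} (hj : j ≤ N) : sqrtGamma N j ^ 2 = gammaCoeff N j :=
  Real.sq_sqrt (gammaCoeff_nonneg hj)

theorem phys_ω_sq {j : ℕ} (hj : j ≤ D.N) (r : ℝ) :
    D.phys.ω j r ^ 2 = gammaCoeff D.N j + D.ℓ ^ 2 * Real.sin (Real.arctan (r / D.ℓ)) ^ 2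
      * ev (D.ghat j) (Real.arctan (r / D.ℓ)) := by
  rw [phys_ω, mul_pow, sqrtGamma_sq hj, D.ev_ghat _ (abs_arctan_lt _)]

theorem IsSolution.phys_mu (hD : D.IsSolution) (r : ℝ) (hℓ : D.ℓ ≠ 0) (hr : r ≠ 0) :
    D.phys.mu 1 D.ℓ r = ev D.nu (Real.arctan (r / D.ℓ)) / Real.cos (Real.arctan (r / D.ℓ)) ^ 2 := by
  have hx := abs_arctan_lt (r / D.ℓ)
  have hc : Real.cos (Real.arctan (r / D.ℓ)) ≠ 0 := (Real.cos_arctan_pos _).ne'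
  have hrx := radius_eq hℓ r
  have hm := hD.mass_eq hx
  have hsc := Real.sin_sq_add_cos_sq (Real.arctan (r / D.ℓ))
  rw [EYMFields.mu, phys_m, D.ev_nu hx]
  generalize Real.arctan (r / D.ℓ) = x at *
  have hs : Real.sin x ≠ 0 := by
    rintro h
    rw [h, mul_zero, zero_div] at hrx
    exact hr hrx
  rw [hrx]
  generalize ev (X ^ 3 * D.massInt) x = m at *
  field_simp
  push_cast
  linear_combination (-2 * D.ℓ * Real.cos x ^ 3) * hm + Real.sin x * hsc

theorem phys_zeta (r : ℝ) :
    D.phys.zeta D.N r = D.ℓ ^ 2 * Real.sin (Real.arctan (r / D.ℓ)) ^ 2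
      * ev D.zsum (Real.arctan (r / D.ℓ)) := by
  have hx := abs_arctan_lt (r / D.ℓ)
  rw [EYMFields.zeta, zsum, ev_sum _ _ hx.le, Finset.mul_sum]
  refine Finset.sum_congr rfl fun j hj => ?_
  have hj' : j ≤ D.N := by
    rw [Finset.mem_Icc] at hj
    omega
  rw [phys_elec hj, phys_ω, mul_pow, sqrtGamma_sq hj']
  simp only [ev_mul _ _ hx.le, ev_pow _ _ hx.le, ev_smul _ _ hx.le, ev_sinW hx]
  ring

/-- Because `γ_j - γ_{j-1} = N + 1 - 2 j`, the background `ω_j² = γ_j` cancels and only squares of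
the deviations remain. -/
theorem phys_potP (r : ℝ) :
    D.phys.potP D.N 1 r = 1 / (4 * r ^ 2) * (D.ℓ ^ 4 * Real.sin (Real.arctan (r / D.ℓ)) ^ 4
      * ev D.psum (Real.arctan (r / D.ℓ))) := by
  have hx := abs_arctan_lt (r / D.ℓ)
  rw [EYMFields.potP, psum, ev_sum _ _ hx.le]
  congr 1
  rw [Finset.mul_sum]
  refine Finset.sum_congr rfl fun j hj => ?_
  obtain ⟨h1, h2⟩ := Finset.mem_Icc.1 hj
  rw [phys_ω_sq h2, phys_ω_sq (by omega), ev_pow _ _ hx.le, ev_sub _ _ hx.le]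
  have h3 : gammaCoeff D.N j - gammaCoeff D.N (j - 1) = (D.N : ℝ) + 1 - 2 * j := by
    rw [gammaCoeff, gammaCoeff, Nat.cast_sub h1]
    push_cast
    ring
  have h4 : (((1 : ℤ) : ℝ)) * ((D.N : ℝ) + 1 - 2 * (j : ℝ))
      = gammaCoeff D.N j - gammaCoeff D.N (j - 1) := by
    rw [h3]
    push_cast
    ring
  rw [h4]
  ring

/-- Because `γ_j - (γ_{j+1} + γ_{j-1}) / 2 = 1`, the background has `W_j = 0`. The remainder is the
matrix with eigenvectors `v_k` applied to `B + (ℓ² / 2) sin² · B²`. -/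
theorem phys_potW {j : ℕ} (hj : j ∈ Finset.Icc 1 (D.N - 1)) (r : ℝ) :
    D.phys.potW 1 j r = -(D.ℓ ^ 2 * Real.sin (Real.arctan (r / D.ℓ)) ^ 2 *
      ev (D.val (fun k => ((k : ℝ) * (k + 1)) • D.potAmp k) j) (Real.arctan (r / D.ℓ))) := by
  have hx := abs_arctan_lt (r / D.ℓ)
  obtain ⟨h1, h2⟩ := Finset.mem_Icc.1 hj
  have hg : ∀ i, ev (D.ghat i) (Real.arctan (r / D.ℓ)) = 2 * (gammaCoeff D.N i *
      (ev (D.val D.B i) (Real.arctan (r / D.ℓ)) + D.ℓ ^ 2 / 2 * (Real.sin (Real.arctan (r / D.ℓ)) ^ 2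
        * ev (D.val D.B i) (Real.arctan (r / D.ℓ)) ^ 2))) := by
    intro i
    simp only [ghat, ev_add _ _ hx.le, ev_mul _ _ hx.le, ev_smul _ _ hx.le, ev_pow _ _ hx.le,
      ev_sinW hx]
    ring
  rw [D.ev_val_eigen _ hj hx, modeMatrix_congr hj fun i hi => D.ev_potAmp hi hx, EYMFields.potW,
    phys_ω_sq (by omega), phys_ω_sq (by omega), phys_ω_sq (by omega), hg, hg, hg]
  simp only [modeMatrix, smul_eq_mul]
  have h3 : gammaCoeff D.N j - 1 / 2 * (gammaCoeff D.N (j + 1) + gammaCoeff D.N (j - 1)) = 1 := by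
    rw [gammaCoeff, gammaCoeff, gammaCoeff, Nat.cast_sub h1]
    push_cast
    ring
  push_cast
  linear_combination -h3

theorem phys_sq_mul_elec {i : ℕ} (hi : i ≤ D.N) (r : ℝ) :
    D.phys.ω i r ^ 2 * D.phys.elec i r = D.ℓ * Real.sin (Real.arctan (r / D.ℓ)) *
      (gammaCoeff D.N i * (ev (D.ym i) (Real.arctan (r / D.ℓ)) ^ 2
        * ev (D.val D.T i) (Real.arctan (r / D.ℓ)))) := by
  have hx := abs_arctan_lt (r / D.ℓ)
  rw [phys_ω, mul_pow, sqrtGamma_sq hi]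
  by_cases hi' : i ∈ Finset.Icc 1 (D.N - 1)
  · rw [phys_elec hi', ev_mul _ _ hx.le, ev_sinW hx]
    ring
  · have h : i = 0 ∨ i = D.N := by
      rw [Finset.mem_Icc] at hi'
      omega
    -- Outside `1, …, N - 1` the mode sums have no meaning; the vanishing weight removes them.
    have h0 : gammaCoeff D.N i = 0 := by
      rcases h with rfl | rfl
      · exact gammaCoeff_zero _
      · exact gammaCoeff_self _
    rw [h0]
    ring

theorem phys_potZ {j : ℕ} (hj : j ∈ Finset.Icc 1 (D.N - 1)) (r : ℝ) :
    D.phys.potZ j r = D.ℓ * Real.sin (Real.arctan (r / D.ℓ)) *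
      (ev (D.val (fun k => ((k : ℝ) * (k + 1)) • D.T k) j) (Real.arctan (r / D.ℓ))
        + D.ℓ ^ 2 * Real.sin (Real.arctan (r / D.ℓ)) ^ 2 * ev (D.val (fun k => ((k : ℝ) * (k + 1)) •
            D.mulA (fun k => (2 : ℝ) • D.potAmp k) D.T k) j) (Real.arctan (r / D.ℓ))) := by
  have hx := abs_arctan_lt (r / D.ℓ)
  obtain ⟨h1, h2⟩ := Finset.mem_Icc.1 hj
  have h3 : ∀ i ∈ Finset.Icc 1 (D.N - 1), ev (D.val (D.mulA (fun k => (2 : ℝ) • D.potAmp k) D.T) i)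
      (Real.arctan (r / D.ℓ)) = 2 * (ev (D.val D.B i) (Real.arctan (r / D.ℓ))
        + D.ℓ ^ 2 / 2 * (Real.sin (Real.arctan (r / D.ℓ)) ^ 2
          * ev (D.val D.B i) (Real.arctan (r / D.ℓ)) ^ 2))
          * ev (D.val D.T i) (Real.arctan (r / D.ℓ)) := by
    intro i hi
    rw [D.ev_val_mulA _ _ hi hx, val_smul, ev_smul _ _ hx.le, D.ev_potAmp hi hx]
  rw [EYMFields.potZ, mul_assoc 2, phys_sq_mul_elec (by omega), phys_sq_mul_elec (by omega),
    phys_sq_mul_elec (by omega), D.ev_val_eigen D.T hj hx, D.ev_val_eigen (D.mulA _ _) hj hx,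
    modeMatrix_congr hj h3, D.ev_ym _ hx, D.ev_ym _ hx, D.ev_ym _ hx]
  simp only [modeMatrix, smul_eq_mul]
  ring

end OriginData

/-! ### Solitons: verification of the field equations. -/

namespace OriginData

open Wiener

variable {D : OriginData} {r : ℝ}

theorem angle_pos (hℓ : 0 < D.ℓ) (hr : 0 < r) : 0 < Real.arctan (r / D.ℓ) :=
  Real.arctan_pos.2 (div_pos hr hℓ)

theorem sin_angle_pos (hℓ : 0 < D.ℓ) (hr : 0 < r) : 0 < Real.sin (Real.arctan (r / D.ℓ)) :=
  Real.sin_pos_of_pos_of_lt_pi (angle_pos hℓ hr)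
    ((Real.arctan_lt_pi_div_two _).trans (by linarith [Real.pi_pos]))

theorem eventually_abs_lt_and_ne {x : ℝ} (hx : |x| < convRadius) (hx0 : x ≠ 0) :
    ∀ᶠ t in 𝓝 x, |t| < convRadius ∧ t ≠ 0 :=
  (eventually_abs_lt hx).and (eventually_ne_nhds hx0)

theorem IsSolution.phys_mu_hasDerivAt (hD : D.IsSolution) (hℓ : 0 < D.ℓ) (hr : 0 < r) :
    HasDerivAt (D.phys.mu 1 D.ℓ) ((D.ℓ * Real.sin (Real.arctan (r / D.ℓ))
        * ev D.nuRate (Real.arctan (r / D.ℓ)) + 2 * ev D.nu (Real.arctan (r / D.ℓ))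
          * Real.sin (Real.arctan (r / D.ℓ)) / Real.cos (Real.arctan (r / D.ℓ))) / D.ℓ) r := by
  have hc : Real.cos (Real.arctan (r / D.ℓ)) ≠ 0 := (Real.cos_arctan_pos _).ne'
  have h1 := (hD.hasDerivAt_nu (abs_arctan_lt (r / D.ℓ)) (sin_angle_pos hℓ hr).ne').div
    ((Real.hasDerivAt_cos _).pow 2) (pow_ne_zero 2 hc)
  have h2 := HasDerivAt.comp r h1 (D.hasDerivAt_angle r)
  refine (h2.congr_deriv ?_).congr_of_eventuallyEq ?_
  · simp only [Pi.pow_apply]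
    field_simp
    push_cast
    ring
  · filter_upwards [eventually_ne_nhds hr.ne'] with t ht
    exact hD.phys_mu t hℓ.ne' ht

theorem IsSolution.phys_S_hasDerivAt (hD : D.IsSolution) (hℓ : D.ℓ ≠ 0)
    (ha : ev D.a (Real.arctan (r / D.ℓ)) ≠ 0) :
    HasDerivAt D.phys.S (D.ℓ * ev D.logS (Real.arctan (r / D.ℓ))
      * Real.sin (Real.arctan (r / D.ℓ)) * Real.cos (Real.arctan (r / D.ℓ)) ^ 2
        / ev D.a (Real.arctan (r / D.ℓ))) r := by
  have h1 := (hD.hasDerivAt_a (abs_arctan_lt (r / D.ℓ))).inv ha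
  have h2 := HasDerivAt.comp r h1 (D.hasDerivAt_angle r)
  refine h2.congr_deriv ?_
  field_simp

theorem IsSolution.fieldEquations (hD : D.IsSolution) (hℓ : 0 < D.ℓ) (hr : 0 < r)
    (ha : ev D.a (Real.arctan (r / D.ℓ)) ≠ 0) :
    D.phys.FieldEquations D.N 1 D.ℓ r := by
  have hl : D.ℓ ≠ 0 := hℓ.ne'
  have hx := abs_arctan_lt (r / D.ℓ)
  have hx0 := (angle_pos hℓ hr).ne'
  have hs := (sin_angle_pos hℓ hr).ne'
  have hc : Real.cos (Real.arctan (r / D.ℓ)) ≠ 0 := (Real.cos_arctan_pos _).ne'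
  have hq := hD.nu_mul_q hx
  have hr0 := hr.ne'
  have hS₁ := hD.phys_S_hasDerivAt hl ha
  have hμ₁ := hD.phys_mu_hasDerivAt hℓ hr
  have hrx := radius_eq hl r
  have hmu := hD.phys_mu r hl hr0
  have hS := D.phys_S r
  have hζ := D.phys_zeta r
  have hP := D.phys_potP r
  have hq' := hD.q_eq' hx
  choose E' hE' hE'' using fun j => (hD.hasDerivAt_electric j hx hx0).2
  have hq2 : ev D.q (Real.arctan (r / D.ℓ)) = (ev D.nu (Real.arctan (r / D.ℓ)))⁻¹ :=
    eq_inv_of_mul_eq_one_right hq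
  have hn : ev D.nu (Real.arctan (r / D.ℓ)) ≠ 0 := left_ne_zero_of_mul_eq_one hq
  have hlogS : D.ℓ * ev D.logS (Real.arctan (r / D.ℓ))
      * Real.sin (Real.arctan (r / D.ℓ)) * Real.cos (Real.arctan (r / D.ℓ)) ^ 2
        / ev D.a (Real.arctan (r / D.ℓ)) / D.phys.S r = D.ℓ * ev D.logS (Real.arctan (r / D.ℓ))
      * Real.sin (Real.arctan (r / D.ℓ)) * Real.cos (Real.arctan (r / D.ℓ)) ^ 2 := by
    rw [hS]
    field_simp
  have hG : ∑ j ∈ Finset.Icc 1 (D.N - 1), (sqrtGamma D.N j * (D.ℓ ^ 2 *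
      (Real.sin (Real.arctan (r / D.ℓ)) * ev (D.val D.DB j) (Real.arctan (r / D.ℓ)))) *
        (Real.cos (Real.arctan (r / D.ℓ)) ^ 2 / D.ℓ)) ^ 2 = D.ℓ ^ 2 *
      Real.sin (Real.arctan (r / D.ℓ)) ^ 2 * Real.cos (Real.arctan (r / D.ℓ)) ^ 4 *
        ev D.gsum (Real.arctan (r / D.ℓ)) := by
    rw [gsum, ev_sum _ _ hx.le, Finset.mul_sum]
    refine Finset.sum_congr rfl fun j hj => ?_
    have hj' : j ≤ D.N := by
      rw [Finset.mem_Icc] at hj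
      omega
    rw [ev_smul _ _ hx.le, ev_pow _ _ hx.le, ← sqrtGamma_sq hj']
    field_simp
  refine EYMFields.fieldEquations_of_hasDerivAt
    (m₁ := D.ℓ * (D.ℓ ^ 2 * (Real.sin (Real.arctan (r / D.ℓ)) ^ 2
      * ev D.massRate (Real.arctan (r / D.ℓ)) * (Real.cos (Real.arctan (r / D.ℓ)) ^ 2 / D.ℓ))))
    (α₁ := fun j => traceless D.N (fun i => D.ℓ * (ev (D.val D.DT i) (Real.arctan (r / D.ℓ))
      * (Real.cos (Real.arctan (r / D.ℓ)) ^ 2 / D.ℓ))) j)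
    (ω₁ := fun j t => sqrtGamma D.N j * (D.ℓ ^ 2 * (Real.sin (Real.arctan (t / D.ℓ)) *
      ev (D.val D.DB j) (Real.arctan (t / D.ℓ)))) * (Real.cos (Real.arctan (t / D.ℓ)) ^ 2 / D.ℓ))
    (ω₂ := fun j => sqrtGamma D.N j * (D.ℓ ^ 2 *
      (ev (D.val (fun k => ((k : ℝ) * (k + 1)) • D.B k) j) (Real.arctan (r / D.ℓ))
        + Real.sin (Real.arctan (r / D.ℓ)) ^ 2 *
          (D.ℓ * ev (D.val D.magSource j) (Real.arctan (r / D.ℓ)))))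
            * (Real.cos (Real.arctan (r / D.ℓ)) ^ 2 / D.ℓ) ^ 2
      + sqrtGamma D.N j * (D.ℓ ^ 2 * (Real.sin (Real.arctan (r / D.ℓ)) *
      ev (D.val D.DB j) (Real.arctan (r / D.ℓ)))) *
      (-2 * Real.sin (Real.arctan (r / D.ℓ)) * Real.cos (Real.arctan (r / D.ℓ)) ^ 3 / D.ℓ ^ 2))
    (E₁ := fun j t => D.ℓ * ev (D.val D.DT j) (Real.arctan (t / D.ℓ))
      * (Real.cos (Real.arctan (t / D.ℓ)) ^ 2 / D.ℓ))
    (E₂ := fun j => D.ℓ * E' j * (Real.cos (Real.arctan (r / D.ℓ)) ^ 2 / D.ℓ) ^ 2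
      + D.ℓ * ev (D.val D.DT j) (Real.arctan (r / D.ℓ)) *
      (-2 * Real.sin (Real.arctan (r / D.ℓ)) * Real.cos (Real.arctan (r / D.ℓ)) ^ 3 / D.ℓ ^ 2))
    ?_ hS₁ hμ₁ ?_ ?_ ?_ ?_ ?_ ?_ ?_
  · exact ((HasDerivAt.comp r (D.hasDerivAt_massInt hx) (D.hasDerivAt_angle r)).const_mul
      (D.ℓ ^ 2)).const_mul D.ℓ
  · intro j _
    exact HasDerivAt.traceless
      (E := fun i t => D.ℓ * ev (sinW * D.val D.T i) (Real.arctan (t / D.ℓ)))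
      (fun i _ => (HasDerivAt.comp (h₂ := ev (sinW * D.val D.T i)) r
        (hD.hasDerivAt_electric i hx hx0).1 (D.hasDerivAt_angle r)).const_mul D.ℓ) j
  · intro j _
    refine hasDerivAt_comp_and_deriv (g := fun y => sqrtGamma D.N j * ev (D.ym j) y)
      (g₁ := fun y => sqrtGamma D.N j * (D.ℓ ^ 2 * (Real.sin y * ev (D.val D.DB j) y))) ?_ ?_
      (Eventually.of_forall fun t => D.hasDerivAt_angle t) (D.hasDerivAt_angle_deriv r)
    · filter_upwards [eventually_abs_lt_and_ne hx hx0] with t ht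
      have h1 := (((hD.hasDerivAt_magnetic j ht.1 ht.2).1.const_mul (D.ℓ ^ 2)).const_add 1).const_mul
        (sqrtGamma D.N j)
      refine h1.congr_of_eventuallyEq ?_
      filter_upwards [eventually_abs_lt ht.1] with y hy
      rw [ym, ev_add _ _ hy.le, ev_one hy.le, ev_smul _ _ hy.le]
    · exact ((hD.hasDerivAt_magnetic j hx hx0).2.const_mul (D.ℓ ^ 2)).const_mul (sqrtGamma D.N j)
  · intro j hj
    rw [show D.phys.elec j = _ from funext fun t => phys_elec hj t]
    refine hasDerivAt_comp_and_deriv (g := fun y => D.ℓ * ev (sinW * D.val D.T j) y)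
      (g₁ := fun y => D.ℓ * ev (D.val D.DT j) y) ?_ ((hE' j).const_mul D.ℓ)
      (Eventually.of_forall fun t => D.hasDerivAt_angle t) (D.hasDerivAt_angle_deriv r)
    filter_upwards [eventually_abs_lt_and_ne hx hx0] with t ht
    exact (hD.hasDerivAt_electric j ht.1 ht.2).1.const_mul D.ℓ
  · have hη : ∑ j ∈ Finset.Icc 1 D.N, traceless D.N (fun i => D.ℓ *
        (ev (D.val D.DT i) (Real.arctan (r / D.ℓ))
          * (Real.cos (Real.arctan (r / D.ℓ)) ^ 2 / D.ℓ))) j ^ 2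
        = ev D.etasum (Real.arctan (r / D.ℓ)) * Real.cos (Real.arctan (r / D.ℓ)) ^ 4 := by
      rw [etasum, ev_sum _ _ hx.le, Finset.sum_mul]
      refine Finset.sum_congr rfl fun j _ => ?_
      rw [ev_pow _ _ hx.le, ev_traceless _ _ _ hx.le]
      have e1 : (fun i => D.ℓ * (ev (D.val D.DT i) (Real.arctan (r / D.ℓ))
          * (Real.cos (Real.arctan (r / D.ℓ)) ^ 2 / D.ℓ)))
          = fun i => ev (D.val D.DT i) (Real.arctan (r / D.ℓ))
            * Real.cos (Real.arctan (r / D.ℓ)) ^ 2 := by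
        funext i
        field_simp
      rw [e1, HorizonData.traceless_mul_const]
      ring
    rw [hη, hG, hζ, hP, hmu, hS, D.ev_massRate hx, hq2]
    generalize Real.arctan (r / D.ℓ) = x at *
    rw [hrx]
    field_simp
  · rw [hlogS, hG, hζ, hmu, hS, D.ev_logS hx, hq2]
    generalize Real.arctan (r / D.ℓ) = x at *
    rw [hrx]
    field_simp
  · intro j hj
    have h1 := hE'' j
    rw [D.ev_elSource j hx] at h1
    rw [hlogS, phys_potZ hj, hmu]
    have hsc := Real.sin_sq_add_cos_sq (Real.arctan (r / D.ℓ))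
    generalize Real.arctan (r / D.ℓ) = x at *
    have hE2 : E' j = (-2 * Real.cos x * Real.sin x * ev (D.val D.DT j) x
        + Real.sin x * ev (D.val (fun k => ((k : ℝ) * (k + 1)) • D.T k) j) x
        + Real.sin x ^ 3 * (D.ℓ * (D.ℓ * ev D.logS x * ev (D.val D.DT j) x
        + D.ℓ * ev D.q x * ev (D.val (fun k => ((k : ℝ) * (k + 1)) •
            D.mulA (fun k => (2 : ℝ) • D.potAmp k) D.T k) j) x
        + ev D.qcorr x * ev (D.val (fun k => ((k : ℝ) * (k + 1)) • D.T k) j) x))) / Real.sin x ^ 2 := by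
      rw [eq_div_iff (pow_ne_zero 2 hs), ← h1]
      ring
    have hν : ev D.nu x = (ev D.q x)⁻¹ := eq_inv_of_mul_eq_one_left hq
    have hqne : ev D.q x ≠ 0 := right_ne_zero_of_mul_eq_one hq
    rw [hE2, hrx, hν]
    generalize ev D.q x = q at *
    -- The difference of the two sides is a combination of `1 + ℓ sin² · qcorr - q` and `sin² + cos²
    -- - 1`, both of which vanish.
    refine sub_eq_zero.1 (Eq.trans (b := Real.cos x ^ 4 / (D.ℓ * Real.sin x)
      * ev (D.val (fun k => ((k : ℝ) * (k + 1)) • D.T k) j) x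
        * (1 + D.ℓ * (Real.sin x ^ 2 * ev D.qcorr x) - q)
      - 2 * Real.cos x ^ 3 * ev (D.val D.DT j) x / (D.ℓ * Real.sin x)
        * (Real.sin x ^ 2 + Real.cos x ^ 2 - 1)) ?_ ?_)
    · field_simp
      ring
    · rw [← hq', hsc]
      ring
  · intro j hj
    rw [hlogS, phys_potW hj, hmu, hS, phys_elec hj, phys_ω, D.ev_magSource hj hx, D.ev_ym _ hx,
      D.ev_potAmp_eigen _ hx, ev_mul _ _ hx.le, ev_sinW hx]
    generalize Real.arctan (r / D.ℓ) = x at *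
    have hν : ev D.nu x = (ev D.q x)⁻¹ := eq_inv_of_mul_eq_one_left hq
    have hqne : ev D.q x ≠ 0 := right_ne_zero_of_mul_eq_one hq
    rw [hrx, hν]
    generalize ev D.q x = q at *
    -- The difference of the two sides is a multiple of `1 + ℓ sin² · qcorr - q`.
    refine sub_eq_zero.1 (Eq.trans (b := sqrtGamma D.N j * Real.cos x ^ 4
      * (ev (D.val (fun k => ((k : ℝ) * (k + 1)) • D.B k) j) x
        + D.ℓ ^ 2 / 2 * (Real.sin x ^ 2 *
          ev (D.val (fun k => ((k : ℝ) * (k + 1)) • D.BB k) j) x))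
        * (1 + D.ℓ * (Real.sin x ^ 2 * ev D.qcorr x) - q)) ?_ ?_)
    · field_simp
      ring
    · rw [← hq']
      ring

end OriginData

/-! ### Solitons: non-triviality. -/

/-- A combination of the eigenvectors is constant only if it is a multiple of the first one. -/
theorem modeVec_eq_zero_of_eq_const {N : ℕ} {c : ℕ → ℝ} {a : ℝ}
    (h : ∀ j ∈ Finset.Icc 1 (N - 1), ∑ i ∈ Finset.Icc 1 (N - 1), c i * modeVec N i j = a) :
    ∀ i ∈ Finset.Icc 2 (N - 1), c i = 0 := by
  intro i hi
  obtain ⟨h1, h2⟩ := Finset.mem_Icc.1 hi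
  have hone : 1 ∈ Finset.Icc 1 (N - 1) := Finset.mem_Icc.2 (by omega)
  have := modeVec_independent (c := fun i => c i - if i = 1 then a else 0) (fun j hj => by
    simp only [sub_mul, Finset.sum_sub_distrib, ite_mul, zero_mul]
    rw [Finset.sum_ite_eq' _ 1, if_pos hone, modeVec_one hj, h j hj]
    ring) i (Finset.mem_Icc.2 (by omega))
  simpa [show i ≠ 1 by omega] using this

namespace EYMFields.IsSoliton

variable {F : EYMFields} {N : ℕ} {ℓ : ℝ} {β θ : ℕ → ℝ}

theorem eq_zero_of_eventually {f : ℝ → ℝ} (hf : ContinuousAt f 0)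
    (h : ∀ᶠ r in 𝓝[>] (0 : ℝ), f r = 0) : f 0 = 0 :=
  tendsto_nhds_unique ((hf.tendsto.mono_left nhdsWithin_le_nhds).congr' h) tendsto_const_nhds

theorem not_isPurelyMagnetic (hF : F.IsSoliton N ℓ β θ)
    (hθ : ∃ i ∈ Finset.Icc 1 (N - 1), θ i ≠ 0) : ¬ F.IsPurelyMagnetic N 0 := fun hm => by
  obtain ⟨-, -, -, b, t, hbt, hmodes⟩ := hF
  obtain ⟨i, hi, hne⟩ := hθ
  refine hne ?_
  rw [← (hbt i hi).2.2.2]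
  refine eq_zero_of_eventually (hbt i hi).2.1.continuousAt ?_
  filter_upwards [self_mem_nhdsWithin, hmodes.filter_mono nhdsWithin_le_nhds] with r hr hr'
  -- At each fixed `r > 0` independence gives `t_i(r) rⁱ = 0`; the power is divided out before
  -- letting `r → 0`.
  have h0 := modeVec_independent (c := fun k => t k r * r ^ k) (fun j hj => by
    rw [← hm.elec_eq_zero hj hr, (hr' j hj).2]
    exact Finset.sum_congr rfl fun k _ => by ring) i hi
  exact (mul_eq_zero.1 h0).resolve_right (pow_ne_zero _ (ne_of_gt hr))

/-- For an embedded field both `ω_j / √γ_j` and `𝓔_j` are independent of `j`. Since `v_1 = 1`, only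
the first mode can then be present at each small `r > 0`, and the limit `r → 0` gives the data. -/
theorem not_isEmbeddedSU2 (hF : F.IsSoliton N ℓ β θ)
    (hne : ∃ i ∈ Finset.Icc 2 (N - 1), β i ≠ 0 ∨ θ i ≠ 0) : ¬ F.IsEmbeddedSU2 N 0 := fun hm => by
  obtain ⟨-, -, -, b, t, hbt, hmodes⟩ := hF
  obtain ⟨i, hi, hne⟩ := hne
  have hi' : i ∈ Finset.Icc 1 (N - 1) := by
    rw [Finset.mem_Icc] at hi ⊢
    omega
  have hβ : β i = 0 := by
    obtain ⟨w, a, hwa⟩ := hm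
    rw [← (hbt i hi').2.2.1]
    refine eq_zero_of_eventually (hbt i hi').1.continuousAt ?_
    filter_upwards [self_mem_nhdsWithin, hmodes.filter_mono nhdsWithin_le_nhds] with r hr hr'
    have h0 := modeVec_eq_zero_of_eq_const (c := fun k => b k r * r ^ (k + 1)) (a := w r - 1)
      (fun j hj => by
        have h1 := (hr' j hj).1
        rw [(hwa r hr).1 j hj] at h1
        have h2 := mul_left_cancel₀ (sqrtGamma_pos hj).ne' h1
        rw [h2, add_sub_cancel_left]
        exact Finset.sum_congr rfl fun k _ => by ring) i hi
    exact (mul_eq_zero.1 h0).resolve_right (pow_ne_zero _ (ne_of_gt hr))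
  have hθ : θ i = 0 := by
    obtain ⟨a, ha⟩ := hm.elec_eq
    rw [← (hbt i hi').2.2.2]
    refine eq_zero_of_eventually (hbt i hi').2.1.continuousAt ?_
    filter_upwards [self_mem_nhdsWithin, hmodes.filter_mono nhdsWithin_le_nhds] with r hr hr'
    have h0 := modeVec_eq_zero_of_eq_const (c := fun k => t k r * r ^ k) (a := a r)
      (fun j hj => by
        rw [← ha r hr j hj, (hr' j hj).2]
        exact Finset.sum_congr rfl fun k _ => by ring) i hi
    exact (mul_eq_zero.1 h0).resolve_right (pow_ne_zero _ (ne_of_gt hr))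
  exact hne.elim (fun h => h hβ) fun h => h hθ

end EYMFields.IsSoliton

/-! ### Solitons: behaviour at the origin and at infinity. -/

namespace OriginData

open Wiener

variable {D : OriginData} {r : ℝ}

theorem isSuN (D : OriginData) : D.phys.IsSuN D.N := fun r => by
  refine ⟨?_, ?_, ?_, ?_, sum_traceless _ _⟩
  · rw [phys_ω, sqrtGamma]
    simp
  · rw [phys_ω, sqrtGamma]
    simp
  · exact traceless_of_notMem _ (by simp)
  · exact traceless_of_notMem _ (by simp)

theorem analyticAt_angle (ℓ r : ℝ) : AnalyticAt ℝ (fun t => Real.arctan (t / ℓ)) r :=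
  AnalyticAt.fun_comp (g := Real.arctan) Real.contDiff_arctan.contDiffAt.analyticAt
    analyticAt_id.div_const

theorem analyticAt_ev_angle (ℓ r : ℝ) (f : Wiener) :
    AnalyticAt ℝ (fun t => ev f (Real.arctan (t / ℓ))) r :=
  AnalyticAt.fun_comp (g := ev f) (analyticAt_ev_right f (abs_arctan_lt _)) (analyticAt_angle ℓ r)

theorem isRegular (ha : ∀ x, |x| < convRadius → 0 < ev D.a x) : D.phys.IsRegular D.N 0 :=
  ⟨fun r _ => analyticAt_const.mul (analyticAt_const.mul (analyticAt_ev_angle D.ℓ r _)),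
    fun r _ => (analyticAt_ev_angle D.ℓ r D.a).inv (ha _ (abs_arctan_lt _)).ne',
    fun _ _ r _ => analyticAt_const.mul (analyticAt_ev_angle D.ℓ r _),
    fun j _ r _ => AnalyticAt.traceless
      (fun _ _ => analyticAt_const.mul (analyticAt_ev_angle D.ℓ r _)) j⟩

theorem IsSolution.ev_a_pi_div_two (hD : D.IsSolution) : ev D.a (Real.pi / 2) = 1 := by
  rw [hD.a_eq, ev_add _ _ abs_pi_div_two_le, ev_one abs_pi_div_two_le,
    ev_smul _ _ abs_pi_div_two_le, ev_neg _ abs_pi_div_two_le, ev_smul _ _ abs_pi_div_two_le,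
    ev_primitive_self]
  ring

theorem abs_pi_div_two_lt : |Real.pi / 2| < convRadius := by
  rw [abs_of_pos (by positivity), convRadius]
  linarith [Real.pi_lt_d2]

/-- In `z = 1 / r` the angle is `π / 2 - arctan (ℓ z)`, analytic through `z = 0`, with cosine
`O(z)`. The factor `cos³` of `logS` makes `dS/dz = O(z³)`. -/
theorem isAsymptoticallyAdS (hD : D.IsSolution) (hℓ : 0 < D.ℓ) :
    D.phys.IsAsymptoticallyAdS D.N := by
  set φ : ℝ → ℝ := fun z => Real.pi / 2 - Real.arctan (D.ℓ * z) with hφ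
  have hφ0 : φ 0 = Real.pi / 2 := by simp [hφ]
  have hφan : ∀ z, AnalyticAt ℝ φ z := fun z => analyticAt_const.sub
    (AnalyticAt.fun_comp (g := Real.arctan) Real.contDiff_arctan.contDiffAt.analyticAt
      (analyticAt_const.mul analyticAt_id))
  have h1 : |φ 0| < convRadius := by
    rw [hφ0]
    exact abs_pi_div_two_lt
  have han : ∀ f : Wiener, AnalyticAt ℝ (fun z => ev f (φ z)) 0 := fun f =>
    AnalyticAt.fun_comp (g := ev f) (analyticAt_ev_right f h1) (hφan 0)
  have ha1 : ev D.a (φ 0) = 1 := by rw [hφ0, hD.ev_a_pi_div_two]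
  have ha0 : ∀ᶠ z in 𝓝 (0 : ℝ), ev D.a (φ z) ≠ 0 :=
    (han D.a).continuousAt.eventually_ne (by rw [ha1]; exact one_ne_zero)
  have hlt : ∀ᶠ z in 𝓝 (0 : ℝ), |φ z| < convRadius :=
    (hφan 0).continuousAt.tendsto.eventually (eventually_abs_lt h1)
  have hφr : ∀ᶠ r in atTop, Real.arctan (r / D.ℓ) = φ r⁻¹ := by
    filter_upwards [eventually_gt_atTop 0] with r hr
    have := Real.arctan_inv_of_pos (x := D.ℓ * r⁻¹) (by positivity)
    refine Eq.trans (congrArg Real.arctan ?_) this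
    field_simp
  refine ⟨fun z => D.ℓ * (D.ℓ ^ 2 * ev (X ^ 3 * D.massInt) (φ z)),
    fun z => (ev D.a (φ z))⁻¹, fun j z => sqrtGamma D.N j * ev (D.ym j) (φ z),
    fun j z => traceless D.N (fun i => D.ℓ * ev (sinW * D.val D.T i) (φ z)) j,
    analyticAt_const.mul (analyticAt_const.mul (han _)), (han _).inv (by rw [ha1]; exact one_ne_zero),
    fun j _ => analyticAt_const.mul (han _),
    fun j _ => AnalyticAt.traceless (fun i _ => analyticAt_const.mul (han _)) j, ?_, ?_⟩
  · have hder : ∀ z, HasDerivAt φ (-(D.ℓ / (1 + (D.ℓ * z) ^ 2))) z := fun z => by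
      have h2 := ((Real.hasDerivAt_arctan (D.ℓ * z)).comp z
        ((hasDerivAt_id z).const_mul D.ℓ)).const_sub (Real.pi / 2)
      refine h2.congr_deriv ?_
      ring
    have hcos : (fun z => Real.cos (φ z)) =O[𝓝 0] fun z : ℝ => z := by
      have h2 : DifferentiableAt ℝ (fun z => Real.cos (φ z)) 0 :=
        Real.differentiable_cos.differentiableAt.fun_comp' _ (hφan 0).differentiableAt
      simpa [hφ0] using h2.isBigO_sub
    refine isBigO_pow_succ_of_hasDerivAt (n := 3)
      (f' := fun z => Real.cos (φ z) ^ 3 * (-(D.ℓ ^ 2 * ((1 / 2 * (ev D.zsum (φ z)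
        * ev D.q (φ z) ^ 2 * ev D.a (φ z) ^ 2) + 2 * ev D.gsum (φ z)) * Real.sin (φ z)
          / ev D.a (φ z)) * (D.ℓ / (1 + (D.ℓ * z) ^ 2))))) ?_ ?_ ?_
    · filter_upwards [ha0, hlt] with z hz hz'
      have h3 := ((HasDerivAt.comp z (hD.hasDerivAt_a hz') (hder z)).inv hz).sub_const 1
      refine h3.congr_deriv ?_
      simp only [Function.comp]
      rw [D.ev_logS hz']
      field_simp
    · simp only [ha1, inv_one, sub_self]
    · have hcont : ContinuousAt (fun z => -(D.ℓ ^ 2 * ((1 / 2 * (ev D.zsum (φ z)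
          * ev D.q (φ z) ^ 2 * ev D.a (φ z) ^ 2) + 2 * ev D.gsum (φ z)) * Real.sin (φ z)
            / ev D.a (φ z)) * (D.ℓ / (1 + (D.ℓ * z) ^ 2)))) 0 := by
        have c1 := (han D.zsum).continuousAt
        have c2 := (han D.q).continuousAt
        have c3 := (han D.a).continuousAt
        have c4 := (han D.gsum).continuousAt
        have c5 := (hφan 0).continuousAt
        have hne : ev D.a (φ 0) ≠ 0 := by rw [ha1]; exact one_ne_zero
        have hne' : 1 + (D.ℓ * 0) ^ 2 ≠ 0 := by simp
        fun_prop (disch := assumption)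
      simpa using (hcos.pow 3).mul (hcont.isBigO_one ℝ)
  · filter_upwards [hφr] with r hr
    refine ⟨?_, ?_, fun j _ => ?_, fun j _ => ?_⟩
    · rw [phys_m, hr]
    · rw [phys_S, hr]
    · rw [phys_ω, hr]
    · simp only [← hr]
      rfl

/-- The grading parameter is `ℓ sin x = r cos x`, so powers of it are powers of `r` times powers of
the cosine, which go into the amplitudes. -/
theorem phys_hasModes (hℓ : D.ℓ ≠ 0) (r : ℝ) :
    D.phys.HasModes D.N r (fun k => D.magAmp k (r / D.ℓ)) (fun k => D.elAmp k (r / D.ℓ)) := by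
  intro j hj
  have hx := abs_arctan_lt (r / D.ℓ)
  have hc : Real.cos (Real.arctan (r / D.ℓ)) ≠ 0 := (Real.cos_arctan_pos _).ne'
  have hrx : r * Real.cos (Real.arctan (r / D.ℓ)) = D.ℓ * Real.sin (Real.arctan (r / D.ℓ)) :=
    (eq_div_iff hc).1 (radius_eq hℓ r)
  constructor
  · rw [phys_ω, D.ev_ym _ hx, D.ev_val _ _ hx, modeSum, Finset.mul_sum, Finset.mul_sum]
    congr 2
    refine Finset.sum_congr rfl fun k hk => ?_
    obtain ⟨k, rfl⟩ := Nat.exists_eq_add_of_le' (Finset.mem_Icc.1 hk).1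
    simp only [magAmp]
    rw [Nat.add_sub_cancel, smul_eq_mul, ← hrx]
    have e : D.ℓ ^ 2 * Real.sin (Real.arctan (r / D.ℓ)) ^ 2
        = (r * Real.cos (Real.arctan (r / D.ℓ))) ^ 2 := by
      rw [hrx]
      ring
    rw [← mul_assoc, e]
    ring
  · rw [phys_elec hj, ev_mul _ _ hx.le, ev_sinW hx, D.ev_val _ _ hx, modeSum, Finset.mul_sum,
      Finset.mul_sum]
    refine Finset.sum_congr rfl fun k hk => ?_
    obtain ⟨k, rfl⟩ := Nat.exists_eq_add_of_le' (Finset.mem_Icc.1 hk).1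
    simp only [elAmp]
    rw [Nat.add_sub_cancel, smul_eq_mul, ← mul_assoc, ← hrx]
    ring

theorem isSoliton (hD : D.IsSolution) (hℓ : 0 < D.ℓ)
    (hn : ∀ x, |x| < convRadius → 0 < ev D.nu x) (ha : ∀ x, |x| < convRadius → 0 < ev D.a x) :
    D.phys.IsSoliton D.N D.ℓ D.β D.θ := by
  have hang : (fun r => Real.arctan (r / D.ℓ)) =O[𝓝 0] fun r : ℝ => r := by
    simpa using (analyticAt_angle D.ℓ 0).differentiableAt.isBigO_sub
  have h00 : |(0 : ℝ)| ≤ convRadius := by simpa using convRadius_pos.le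
  refine ⟨⟨isSuN D, isRegular ha, fun r _ => inv_pos.2 (ha _ (abs_arctan_lt _)), fun r hr => ?_,
    fun r hr => hD.fieldEquations hℓ hr (ha _ (abs_arctan_lt _)).ne', isAsymptoticallyAdS hD hℓ⟩,
    ?_, ?_, fun k r => D.magAmp k (r / D.ℓ), fun k r => D.elAmp k (r / D.ℓ),
    fun k _ => ⟨?_, ?_, ?_, ?_⟩, Eventually.of_forall fun r => phys_hasModes hℓ.ne' r⟩
  · rw [hD.phys_mu r hℓ.ne' hr.ne']
    exact div_pos (hn _ (abs_arctan_lt _)) (pow_pos (Real.cos_arctan_pos _) 2)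
  · have h1 : D.phys.m = fun r => Real.arctan (r / D.ℓ) ^ 3
        * (D.ℓ ^ 3 * ev D.massInt (Real.arctan (r / D.ℓ))) := funext fun r => by
      have hx := abs_arctan_lt (r / D.ℓ)
      rw [phys_m, ev_mul _ _ hx.le, ev_pow _ _ hx.le, ev_X]
      ring
    rw [h1]
    simpa using (hang.pow 3).mul
      ((analyticAt_const.mul (analyticAt_ev_angle D.ℓ 0 D.massInt)).continuousAt.isBigO_one ℝ)
  · refine isBigO_pow_succ_of_hasDerivAt (n := 1)
      (f' := fun r => Real.sin (Real.arctan (r / D.ℓ)) * (D.ℓ * ev D.logS (Real.arctan (r / D.ℓ))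
        * Real.cos (Real.arctan (r / D.ℓ)) ^ 2 / ev D.a (Real.arctan (r / D.ℓ)))) ?_ ?_ ?_
    · refine Eventually.of_forall fun r => ?_
      refine ((hD.phys_S_hasDerivAt hℓ.ne' (ha _ (abs_arctan_lt _)).ne').sub_const _).congr_deriv ?_
      ring
    · simp
    · have hsin : (fun r => Real.sin (Real.arctan (r / D.ℓ))) =O[𝓝 0] fun r : ℝ => r ^ 1 := by
        have h2 : DifferentiableAt ℝ (fun r => Real.sin (Real.arctan (r / D.ℓ))) 0 :=
          Real.differentiable_sin.differentiableAt.fun_comp' _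
            (analyticAt_angle D.ℓ 0).differentiableAt
        simpa using h2.isBigO_sub
      have hcont : ContinuousAt (fun r => D.ℓ * ev D.logS (Real.arctan (r / D.ℓ))
          * Real.cos (Real.arctan (r / D.ℓ)) ^ 2 / ev D.a (Real.arctan (r / D.ℓ))) 0 := by
        have c1 := (analyticAt_ev_angle D.ℓ 0 D.logS).continuousAt
        have c2 := (analyticAt_ev_angle D.ℓ 0 D.a).continuousAt
        have c3 := (analyticAt_angle D.ℓ 0).continuousAt
        have hne : ev D.a (Real.arctan (0 / D.ℓ)) ≠ 0 := (ha _ (abs_arctan_lt _)).ne'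
        fun_prop (disch := assumption)
      simpa using hsin.mul (hcont.isBigO_one ℝ)
  · exact (analyticAt_ev_angle D.ℓ 0 _).mul ((AnalyticAt.fun_comp (g := Real.cos)
      Real.contDiff_cos.contDiffAt.analyticAt (analyticAt_angle D.ℓ 0)).pow _)
  · exact (analyticAt_ev_angle D.ℓ 0 _).mul ((AnalyticAt.fun_comp (g := Real.cos)
      Real.contDiff_cos.contDiffAt.analyticAt (analyticAt_angle D.ℓ 0)).pow _)
  · simp [magAmp, B, ev_add _ _ h00, ev_algebraMap _ h00, ev_mul _ _ h00, ev_pow _ _ h00, ev_X]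
  · simp [elAmp, T, ev_add _ _ h00, ev_algebraMap _ h00, ev_mul _ _ h00, ev_pow _ _ h00, ev_X]

end OriginData

/-! ### Solitons: analyticity of the right-hand sides. -/

section Modes

variable {V A : Type*} [NormedAddCommGroup V] [NormedSpace ℝ V] [NormedCommRing A]
  [NormedAlgebra ℝ A] {N : ℕ} {n : WithTop ℕ∞} {z : V → A} {c d : V → ℕ → A}

@[fun_prop]
theorem ContDiff.modeSum (hz : ContDiff ℝ n z) (hc : ∀ k, ContDiff ℝ n fun x => c x k) (j : ℕ) :
    ContDiff ℝ n fun x => modeSum N (z x) (c x) j :=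
  ContDiff.sum fun k _ => ((hz.pow _).mul (hc k)).const_smul _

@[fun_prop]
theorem ContDiff.modeMul (hz : ContDiff ℝ n z) (hc : ∀ k, ContDiff ℝ n fun x => c x k)
    (hd : ∀ k, ContDiff ℝ n fun x => d x k) (i : ℕ) :
    ContDiff ℝ n fun x => modeMul N (z x) (c x) (d x) i :=
  ContDiff.sum fun k _ => ContDiff.sum fun l _ =>
    ((hz.pow _).mul ((hc k).mul (hd l))).const_smul _

end Modes

namespace OriginData

open Wiener

/-- The space of unknowns. -/
abbrev State (N : ℕ) : Type :=
  Wiener × Wiener × Wiener × (Finset.Icc 1 (N - 1) → Wiener) × (Finset.Icc 1 (N - 1) → Wiener)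

/-- The space of parameters and unknowns. -/
abbrev Config (N : ℕ) : Type := ℝ × (Finset.Icc 1 (N - 1) → ℝ) × State N

/-- The data with given parameters and unknowns. -/
noncomputable def ofState (N : ℕ) (β : ℕ → ℝ) (v : Config N) : OriginData where
  N := N
  β := β
  θ := fun j => extendZero v.2.1 j
  ℓ := v.1
  M := v.2.2.1
  q := v.2.2.2.1
  a := v.2.2.2.2.1
  h := fun j => extendZero v.2.2.2.2.2.1 j
  g := fun j => extendZero v.2.2.2.2.2.2 j

section ContDiff

variable (N : ℕ) (β : ℕ → ℝ)

theorem contDiff_grade : ContDiff ℝ ⊤ fun v => (ofState N β v).grade := by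
  simp only [grade, ofState]
  fun_prop

theorem contDiff_B (k : ℕ) : ContDiff ℝ ⊤ fun v => (ofState N β v).B k := by
  simp only [B, ofState]
  fun_prop

theorem contDiff_T (k : ℕ) : ContDiff ℝ ⊤ fun v => (ofState N β v).T k := by
  simp only [T, ofState, Algebra.algebraMap_eq_smul_one]
  fun_prop

theorem contDiff_DB (k : ℕ) : ContDiff ℝ ⊤ fun v => (ofState N β v).DB k := by
  have h1 := contDiff_B N β
  simp only [DB]
  simp only [ofState] at h1 ⊢
  fun_prop

theorem contDiff_DT (k : ℕ) : ContDiff ℝ ⊤ fun v => (ofState N β v).DT k := by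
  have h1 := contDiff_T N β
  simp only [DT]
  simp only [ofState] at h1 ⊢
  fun_prop

variable {N} in
theorem contDiff_val {c : Config N → ℕ → Wiener} (hc : ∀ k, ContDiff ℝ ⊤ fun v => c v k) (j : ℕ) :
    ContDiff ℝ ⊤ fun v => (ofState N β v).val (c v) j :=
  (contDiff_grade N β).modeSum hc j

variable {N} in
theorem contDiff_mulA {c d : Config N → ℕ → Wiener} (hc : ∀ k, ContDiff ℝ ⊤ fun v => c v k)
    (hd : ∀ k, ContDiff ℝ ⊤ fun v => d v k) (i : ℕ) :
    ContDiff ℝ ⊤ fun v => (ofState N β v).mulA (c v) (d v) i :=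
  (contDiff_grade N β).modeMul hc hd i

theorem contDiff_ym (j : ℕ) : ContDiff ℝ ⊤ fun v => (ofState N β v).ym j := by
  have h1 := contDiff_val β (contDiff_B N β)
  simp only [ym]
  simp only [ofState] at h1 ⊢
  fun_prop

theorem contDiff_zsum : ContDiff ℝ ⊤ fun v => (ofState N β v).zsum := by
  have h1 := contDiff_ym N β
  have h2 := contDiff_val β (contDiff_T N β)
  show ContDiff ℝ ⊤ fun v => ∑ j ∈ Finset.Icc 1 (N - 1),
    gammaCoeff N j • ((ofState N β v).ym j ^ 2 * (ofState N β v).val (ofState N β v).T j ^ 2)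
  fun_prop

theorem contDiff_gsum : ContDiff ℝ ⊤ fun v => (ofState N β v).gsum := by
  have h2 := contDiff_val β (contDiff_DB N β)
  show ContDiff ℝ ⊤ fun v => ∑ j ∈ Finset.Icc 1 (N - 1),
    gammaCoeff N j • (ofState N β v).val (ofState N β v).DB j ^ 2
  fun_prop

theorem contDiff_etasum : ContDiff ℝ ⊤ fun v => (ofState N β v).etasum := by
  have h2 := contDiff_val β (contDiff_DT N β)
  show ContDiff ℝ ⊤ fun v => ∑ j ∈ Finset.Icc 1 N,
    traceless N ((ofState N β v).val (ofState N β v).DT) j ^ 2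
  fun_prop

theorem contDiff_ghat (j : ℕ) : ContDiff ℝ ⊤ fun v => (ofState N β v).ghat j := by
  have h1 := contDiff_val β (contDiff_B N β)
  simp only [ghat]
  simp only [ofState] at h1 ⊢
  fun_prop

theorem contDiff_psum : ContDiff ℝ ⊤ fun v => (ofState N β v).psum := by
  have h1 := contDiff_ghat N β
  show ContDiff ℝ ⊤ fun v => ∑ j ∈ Finset.Icc 1 N,
    ((ofState N β v).ghat j - (ofState N β v).ghat (j - 1)) ^ 2
  fun_prop

theorem contDiff_nu : ContDiff ℝ ⊤ fun v => (ofState N β v).nu := by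
  simp only [nu, ofState]
  fun_prop

theorem contDiff_massRate : ContDiff ℝ ⊤ fun v => (ofState N β v).massRate := by
  have h1 := contDiff_zsum N β
  have h2 := contDiff_gsum N β
  have h3 := contDiff_etasum N β
  have h4 := contDiff_psum N β
  have h5 := contDiff_nu N β
  simp only [massRate]
  simp only [ofState] at h1 h2 h3 h4 h5 ⊢
  fun_prop

theorem contDiff_massInt : ContDiff ℝ ⊤ fun v => (ofState N β v).massInt := by
  have h1 := contDiff_massRate N β
  simp only [massInt]
  fun_prop

theorem contDiff_logS : ContDiff ℝ ⊤ fun v => (ofState N β v).logS := by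
  have h1 := contDiff_zsum N β
  have h2 := contDiff_gsum N β
  simp only [logS]
  simp only [ofState] at h1 h2 ⊢
  fun_prop

theorem contDiff_qcorr : ContDiff ℝ ⊤ fun v => (ofState N β v).qcorr := by
  simp only [qcorr, ofState]
  fun_prop

theorem contDiff_nuRate : ContDiff ℝ ⊤ fun v => (ofState N β v).nuRate := by
  have h1 := contDiff_massRate N β
  simp only [nuRate]
  simp only [ofState] at h1 ⊢
  fun_prop

theorem contDiff_BB (k : ℕ) : ContDiff ℝ ⊤ fun v => (ofState N β v).BB k :=
  contDiff_mulA β (contDiff_B N β) (contDiff_B N β) k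

theorem contDiff_potAmp (k : ℕ) : ContDiff ℝ ⊤ fun v => (ofState N β v).potAmp k := by
  have h1 := contDiff_B N β
  have h2 := contDiff_BB N β
  simp only [potAmp]
  simp only [ofState] at h1 h2 ⊢
  fun_prop

theorem contDiff_magSource (k : ℕ) : ContDiff ℝ ⊤ fun v => (ofState N β v).magSource k := by
  have h1 := contDiff_DB N β
  have h2 := contDiff_logS N β
  have h3 := contDiff_nuRate N β
  have h4 := contDiff_mulA β (contDiff_T N β) (contDiff_T N β)
  have h5 := contDiff_mulA β (contDiff_B N β) h4
  have h6 := contDiff_BB N β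
  have h7 := contDiff_potAmp N β
  have h8 := contDiff_mulA β (fun k => (h7 k).const_smul ((k : ℝ) * (k + 1))) (contDiff_B N β)
  have h9 := contDiff_qcorr N β
  have hl : ContDiff ℝ ⊤ fun v => (ofState N β v).ℓ := contDiff_fst
  have hq : ContDiff ℝ ⊤ fun v => (ofState N β v).q := by
    simp only [ofState]
    fun_prop
  have ha : ContDiff ℝ ⊤ fun v => (ofState N β v).a := by
    simp only [ofState]
    fun_prop
  exact (((((hl.smul h2).add (h3.mul hq)).neg.mul (h1 k)).add
    (((hl.div_const 4).smul ((hq.pow 2).mul (ha.pow 2))).neg.mul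
      ((h4 k).add (((hl.pow 2).smul contDiff_const).mul (h5 k))))).add
        ((hl.div_const 2).smul ((h6 k).const_smul _))).add ((hl.smul hq).mul (h8 k)) |>.add
          (h9.mul ((h7 k).const_smul _))

theorem contDiff_elSource (k : ℕ) : ContDiff ℝ ⊤ fun v => (ofState N β v).elSource k := by
  have h1 := contDiff_DT N β
  have h2 := contDiff_logS N β
  have h3 := contDiff_T N β
  have h4 := contDiff_potAmp N β
  have h5 := contDiff_mulA β (fun k => (h4 k).const_smul (2 : ℝ)) h3
  have h6 := contDiff_qcorr N β
  simp only [elSource]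
  simp only [ofState] at h1 h2 h3 h4 h5 h6 ⊢
  fun_prop

/-- The right hand side of the integrated field equations, without the leading order. -/
noncomputable def rhs (v : Config N) : State N :=
  let D := ofState N β v
  (invSincW ^ 3 * D.massInt, sinW ^ 2 * D.qcorr,
    -(v.1 • primitive (Real.pi / 2) abs_pi_div_two_le (D.a * D.logS * sinW)),
    (fun k => D.magSource k), fun k => D.elSource k)

theorem contDiff_rhs : ContDiff ℝ ⊤ (rhs N β) := by
  have h1 := contDiff_massInt N β
  have h2 := contDiff_qcorr N β
  have h3 := contDiff_logS N β
  have h4 := contDiff_magSource N β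
  have h5 := contDiff_elSource N β
  show ContDiff ℝ ⊤ fun v => rhs N β v
  simp only [rhs]
  simp only [ofState] at h1 h2 h3 h4 h5 ⊢
  refine ContDiff.prodMk (by fun_prop) (ContDiff.prodMk (by fun_prop) (ContDiff.prodMk
    (by fun_prop) (ContDiff.prodMk ?_ ?_)))
  · exact contDiff_pi.2 fun k => h4 k
  · exact contDiff_pi.2 fun k => h5 k

/-- The leading order of the integrated field equations. -/
noncomputable def leading (p : Finset.Icc 1 (N - 1) → ℝ) : State N :=
  (0, 1, 1, (fun k => (((k : ℕ) + 1 : ℝ) ^ 2 * β k) • (1 : Wiener)),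
    fun k => (((k : ℕ) : ℝ) * ((k : ℕ) + 2) * p k) • (1 : Wiener))

theorem contDiff_leading : ContDiff ℝ ⊤ (leading N β) := by
  show ContDiff ℝ ⊤ fun p => leading N β p
  simp only [leading]
  refine ContDiff.prodMk (by fun_prop) (ContDiff.prodMk (by fun_prop) (ContDiff.prodMk
    (by fun_prop) (ContDiff.prodMk (by fun_prop) ?_)))
  exact contDiff_pi.2 fun k => by fun_prop

/-- The operator `1 - modeOp` as an equivalence. -/
noncomputable def modeEquiv (k : ℕ) (c : ℝ) : Wiener ≃L[ℝ] Wiener :=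
  ContinuousLinearEquiv.unitsEquiv ℝ Wiener (isUnit_one_sub_modeOp (p := 2 * k + 3) (by omega) c
    ((-(2 * ((k : ℝ) + 1))) • cotW)).unit

/-- The linear part of the integrated field equations. -/
noncomputable def linearPart : State N ≃L[ℝ] State N :=
  (ContinuousLinearEquiv.refl ℝ Wiener).prodCongr ((ContinuousLinearEquiv.refl ℝ Wiener).prodCongr
    ((ContinuousLinearEquiv.refl ℝ Wiener).prodCongr
      ((ContinuousLinearEquiv.piCongrRight fun k : Finset.Icc 1 (N - 1) =>
          modeEquiv k (((k : ℕ) + 1 : ℝ) ^ 2)).prodCongr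
        (ContinuousLinearEquiv.piCongrRight fun k : Finset.Icc 1 (N - 1) =>
          modeEquiv k (((k : ℕ) : ℝ) * ((k : ℕ) + 2))))))

theorem isSolution_ofState {ℓ : ℝ} {p : Finset.Icc 1 (N - 1) → ℝ} {u : State N}
    (hu : linearPart N u = leading N β p + ℓ • rhs N β (ℓ, p, u)) :
    (ofState N β (ℓ, p, u)).IsSolution where
  M_eq := (congrArg (fun z => z.1) hu).trans (zero_add _)
  q_eq := congrArg (fun z => z.2.1) hu
  a_eq := congrArg (fun z => z.2.2.1) hu
  h_eq := fun k hk => by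
    have := congrFun (congrArg (fun z => z.2.2.2.1) hu) ⟨k, hk⟩
    have hk' : k ∈ Finset.Icc 1 (N - 1) := hk
    simp only [ofState, extendZero_of_mem _ hk']
    exact this
  g_eq := fun k hk => by
    have := congrFun (congrArg (fun z => z.2.2.2.2) hu) ⟨k, hk⟩
    have hk' : k ∈ Finset.Icc 1 (N - 1) := hk
    simp only [ofState, extendZero_of_mem _ hk']
    exact this

end ContDiff

end OriginData

/-! ### Solitons: existence. -/

namespace OriginData

open Wiener

theorem isAnalyticFamily {N : ℕ} (β : ℕ → ℝ) (p : Finset.Icc 1 (N - 1) → ℝ) {U : ℝ → State N}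
    {δ : ℝ} (hU : ∀ ℓ ∈ Ioo (-δ) δ, AnalyticAt ℝ U ℓ)
    (ha : ∀ ℓ ∈ Ioo (-δ) δ, ∀ x, |x| < convRadius → 0 < ev (U ℓ).2.2.1 x) :
    EYMFields.IsAnalyticFamily (fun ℓ => (ofState N β (ℓ, p, U ℓ)).fields) N δ 0 ∧
    ∀ k, AnalyticOnNhd ℝ (fun z : ℝ × ℝ => (ofState N β (z.1, p, U z.1)).magAmp k z.2)
        (Ioo (-δ) δ ×ˢ Ici 0) ∧
      AnalyticOnNhd ℝ (fun z : ℝ × ℝ => (ofState N β (z.1, p, U z.1)).elAmp k z.2)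
        (Ioo (-δ) δ ×ˢ Ici 0) := by
  have hatan : ∀ z : ℝ × ℝ, AnalyticAt ℝ (fun z : ℝ × ℝ => Real.arctan z.2) z := fun z =>
    AnalyticAt.fun_comp (g := Real.arctan) Real.contDiff_arctan.contDiffAt.analyticAt analyticAt_snd
  have hcos : ∀ z : ℝ × ℝ, AnalyticAt ℝ (fun z : ℝ × ℝ => Real.cos (Real.arctan z.2)) z := fun z =>
    AnalyticAt.fun_comp (g := Real.cos) Real.contDiff_cos.contDiffAt.analyticAt (hatan z)
  have key : ∀ f : Config N → Wiener, ContDiff ℝ ⊤ f → ∀ z ∈ Ioo (-δ) δ ×ˢ Ici (0 : ℝ),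
      AnalyticAt ℝ (fun z : ℝ × ℝ => ev (f (z.1, p, U z.1)) (Real.arctan z.2)) z := by
    rintro f hf z ⟨hz1, -⟩
    have h1 : AnalyticAt ℝ (fun z : ℝ × ℝ => U z.1) z :=
      AnalyticAt.fun_comp (g := U) (hU z.1 hz1) analyticAt_fst
    have h2 : AnalyticAt ℝ (fun z : ℝ × ℝ => f (z.1, p, U z.1)) z :=
      AnalyticAt.fun_comp (g := f) (f := fun z : ℝ × ℝ => (z.1, p, U z.1)) hf.contDiffAt.analyticAt
        (analyticAt_fst.prod (analyticAt_const.prod h1))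
    exact AnalyticAt.fun_comp (g := fun q : Wiener × ℝ => ev q.1 q.2)
      (f := fun z : ℝ × ℝ => (f (z.1, p, U z.1), Real.arctan z.2))
      (analyticAt_ev _ (abs_arctan_lt _)) (h2.prod (hatan z))
  refine ⟨⟨fun z hz => ?_, fun z hz => ?_, fun j _ z hz => ?_, fun j _ z hz => ?_⟩,
    fun k => ⟨fun z hz => ?_, fun z hz => ?_⟩⟩
  · exact (analyticAt_fst.pow 2).mul (key (fun v => X ^ 3 * (ofState N β v).massInt)
      (contDiff_const.mul (contDiff_massInt N β)) z hz)
  · exact (key (fun v => v.2.2.2.2.1) (by fun_prop) z hz).inv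
      (ha z.1 hz.1 _ (abs_arctan_lt _)).ne'
  · exact (analyticAt_const (v := sqrtGamma N j)).mul (key _ (contDiff_ym N β j) z hz)
  · exact AnalyticAt.traceless (fun i _ => analyticAt_fst.mul
      (key (fun v => sinW * (ofState N β v).val (ofState N β v).T i)
        (contDiff_const.mul (contDiff_val β (contDiff_T N β) i)) z hz)) j
  · exact (key _ (contDiff_B N β k) z hz).mul ((hcos z).pow _)
  · exact (key _ (contDiff_T N β k) z hz).mul ((hcos z).pow _)

theorem ev_pos_of_norm_sub_one_lt {f : Wiener} {x : ℝ} (hx : |x| < convRadius)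
    (h : ‖f - 1‖ < 1) : 0 < ev f x := by
  have h1 := (abs_ev_le (f - 1) hx.le).trans_lt h
  rw [ev_sub _ _ hx.le, ev_one hx.le] at h1
  linarith [(abs_lt.1 h1).1]

/-- Existence of solitons for small `ℓ`. -/
theorem exists_soliton (N : ℕ) (hN : 2 ≤ N) (β : ℕ → ℝ) :
    ∃ ε > (0 : ℝ), ∃ ℓ₀ > (0 : ℝ), ∀ (θ : ℕ → ℝ), (∀ i ∈ Finset.Icc 1 (N - 1), |θ i| < ε) →
      ∃ (G : ℝ → EYMFields) (b t : ℕ → ℝ → ℝ → ℝ), EYMFields.IsAnalyticFamily G N ℓ₀ 0 ∧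
        (∀ i ∈ Finset.Icc 1 (N - 1),
          AnalyticOnNhd ℝ (fun p : ℝ × ℝ => b i p.1 p.2) (Set.Ioo (-ℓ₀) ℓ₀ ×ˢ Set.Ici 0) ∧
          AnalyticOnNhd ℝ (fun p : ℝ × ℝ => t i p.1 p.2) (Set.Ioo (-ℓ₀) ℓ₀ ×ˢ Set.Ici 0)) ∧
        ∀ ℓ ∈ Set.Ioo 0 ℓ₀, ∃ F : EYMFields, F = EYMFields.ofSolitonScaling ℓ (G ℓ) ∧
          F.IsSoliton N ℓ β θ ∧
          (∀ r, 0 ≤ r → F.HasModes N r (fun i => b i ℓ (r / ℓ)) (fun i => t i ℓ (r / ℓ))) ∧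
          F.IsNodeless {j | j ∈ Finset.Icc 1 (N - 1)} 0 ∧
          ((∃ i ∈ Finset.Icc 1 (N - 1), θ i ≠ 0) → ¬ F.IsPurelyMagnetic N 0) ∧
          ¬ F.IsAbelian N 0 ∧
          ((∃ i ∈ Finset.Icc 2 (N - 1), β i ≠ 0 ∨ θ i ≠ 0) → ¬ F.IsEmbeddedSU2 N 0) := by
  -- Open conditions that give `ν > 0`, `a > 0` and `ω_j > 0` on the whole disc. At `ℓ = 0` the
  -- series `nu` and `ym` equal `1` whatever the amplitudes, so arbitrary `β` is allowed.
  set O : Set (Config N) := {y | ‖(ofState N β y).nu - 1‖ < 1 ∧ ‖y.2.2.2.2.1 - 1‖ < 1 ∧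
    ∀ j : Finset.Icc 1 (N - 1), ‖(ofState N β y).ym j - 1‖ < 1} with hOdef
  set u₀ : State N := (linearPart N).symm (leading N β 0) with hu₀
  have hO : O ∈ 𝓝 ((0 : ℝ), (0 : Finset.Icc 1 (N - 1) → ℝ), u₀) := by
    refine Filter.Eventually.and ?_ (Filter.Eventually.and ?_ (eventually_all.2 fun j => ?_))
    · refine ContinuousAt.eventually_lt (((contDiff_nu N β).continuous.sub
        continuous_const).norm.continuousAt) continuousAt_const ?_
      simp [nu, ofState]
    · refine ContinuousAt.eventually_lt (by fun_prop) continuousAt_const ?_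
      have h1 : linearPart N u₀ = leading N β 0 := (linearPart N).apply_symm_apply _
      have h2 : u₀.2.2.1 = 1 := congrArg (fun z => z.2.2.1) h1
      simp only [h2, sub_self, norm_zero, zero_lt_one]
    · refine ContinuousAt.eventually_lt (((contDiff_ym N β j).continuous.sub
        continuous_const).norm.continuousAt) continuousAt_const ?_
      simp [ym, ofState]
  obtain ⟨δ, hδ, U, hU, hsol⟩ := exists_analytic_solution (linearPart N) (leading N β)
    (contDiff_leading N β) (rhs N β) (contDiff_rhs N β) O hO
  refine ⟨δ, hδ, δ, hδ, fun θ hθ => ?_⟩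
  set p : Finset.Icc 1 (N - 1) → ℝ := fun j => θ j with hp
  have hball : ∀ ℓ ∈ Ioo (-δ) δ, (ℓ, p) ∈ Metric.ball (0 : ℝ × (Finset.Icc 1 (N - 1) → ℝ)) δ := by
    intro ℓ hℓ
    rw [mem_ball_zero_iff, Prod.norm_def, max_lt_iff]
    exact ⟨abs_lt.2 hℓ, (pi_norm_lt_iff hδ).2 fun j => hθ j j.2⟩
  have hU' : ∀ ℓ ∈ Ioo (-δ) δ, AnalyticAt ℝ (fun ℓ => U (ℓ, p)) ℓ := fun ℓ hℓ =>
    AnalyticAt.fun_comp (g := U) (f := fun ℓ : ℝ => (ℓ, p)) (hU _ (hball ℓ hℓ))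
      (analyticAt_id.prod analyticAt_const)
  have ha : ∀ ℓ ∈ Ioo (-δ) δ, ∀ x, |x| < convRadius → 0 < ev (U (ℓ, p)).2.2.1 x := fun ℓ hℓ x hx =>
    ev_pos_of_norm_sub_one_lt hx (hsol _ (hball ℓ hℓ)).2.2.1
  obtain ⟨hfam, hamp⟩ := isAnalyticFamily β p hU' ha
  refine ⟨_, fun i ℓ x => (ofState N β (ℓ, p, U (ℓ, p))).magAmp i x,
    fun i ℓ x => (ofState N β (ℓ, p, U (ℓ, p))).elAmp i x, hfam, fun i _ => hamp i, fun ℓ hℓ => ⟨_, rfl, ?_⟩⟩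
  have hℓ' : ℓ ∈ Ioo (-δ) δ := ⟨by linarith [hℓ.1], hℓ.2⟩
  obtain ⟨heq, hn, -, hw⟩ := hsol _ (hball ℓ hℓ')
  set D := ofState N β (ℓ, p, U (ℓ, p)) with hDdef
  have hD : D.IsSolution := isSolution_ofState N β heq
  have hsolit : D.phys.IsSoliton N ℓ β θ := by
    obtain ⟨h1, h2, h3, b, t, hbt, h4⟩ := isSoliton hD hℓ.1
      (fun x hx => ev_pos_of_norm_sub_one_lt hx hn) (ha ℓ hℓ')
    refine ⟨h1, h2, h3, b, t, fun i hi => ?_, h4⟩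
    have h5 : D.θ i = θ i := extendZero_of_mem p hi
    rw [← h5]
    exact hbt i hi
  have hnodes : D.phys.IsNodeless {j | j ∈ Finset.Icc 1 (N - 1)} 0 := fun j hj r _ =>
    (mul_pos (sqrtGamma_pos hj) (ev_pos_of_norm_sub_one_lt (abs_arctan_lt _) (hw ⟨j, hj⟩))).ne'
  refine ⟨hsolit, fun r _ => phys_hasModes (D := D) hℓ.1.ne' r, hnodes, hsolit.not_isPurelyMagnetic,
    fun hm => ?_, hsolit.not_isEmbeddedSU2⟩
  have hone : 1 ∈ Finset.Icc 1 (N - 1) := Finset.mem_Icc.2 (by omega)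
  exact hnodes 1 hone 1 zero_le_one (hm 1 hone 1 one_pos)

end OriginData

theorem mainTheorem3 (N : ℕ) (hN : 2 ≤ N) :
    (∀ (k : ℤ), k = -1 ∨ k = 0 ∨ k = 1 → ∀ (rh : ℝ), 0 < rh → ∀ (w : ℕ → ℝ),
      ∃ ε > (0 : ℝ), ∃ ℓ₀ > (0 : ℝ), ∀ (e : ℕ → ℝ), (∀ j ∈ Finset.Icc 1 (N - 1), |e j| < ε) →
        ∃ G : ℝ → EYMFields, EYMFields.IsAnalyticFamily G N ℓ₀ rh ∧
          ∀ ℓ ∈ Set.Ioo 0 ℓ₀, ∃ F : EYMFields, F = EYMFields.ofBlackHoleScaling ℓ (G ℓ) ∧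
            F.IsBlackHole N k ℓ rh w e ∧
            F.IsNodeless {j | j ∈ Finset.Icc 1 (N - 1) ∧ w j ≠ 0} rh ∧
            ((∃ j ∈ Finset.Icc 1 (N - 1), e j ≠ 0) → ¬ F.IsPurelyMagnetic N rh) ∧
            ((∃ j ∈ Finset.Icc 1 (N - 1), w j ≠ 0) → ¬ F.IsAbelian N rh) ∧
            ((¬ ∃ c d : ℝ, ∀ j ∈ Finset.Icc 1 (N - 1), w j = sqrtGamma N j * c ∧ e j = d) →
              ¬ F.IsEmbeddedSU2 N rh)) ∧
    (∀ (β : ℕ → ℝ),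
      ∃ ε > (0 : ℝ), ∃ ℓ₀ > (0 : ℝ), ∀ (θ : ℕ → ℝ), (∀ i ∈ Finset.Icc 1 (N - 1), |θ i| < ε) →
        ∃ (G : ℝ → EYMFields) (b t : ℕ → ℝ → ℝ → ℝ), EYMFields.IsAnalyticFamily G N ℓ₀ 0 ∧
          (∀ i ∈ Finset.Icc 1 (N - 1),
            AnalyticOnNhd ℝ (fun p : ℝ × ℝ => b i p.1 p.2) (Set.Ioo (-ℓ₀) ℓ₀ ×ˢ Set.Ici 0) ∧
            AnalyticOnNhd ℝ (fun p : ℝ × ℝ => t i p.1 p.2) (Set.Ioo (-ℓ₀) ℓ₀ ×ˢ Set.Ici 0)) ∧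
          ∀ ℓ ∈ Set.Ioo 0 ℓ₀, ∃ F : EYMFields, F = EYMFields.ofSolitonScaling ℓ (G ℓ) ∧
            F.IsSoliton N ℓ β θ ∧
            (∀ r, 0 ≤ r → F.HasModes N r (fun i => b i ℓ (r / ℓ)) (fun i => t i ℓ (r / ℓ))) ∧
            F.IsNodeless {j | j ∈ Finset.Icc 1 (N - 1)} 0 ∧
            ((∃ i ∈ Finset.Icc 1 (N - 1), θ i ≠ 0) → ¬ F.IsPurelyMagnetic N 0) ∧
            ¬ F.IsAbelian N 0 ∧
            ((∃ i ∈ Finset.Icc 2 (N - 1), β i ≠ 0 ∨ θ i ≠ 0) → ¬ F.IsEmbeddedSU2 N 0)) :=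
  ⟨fun k _ rh h0 w => HorizonData.exists_blackHole N hN k rh h0 w,
    OriginData.exists_soliton N hN⟩
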